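/- Let $\lambda\in(0,1]$ and $\alpha\ge 0$. For a non-increasing sequence $m=(m_k)_{k\ge1}$ in $[0,\infty)$ put $\|m\|_p=\sum_k m_k^p$, let $\ell_\lambda=\{m:\|m\|_\lambda<\infty\}$, equipped with the distance $\delta_\lambda(m,\tilde m)=\sum_k|m_k^\lambda-\tilde m_k^\lambda|$, and let $\ell_{0+}$ be the set of such sequences having a zero entry (finite particle systems). Let $K:[0,\infty)^2\to[0,\infty)$ be symmetric, bounded on compact subsets of $(0,\infty)^2$, and such that for every $a>0$ there is $\kappa_a>0$ with $|K(x,y)-K(\tilde x,\tilde y)|\le\kappa_a\left(|x^\lambda-\tilde x^\lambda|+|y^\lambda-\tilde y^\lambda|\right)$ for $x,y,\tilde x,\tilde y\in(0,a]$. Let $F:[0,\infty)\to[0,\infty)$ be bounded on compact subsets of $(0,\infty)$ and such that for every $a>0$ there is $\mu_a>0$ with $|F(x)-F(\tilde x)|\le\mu_a|x^\alpha-\tilde x^\alpha|$ for $x,\tilde x\in(0,a]$. By convention $K(x,0)=0$ for all $x$ and $F(0)=0$. Let $\Theta=\{\theta=(\theta_k)_{k\ge1}:1>\theta_1\ge\theta_2\ge\dots\ge0\}$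 and let $\beta$ be a measure on $\Theta$ with $\beta(\sum_k\theta_k>1)=0$ and $$C_\beta^\lambda:=\int_\Theta\Big[\sum_{k\ge2}\theta_k^\lambda+(1-\theta_1)^\lambda\Big]\beta(d\theta)<\infty .$$ Assume moreover that $\beta(\Theta)<\infty$ and that for some $k$, $\theta_{k+1}=\theta_{k+2}=\dots=0$ for $\beta$-almost every $\theta$. For $m\in\ell_\lambda$ and $i<j$ let $c_{ij}(m)$ be the decreasing rearrangement of $m$ with $m_i,m_j$ replaced by the single mass $m_i+m_j$, and let $f_{i\theta}(m)$ be the decreasing rearrangement of $m$ with $m_i$ replaced by the masses $\theta_1m_i,\theta_2m_i,\dots$. Let $\mathcal N(ds,d(i,j),dz)$ and $\mathcal M(ds,di,d\theta,dz)$ be independent Poisson measures on $[0,\infty)\times\{i<j\}\times[0,\infty)$ and $[0,\infty)\times\mathbb N\times\Theta\times[0,\infty)$ with intensities $ds\,(\sum_{k<l}\delta_{(k,l)})\,dz$ and $ds\,(\sum_k\delta_k)\,\beta(d\theta)\,dz$. For $m\in\ell_{0+}$, a finite solution $M(m,\cdot)$ of $SDE(K,F,m,\mathcal N,\mathcal M)$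 is a process adapted to the filtration generated by $\mathcal N$ and $\mathcal M$, whose paths are a.s. càdlàg in $\ell_\lambda$, for which a.s. the number of non-zero entries is bounded on bounded time intervals, and such that for every $t\ge0$, a.s., $$M(m,t)=m+\int_0^t\!\!\int_{i<j}\int_0^\infty\big[c_{ij}(M(m,s-))-M(m,s-)\big]\mathbf 1_{\{z\le K(M_i(m,s-),M_j(m,s-))\}}\,\mathcal N(ds,d(i,j),dz)$$ $$+\int_0^t\!\!\int_i\int_\Theta\int_0^\infty\big[f_{i\theta}(M(m,s-))-M(m,s-)\big]\mathbf 1_{\{z\le F(M_i(m,s-))\}}\,\mathcal M(ds,di,d\theta,dz)$$ (coordinate by coordinate, with absolutely convergent integrals). Let $m,\tilde m\in\ell_{0+}$ and let $M(m,\cdot)$, $M(\tilde m,\cdot)$ be finite solutions of $SDE(K,F,m,\mathcal N,\mathcal M)$ and $SDE(K,F,\tilde m,\mathcal N,\mathcal M)$, driven by the same Poisson measures. Then: (i) Almost surely $t\mapsto\|M(m,t)\|_1$ is non-increasing, and for all $t\ge0$, with $\overline F_m=\sup_{[0,\|m\|_1]}F$, $$\mathbb E\Big[\sup_{s\in[0,t]}\|M(m,s)\|_\lambda\Big]\le\|m\|_\lambda\,e^{\overline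 F_m C_\beta^\lambda t}.$$ (ii) For $x>0$ let $\tau(m,x)=\inf\{t\ge0:\|M(m,t)\|_\lambda\ge x\}$. There is a constant $C>0$, depending only on $\lambda,\alpha,K,F,C_\beta^\lambda,\|m\|_1$ and $\|\tilde m\|_1$, such that for all $t\ge0$ and $x>0$, $$\mathbb E\Big[\sup_{s\in[0,t\wedge\tau(m,x)\wedge\tau(\tilde m,x)]}\delta_\lambda\big(M(m,s),M(\tilde m,s)\big)\Big]\le\delta_\lambda(m,\tilde m)\,e^{C(x+1)t}.$$ -/

import Mathlib

open MeasureTheory ProbabilityTheory Set Filter Topology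
open scoped NNReal ENNReal

noncomputable section

namespace CoalFrag

/-! ### Sequences of masses -/

/-- `‖m‖_p = ∑ₖ mₖ ^ p`, as an extended non-negative real. Sequences are indexed from `0`. -/
def massNorm (p : ℝ) (m : ℕ → ℝ≥0) : ℝ≥0∞ :=
  ∑' k, (m k : ℝ≥0∞) ^ p

/-- The space `ℓ_p` of non-increasing sequences of masses with `‖m‖_p < ∞`. -/
def ell (p : ℝ) : Set (ℕ → ℝ≥0) :=
  {m | Antitone m ∧ massNorm p m < ∞}

/-- The space `ℓ_{0+}` of non-increasing sequences of masses having a zero entry: the finite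
particle systems, completed by zeros. -/
def ellZeroPlus : Set (ℕ → ℝ≥0) :=
  {m | Antitone m ∧ ∃ k, m k = 0}

/-- The distance `δ_p(m, m') = ∑ₖ |mₖ ^ p - m'ₖ ^ p|`. -/
def delta (p : ℝ) (m m' : ℕ → ℝ≥0) : ℝ≥0∞ :=
  ∑' k, ENNReal.ofReal |(m k : ℝ) ^ p - (m' k : ℝ) ^ p|

/-- Reordering of a family of masses into a non-increasing sequence: the entry of index `k`
(from `0`) is the smallest `x` such that at most `k` members of the family exceed `x`, which is the
`(k + 1)`-st largest member, counted with multiplicity. Missing members are replaced by zeros. -/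
def reorder {ι : Type*} (a : ι → ℝ≥0) (k : ℕ) : ℝ≥0 :=
  sInf {x : ℝ≥0 | {i | x < a i}.encard ≤ k}

/-- The coalescence map `c_{ij}`: the particles `i` and `j` are replaced by one of mass
`mᵢ + mⱼ`. (A mass `0` stands for an absent particle.) -/
def coalesce (i j : ℕ) (m : ℕ → ℝ≥0) : ℕ → ℝ≥0 :=
  reorder fun k => if k = i then m i + m j else if k = j then 0 else m k

/-- The fragmentation map `f_{iθ}`: the particle `i` is replaced by particles of masses
`θ₀ mᵢ, θ₁ mᵢ, …`. -/
def fragment (i : ℕ) (θ : ℕ → ℝ≥0) (m : ℕ → ℝ≥0) : ℕ → ℝ≥0 :=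
  reorder (Sum.elim (fun k => if k = i then 0 else m k) (fun n => θ n * m i) : ℕ ⊕ ℕ → ℝ≥0)

/-! ### Kernels and the dislocation measure -/

/-- Coagulation kernels with Hölder index `p`, with the convention `K(x, 0) = 0`. -/
structure IsCoagulationKernel (p : ℝ) (K : ℝ≥0 → ℝ≥0 → ℝ≥0) : Prop where
  symm : ∀ x y, K x y = K y x
  zero_right : ∀ x, K x 0 = 0
  bounded : ∀ S : Set (ℝ≥0 × ℝ≥0), IsCompact S → (∀ q ∈ S, 0 < q.1 ∧ 0 < q.2) →
    BddAbove ((fun q => K q.1 q.2) '' S)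
  holder : ∀ a : ℝ≥0, 0 < a → ∃ κ : ℝ, 0 < κ ∧
    ∀ x ∈ Ioc 0 a, ∀ y ∈ Ioc 0 a, ∀ x' ∈ Ioc 0 a, ∀ y' ∈ Ioc 0 a,
      |(K x y : ℝ) - K x' y'| ≤
        κ * (|(x : ℝ) ^ p - (x' : ℝ) ^ p| + |(y : ℝ) ^ p - (y' : ℝ) ^ p|)

/-- Fragmentation kernels with Hölder index `q`, with the convention `F(0) = 0`. -/
structure IsFragmentationKernel (q : ℝ) (F : ℝ≥0 → ℝ≥0) : Prop where
  zero : F 0 = 0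
  bounded : ∀ S : Set ℝ≥0, IsCompact S → (∀ x ∈ S, 0 < x) → BddAbove (F '' S)
  holder : ∀ a : ℝ≥0, 0 < a → ∃ μ : ℝ, 0 < μ ∧
    ∀ x ∈ Ioc 0 a, ∀ x' ∈ Ioc 0 a, |(F x : ℝ) - F x'| ≤ μ * |(x : ℝ) ^ q - (x' : ℝ) ^ q|

/-- `F̄_m`, the supremum of `F` over `[0, ‖m‖_1]`. -/
def supRate (F : ℝ≥0 → ℝ≥0) (m : ℕ → ℝ≥0) : ℝ≥0∞ :=
  ⨆ (x : ℝ≥0) (_ : (x : ℝ≥0∞) ≤ massNorm 1 m), (F x : ℝ≥0∞)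

/-- The set `Θ` of ratios `1 > θ₀ ≥ θ₁ ≥ … ≥ 0`. -/
abbrev Ratios : Type := {θ : ℕ → ℝ≥0 // θ 0 < 1 ∧ Antitone θ}

/-- The constant `C_β^p = ∫ (∑_{k ≥ 1} θₖ ^ p + (1 - θ₀) ^ p) β(dθ)`, with `θ` indexed from `0`. -/
def betaConst (p : ℝ) (β : Measure Ratios) : ℝ≥0∞ :=
  ∫⁻ θ, ((∑' k, (θ.1 (k + 1) : ℝ≥0∞) ^ p) + (1 - (θ.1 0 : ℝ≥0∞)) ^ p) ∂β

/-- The general assumptions on the dislocation measure: no gain of mass, and `C_β^p < ∞`. -/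
structure IsDislocationMeasure (p : ℝ) (β : Measure Ratios) : Prop where
  no_gain : β {θ | 1 < ∑' k, (θ.1 k : ℝ≥0∞)} = 0
  const_lt_top : betaConst p β < ∞

/-- The measure is finite and almost every dislocation has at most `k` fragments. -/
structure IsFiniteDislocation (β : Measure Ratios) : Prop where
  finite : β univ < ∞
  bounded_fragments : ∃ k : ℕ, β {θ | ∃ n, k ≤ n ∧ θ.1 n ≠ 0} = 0

/-! ### Poisson random measures -/

/-- `N` is a Poisson random measure on `E` with intensity `ν`. -/
structure IsPoissonMeasure {Ω E : Type*} [MeasurableSpace Ω] [MeasurableSpace E]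
    (P : Measure Ω) (N : Ω → Measure E) (ν : Measure E) : Prop where
  measurable : Measurable N
  point_measure : ∀ᵐ ω ∂P, ∃ (s : Set ℕ) (x : s → E), N ω = Measure.sum fun n => Measure.dirac (x n)
  law_of_lt_top : ∀ A, MeasurableSet A → ν A < ∞ →
    P.map (fun ω => N ω A) =
      (poissonMeasure (ν A).toNNReal).map (fun n : ℕ => (n : ℝ≥0∞))
  law_of_eq_top : ∀ A, MeasurableSet A → ν A = ∞ → ∀ᵐ ω ∂P, N ω A = ∞
  indep : ∀ (n : ℕ) (A : Fin n → Set E), (∀ i, MeasurableSet (A i)) →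
    Pairwise (fun i j => Disjoint (A i) (A j)) → iIndepFun (fun i ω => N ω (A i)) P

/-- Lebesgue measure on `[0, ∞)`. -/
def lebesgueNN : Measure ℝ≥0 := (volume : Measure ℝ).comap ((↑) : ℝ≥0 → ℝ)

/-- The set of pairs of indices `(i, j)` with `i < j`. -/
abbrev Pairs : Type := {p : ℕ × ℕ // p.1 < p.2}

/-- The space of the marks `(s, (i, j), z)` of coalescence events. -/
abbrev CoagSpace : Type := ℝ≥0 × Pairs × ℝ≥0

/-- The space of the marks `(s, i, θ, z)` of fragmentation events. -/
abbrev FragSpace : Type := ℝ≥0 × ℕ × Ratios × ℝ≥0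

/-- The intensity `ds (∑_{k < l} δ_{(k, l)}) dz`. -/
def coagIntensity : Measure CoagSpace :=
  lebesgueNN.prod ((Measure.count : Measure Pairs).prod lebesgueNN)

/-- The intensity `ds (∑ₖ δₖ) β(dθ) dz`. -/
def fragIntensity (β : Measure Ratios) : Measure FragSpace :=
  lebesgueNN.prod ((Measure.count : Measure ℕ).prod (β.prod lebesgueNN))

/-- The canonical filtration of a random measure on `[0, ∞) × E`: at time `t`, the σ-algebra
generated by its restriction to `[0, t] × E`. -/
abbrev canonicalFiltration {Ω E : Type*} [MeasurableSpace E] (N : Ω → Measure (ℝ≥0 × E)) (t : ℝ≥0) :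
    MeasurableSpace Ω :=
  MeasurableSpace.comap (fun ω => (N ω).restrict (Iic t ×ˢ univ)) inferInstance

/-- `N` and `M` are independent Poisson measures which drive the coalescences and the
fragmentations, respectively. -/
structure IsDrivingPair {Ω : Type*} [MeasurableSpace Ω] (P : Measure Ω) (β : Measure Ratios)
    (N : Ω → Measure CoagSpace) (M : Ω → Measure FragSpace) : Prop where
  coag : IsPoissonMeasure P N coagIntensity
  frag : IsPoissonMeasure P M (fragIntensity β)
  indep : IndepFun N M P

/-! ### The stochastic differential equation -/

/-- The path `x` belongs to the Skorokhod space of càdlàg functions from `[0, ∞)` to `ℓ_p`, where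
`ℓ_p` carries the distance `δ_p`. -/
structure IsCadlag (p : ℝ) (x : ℝ≥0 → ℕ → ℝ≥0) : Prop where
  mem_ell : ∀ t, x t ∈ ell p
  right_cont : ∀ t, Tendsto (fun s => delta p (x s) (x t)) (𝓝[>] t) (𝓝 0)
  left_lim : ∀ t, ∃ l ∈ ell p, Tendsto (fun s => delta p (x s) l) (𝓝[<] t) (𝓝 0)

/-- The `k`-th coordinate of the integrand of the coalescence integral over `(0, t]`, for the
path `x`; here `Function.leftLim x s` is the state `x(s-)`. -/
def coagIntegrand (K : ℝ≥0 → ℝ≥0 → ℝ≥0) (x : ℝ≥0 → ℕ → ℝ≥0) (t : ℝ≥0) (k : ℕ) : CoagSpace → ℝ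
  | (s, q, z) =>
    let y := Function.leftLim x s
    if s ∈ Ioc 0 t ∧ z ≤ K (y q.1.1) (y q.1.2) then
      (coalesce q.1.1 q.1.2 y k : ℝ) - y k
    else 0

/-- The `k`-th coordinate of the integrand of the fragmentation integral over `(0, t]`, for the
path `x`. -/
def fragIntegrand (F : ℝ≥0 → ℝ≥0) (x : ℝ≥0 → ℕ → ℝ≥0) (t : ℝ≥0) (k : ℕ) : FragSpace → ℝ
  | (s, i, θ, z) =>
    let y := Function.leftLim x s
    if s ∈ Ioc 0 t ∧ z ≤ F (y i) then (fragment i θ.1 y k : ℝ) - y k else 0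

/-- The process `X` is a solution to `SDE(K, F, m, N, M)` with values in `ℓ_p`. The equation is
read coordinate by coordinate, with absolutely convergent integrals. -/
structure IsSolution {Ω : Type*} [MeasurableSpace Ω] (P : Measure Ω) (p : ℝ)
    (K : ℝ≥0 → ℝ≥0 → ℝ≥0) (F : ℝ≥0 → ℝ≥0) (m : ℕ → ℝ≥0)
    (N : Ω → Measure CoagSpace) (M : Ω → Measure FragSpace)
    (X : ℝ≥0 → Ω → ℕ → ℝ≥0) : Prop where
  adapted : ∀ t, Measurable[canonicalFiltration N t ⊔ canonicalFiltration M t] (X t)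
  cadlag : ∀ᵐ ω ∂P, IsCadlag p (fun s => X s ω)
  equation : ∀ t, ∀ᵐ ω ∂P, ∀ k,
    Integrable (coagIntegrand K (fun s => X s ω) t k) (N ω) ∧
    Integrable (fragIntegrand F (fun s => X s ω) t k) (M ω) ∧
    (X t ω k : ℝ) = m k + (∫ e, coagIntegrand K (fun s => X s ω) t k e ∂N ω)
      + ∫ e, fragIntegrand F (fun s => X s ω) t k e ∂M ω

/-- A finite solution: one for which, almost surely, the number of particles is bounded on bounded
time intervals. -/
structure IsFiniteSolution {Ω : Type*} [MeasurableSpace Ω] (P : Measure Ω) (p : ℝ)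
    (K : ℝ≥0 → ℝ≥0 → ℝ≥0) (F : ℝ≥0 → ℝ≥0) (m : ℕ → ℝ≥0)
    (N : Ω → Measure CoagSpace) (M : Ω → Measure FragSpace)
    (X : ℝ≥0 → Ω → ℕ → ℝ≥0) : Prop extends IsSolution P p K F m N M X where
  finite : ∀ᵐ ω ∂P, ∀ t, ∃ n : ℕ, ∀ s ≤ t, {k | X s ω k ≠ 0}.encard ≤ n

/-- `τ(x) = inf {t ≥ 0 : ‖X(t)‖_p ≥ x}`, which is `∞` if the level is never reached. -/
def hittingLevel {Ω : Type*} (p : ℝ) (X : ℝ≥0 → Ω → ℕ → ℝ≥0) (x : ℝ) (ω : Ω) : ℝ≥0∞ :=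
  ⨅ (t : ℝ≥0) (_ : ENNReal.ofReal x ≤ massNorm p (X t ω)), (t : ℝ≥0∞)

/-- `sup_{s ∈ [0, t]} ‖X(s)‖_p`. -/
def supNorm {Ω : Type*} (p : ℝ) (X : ℝ≥0 → Ω → ℕ → ℝ≥0) (t : ℝ≥0) (ω : Ω) : ℝ≥0∞ :=
  ⨆ (s : ℝ≥0) (_ : s ≤ t), massNorm p (X s ω)

/-- `sup_{s ∈ [0, t ∧ τ(x) ∧ τ'(x)]} δ_p(X(s), X'(s))`, where `τ(x)` and `τ'(x)` are the times at
which `‖X‖_p` and `‖X'‖_p` reach the level `x`. -/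
def supDelta {Ω : Type*} (p : ℝ) (X X' : ℝ≥0 → Ω → ℕ → ℝ≥0) (x : ℝ) (t : ℝ≥0) (ω : Ω) : ℝ≥0∞ :=
  ⨆ (s : ℝ≥0)
    (_ : (s : ℝ≥0∞) ≤ min (t : ℝ≥0∞) (min (hittingLevel p X x ω) (hittingLevel p X' x ω))),
    delta p (X s ω) (X' s ω)

end CoalFrag

end

/-!
The theorem rests on a discrete Gronwall argument for a pair of solutions driven by the same
Poisson measures, which avoids stochastic integration.

*Paths.* A finite solution has bounded masses and boundedly many particles on `[0, t]`, so that only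
the events with marks in a region of finite intensity affect it (`exists_region`). Such events are
a.s. isolated by every fine dyadic grid (`ae_eventually_atMostOneEvent`), and the equation then says
that over each cell both solutions are constant or perform one jump, given by the same mark acting
on both states (`IsSolutionPath.isCellStep`). In particular every jump is a coalescence or a
fragmentation without gain of mass, so that the total mass is non-increasing and bounds all masses.

*Drift.* Rearrangement contracts `δ_p` by the layer-cake formula, since the entry of index `k`
exceeds `x` exactly when more than `k` members of the family do (`delta_reorder_le`). So a
coalescence which affects both states does not increase their distance, a fragmentation of both
particles `i` increases it by at most a weight of the dislocation times the distance of the two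
masses, and the events which affect one state only have a rate controlled by the Hölder
conditions. Integration over the marks bounds the mean increase of `δ_p` per unit of time by a
multiple of `δ_p` (`lintegral_delta_coagStep_sub_le`, `lintegral_delta_fragStep_sub_le`). The norm
`‖·‖_p` is the distance to the empty system, and it is controlled by the fragmentations alone.

*Gronwall.* The events in a cell are independent of the past (`indep_filtration_comap`), so the
compensation formula (`IsPoissonMeasure.lintegral_lintegral`) turns a bound of the drift on a set
`D` of states into a bound of the increase over a cell. Summing the positive parts of the increases
over the cells bounds the whole supremum up to the exit from `D`, without any maximal inequality:
`lintegral_stoppedSup_le`. Part (i) is the case of `‖·‖_p`, stopped at a level which tends to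
infinity; part (ii) is the case of `δ_p`, on the set of pairs of states with norms below `x`.
-/


namespace CoalFrag

/-! ### Decreasing rearrangements -/

/-- The rearrangement is characterised by its level sets: if some level is exceeded by at most `k`
members of the family, then the entry of index `k` exceeds `x` exactly when more than `k` members
of the family do. -/
lemma lt_reorder_iff_of_nonempty {ι : Type*} {a : ι → ℝ≥0} {k : ℕ}
    (hne : {y : ℝ≥0 | {i | y < a i}.encard ≤ k}.Nonempty) (x : ℝ≥0) :
    x < reorder a k ↔ (k : ℕ∞) < {i | x < a i}.encard := by
  constructor
  · intro h
    by_contra hc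
    have hmem : x ∈ {y : ℝ≥0 | {i | y < a i}.encard ≤ k} := not_lt.1 hc
    exact absurd (csInf_le (OrderBot.bddBelow _) hmem) (not_le.2 h)
  · intro h
    have h' : ((k + 1 : ℕ) : ℕ∞) ≤ {i | x < a i}.encard := by
      simpa using Order.add_one_le_of_lt h
    obtain ⟨t, ht, htk⟩ := exists_subset_encard_eq h'
    have htf : t.Finite := finite_of_encard_eq_coe htk
    have htn : t.Nonempty := by
      rw [← encard_ne_zero, htk]; simp
    -- the smallest of `k + 1` members above `x` still leaves room for a level above `x`
    obtain ⟨i₀, hi₀, hmin⟩ := htf.exists_minimalFor a t htn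
    have hmin' : ∀ i ∈ t, a i₀ ≤ a i := fun i hi => by
      rcases le_total (a i₀) (a i) with h1 | h1
      · exact h1
      · exact hmin hi h1
    obtain ⟨y, hxy, hy⟩ := exists_between (show x < a i₀ from ht hi₀)
    refine hxy.trans_le (le_csInf hne fun z hz => ?_)
    by_contra hc
    have : t ⊆ {i | z < a i} := fun i hi => (not_le.1 hc).trans (hy.trans_le (hmin' i hi))
    have h2 := (encard_le_encard this).trans hz
    rw [htk] at h2
    have : k + 1 ≤ k := by exact_mod_cast h2
    omega

lemma lt_reorder_iff {ι : Type*} {a : ι → ℝ≥0} (ha : BddAbove (range a)) (k : ℕ) (x : ℝ≥0) :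
    x < reorder a k ↔ (k : ℕ∞) < {i | x < a i}.encard := by
  obtain ⟨b, hb⟩ := ha
  refine lt_reorder_iff_of_nonempty ⟨b, ?_⟩ x
  have : {i | b < a i} = ∅ := by
    ext i; simpa using hb ⟨i, rfl⟩
  simp [this]

lemma bddAbove_range_of_antitone {m : ℕ → ℝ≥0} (hm : Antitone m) : BddAbove (range m) :=
  ⟨m 0, by rintro _ ⟨k, rfl⟩; exact hm (Nat.zero_le k)⟩

/-- Rearranging a non-increasing sequence, spread injectively over a larger index set and padded
by zeros, gives the sequence back. -/
lemma reorder_eq_of_antitone {ι : Type*} {m : ℕ → ℝ≥0} (hm : Antitone m) {a : ι → ℝ≥0} (g : ℕ → ι)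
    (hg : Function.Injective g) (hag : ∀ k, a (g k) = m k) (ha0 : ∀ i ∉ range g, a i = 0) :
    reorder a = m := by
  have hb : BddAbove (range a) := by
    refine ⟨m 0, ?_⟩
    rintro _ ⟨i, rfl⟩
    by_cases hi : i ∈ range g
    · obtain ⟨k, rfl⟩ := hi
      rw [hag]; exact hm (Nat.zero_le k)
    · rw [ha0 i hi]; exact zero_le
  funext k
  refine eq_of_forall_lt_iff fun x => ?_
  rw [lt_reorder_iff hb]
  have hset : {i | x < a i} = g '' {j | x < m j} := by
    ext i
    simp only [mem_ofPred_eq, mem_image]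
    constructor
    · intro h
      by_cases hi : i ∈ range g
      · obtain ⟨j, rfl⟩ := hi
        exact ⟨j, by rwa [hag] at h, rfl⟩
      · rw [ha0 i hi] at h; simp at h
    · rintro ⟨j, hj, rfl⟩
      rwa [hag]
  rw [hset, hg.encard_image]
  constructor
  · intro h
    by_contra hc
    have : {j | x < m j} ⊆ {j : ℕ | j < k} := fun j hj => by
      by_contra hjk
      exact hc (lt_of_lt_of_le hj (hm (not_lt.1 hjk)))
    have h2 := encard_le_encard this
    have h3 : {j : ℕ | j < k}.encard = k := by
      have : {j : ℕ | j < k} = (Finset.range k : Set ℕ) := by ext; simp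
      rw [this, encard_coe_eq_coe_finsetCard]; simp
    rw [h3] at h2
    exact absurd h (not_lt.2 h2)
  · intro h
    have : ((Finset.range (k + 1) : Finset ℕ) : Set ℕ) ⊆ {j | x < m j} := fun j hj => by
      have : j ≤ k := by simpa [Nat.lt_succ_iff] using hj
      exact lt_of_lt_of_le h (hm this)
    have h2 := encard_le_encard this
    rw [encard_coe_eq_coe_finsetCard] at h2
    refine lt_of_lt_of_le ?_ h2
    simp only [Finset.card_range]
    exact_mod_cast Nat.lt_succ_self k

lemma ofReal_abs_sub_eq_lintegral (A B : ℝ) :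
    ENNReal.ofReal |A - B| = ∫⁻ y : ℝ, {y : ℝ | ¬ (y < A ↔ y < B)}.indicator 1 y := by
  have : {y : ℝ | ¬ (y < A ↔ y < B)} = Ico (min A B) (max A B) := by
    ext y
    simp only [mem_ofPred_eq, mem_Ico, min_le_iff, lt_max_iff]
    constructor
    · intro h
      by_cases h1 : y < A <;> by_cases h2 : y < B <;> simp_all
    · rintro ⟨h1, h2⟩ h3
      rcases h2 with h2 | h2
      · have := h3.1 h2
        rcases h1 with h1 | h1 <;> linarith
      · have := h3.2 h2
        rcases h1 with h1 | h1 <;> linarith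
  rw [this, lintegral_indicator_one measurableSet_Ico, Real.volume_Ico, max_sub_min_eq_abs,
    abs_sub_comm]

lemma measurableSet_not_lt_iff_lt (A B : ℝ) : MeasurableSet {y : ℝ | ¬ (y < A ↔ y < B)} := by
  apply MeasurableSet.compl
  apply MeasurableSet.iff <;> exact measurableSet_Iio

lemma tsum_indicator_one_eq_encard {ι : Type*} (s : Set ι) :
    ∑' i, s.indicator (1 : ι → ℝ≥0∞) i = (s.encard : ℝ≥0∞) := by
  rw [← ENNReal.tsum_set_one, tsum_subtype s (fun _ => (1 : ℝ≥0∞))]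
  rfl

/-- The layer-cake formula for an `ℓ¹` distance. -/
lemma tsum_abs_sub_eq_lintegral {ι : Type*} [Countable ι] (A B : ι → ℝ) :
    ∑' i, ENNReal.ofReal |A i - B i| =
      ∫⁻ y : ℝ, ({i | ¬ (y < A i ↔ y < B i)}.encard : ℝ≥0∞) := by
  simp_rw [ofReal_abs_sub_eq_lintegral]
  rw [← lintegral_tsum]
  · refine lintegral_congr fun y => ?_
    rw [← tsum_indicator_one_eq_encard]
    rfl
  · intro i
    exact (measurable_one.indicator (measurableSet_not_lt_iff_lt _ _)).aemeasurable

/-- The initial segments of lengths `#A` and `#B` differ by at most as many points as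
`A` and `B` do. -/
lemma encard_initial_symmDiff_le {ι : Type*} (A B : Set ι) :
    {k : ℕ | ¬ ((k : ℕ∞) < A.encard ↔ (k : ℕ∞) < B.encard)}.encard ≤
      {i | ¬ (i ∈ A ↔ i ∈ B)}.encard := by
  wlog h : A.encard ≤ B.encard generalizing A B
  · have := this B A (le_of_not_ge h)
    simpa only [iff_comm] using this
  have hsub : B \ A ⊆ {i | ¬ (i ∈ A ↔ i ∈ B)} := fun i hi => by simp [hi.1, hi.2]
  refine le_trans ?_ (encard_le_encard hsub)
  rcases eq_or_ne A.encard ⊤ with hA | hA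
  · have hB : B.encard = ⊤ := top_le_iff.1 (hA ▸ h)
    simp [hA, hB]
  obtain ⟨n, hn⟩ := ENat.ne_top_iff_exists.1 hA
  have hBA : B.encard ≤ n + (B \ A).encard := by
    rw [hn, add_comm]
    calc B.encard ≤ ((B \ A) ∪ A).encard := encard_le_encard (by simp)
      _ ≤ _ := encard_union_le _ _
  rw [← hn] at h ⊢
  rcases eq_or_ne (B \ A).encard ⊤ with hd | hd
  · rw [hd]; exact le_top
  obtain ⟨d, hd'⟩ := ENat.ne_top_iff_exists.1 hd
  rw [← hd'] at hBA ⊢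
  have : {k : ℕ | ¬ ((k : ℕ∞) < (n : ℕ∞) ↔ (k : ℕ∞) < B.encard)} ⊆
      (Finset.Ico n (n + d) : Set ℕ) := by
    intro k hk
    simp only [Finset.coe_Ico, mem_Ico]
    simp only [Nat.cast_lt, mem_ofPred_eq] at hk
    by_cases hkn : k < n
    · exfalso
      apply hk
      simp only [hkn, true_iff]
      exact lt_of_lt_of_le (by exact_mod_cast hkn) h
    · refine ⟨not_lt.1 hkn, ?_⟩
      have : (k : ℕ∞) < B.encard := by
        by_contra hc; exact hk (by simp [hkn, hc])
      exact_mod_cast this.trans_le hBA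
  refine (encard_le_encard this).trans ?_
  rw [encard_coe_eq_coe_finsetCard]
  simp

lemma lt_rpow_iff_of_pos {p : ℝ} (hp : 0 < p) (y : ℝ) (u : ℝ≥0) :
    y < (u : ℝ) ^ p ↔ y < 0 ∨ y.toNNReal ^ p⁻¹ < u := by
  rcases lt_or_ge y 0 with hy | hy
  · simp only [hy, true_or, iff_true]
    exact hy.trans_le (by positivity)
  · simp only [not_lt.2 hy, false_or]
    rw [NNReal.rpow_inv_lt_iff hp, ← NNReal.coe_lt_coe, NNReal.coe_rpow, Real.coe_toNNReal _ hy]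

/-- Rearrangement contracts the `δ_p` distance. -/
lemma delta_reorder_le {ι : Type*} [Countable ι] {p : ℝ} (hp : 0 < p) {a b : ι → ℝ≥0}
    (ha : BddAbove (range a)) (hb : BddAbove (range b)) :
    delta p (reorder a) (reorder b) ≤ ∑' i, ENNReal.ofReal |(a i : ℝ) ^ p - (b i : ℝ) ^ p| := by
  unfold delta
  rw [tsum_abs_sub_eq_lintegral, tsum_abs_sub_eq_lintegral]
  refine lintegral_mono fun y => ?_
  simp only [lt_rpow_iff_of_pos hp]
  rcases lt_or_ge y 0 with hy | hy
  · simp [hy]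
  · simp only [not_lt.2 hy, false_or, lt_reorder_iff ha, lt_reorder_iff hb]
    exact_mod_cast encard_initial_symmDiff_le {i | y.toNNReal ^ p⁻¹ < a i}
      {i | y.toNNReal ^ p⁻¹ < b i}

lemma ofReal_abs_rpow_sub_zero {p : ℝ} (hp : 0 < p) (x : ℝ≥0) :
    ENNReal.ofReal |(x : ℝ) ^ p - (0 : ℝ) ^ p| = (x : ℝ≥0∞) ^ p := by
  rw [Real.zero_rpow hp.ne', sub_zero, abs_of_nonneg (by positivity), ← NNReal.coe_rpow,
    ENNReal.ofReal_coe_nnreal, ENNReal.coe_rpow_of_nonneg _ hp.le]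

lemma massNorm_eq_delta_zero {p : ℝ} (hp : 0 < p) (m : ℕ → ℝ≥0) :
    massNorm p m = delta p m 0 := by
  unfold massNorm delta
  refine tsum_congr fun k => ?_
  simpa using (ofReal_abs_rpow_sub_zero hp (m k)).symm

lemma massNorm_reorder_le {ι : Type*} [Countable ι] {p : ℝ} (hp : 0 < p) {a : ι → ℝ≥0}
    (ha : BddAbove (range a)) : massNorm p (reorder a) ≤ ∑' i, (a i : ℝ≥0∞) ^ p := by
  have h0 : BddAbove (range (0 : ι → ℝ≥0)) := ⟨0, by rintro _ ⟨i, rfl⟩; simp⟩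
  have h1 : reorder (0 : ι → ℝ≥0) = 0 := by
    funext k
    refine le_antisymm (not_lt.1 fun h => ?_) zero_le
    have := (lt_reorder_iff h0 k 0).1 h
    simp at this
  have := delta_reorder_le hp ha h0
  rw [h1, ← massNorm_eq_delta_zero hp] at this
  refine this.trans (le_of_eq (tsum_congr fun i => ?_))
  simpa using ofReal_abs_rpow_sub_zero hp (a i)

/-! ### Effect of one coalescence or fragmentation -/

/-- `x ↦ x ^ p` is concave, so its increments decrease under translation. -/
lemma rpow_add_sub_rpow_add_le {p : ℝ} (hp : 0 < p) (hp1 : p ≤ 1) {a a' b : ℝ} (ha' : 0 ≤ a')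
    (haa : a' ≤ a) (hb : 0 ≤ b) : (a + b) ^ p - (a' + b) ^ p ≤ a ^ p - a' ^ p := by
  rcases eq_or_lt_of_le (show a' ≤ a + b by linarith) with h | h
  · have h1 : a = a' := by linarith
    simp [h1]
  have hL : 0 < a + b - a' := by linarith
  have hc := Real.concaveOn_rpow hp.le hp1
  have h0 : a' ∈ Ici (0 : ℝ) := ha'
  have h1 : a + b ∈ Ici (0 : ℝ) := ha'.trans h.le
  have hs : 0 ≤ b / (a + b - a') := by positivity
  have ht : 0 ≤ (a - a') / (a + b - a') := div_nonneg (by linarith) hL.le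
  have hst : b / (a + b - a') + (a - a') / (a + b - a') = 1 := by
    field_simp; ring
  have e1 := hc.2 h0 h1 hs ht hst
  have e2 := hc.2 h0 h1 ht hs (by rw [add_comm]; exact hst)
  have k1 : b / (a + b - a') * a' + (a - a') / (a + b - a') * (a + b) = a := by
    field_simp; ring
  have k2 : (a - a') / (a + b - a') * a' + b / (a + b - a') * (a + b) = a' + b := by
    field_simp; ring
  simp only [smul_eq_mul] at e1 e2
  rw [k1] at e1
  rw [k2] at e2
  have : b / (a + b - a') * a' ^ p + (a - a') / (a + b - a') * (a + b) ^ p +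
      ((a - a') / (a + b - a') * a' ^ p + b / (a + b - a') * (a + b) ^ p) =
      a' ^ p + (a + b) ^ p := by
    calc _ = (b / (a + b - a') + (a - a') / (a + b - a')) * (a' ^ p + (a + b) ^ p) := by ring
      _ = _ := by rw [hst, one_mul]
  linarith

lemma abs_rpow_add_sub_rpow_add_le {p : ℝ} (hp : 0 < p) (hp1 : p ≤ 1) {a a' b : ℝ} (ha : 0 ≤ a)
    (ha' : 0 ≤ a') (hb : 0 ≤ b) : |(a + b) ^ p - (a' + b) ^ p| ≤ |a ^ p - a' ^ p| := by
  wlog h : a' ≤ a generalizing a a'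
  · rw [abs_sub_comm, abs_sub_comm (a ^ p)]
    exact this ha' ha (le_of_not_ge h)
  rw [abs_of_nonneg (sub_nonneg.2 (Real.rpow_le_rpow (by positivity) (by linarith) hp.le)),
    abs_of_nonneg (sub_nonneg.2 (Real.rpow_le_rpow ha' h hp.le))]
  exact rpow_add_sub_rpow_add_le hp hp1 ha' h hb

lemma abs_add_rpow_sub_add_rpow_le {p : ℝ} (hp : 0 < p) (hp1 : p ≤ 1) {a b a' b' : ℝ} (ha : 0 ≤ a)
    (ha' : 0 ≤ a') (hb : 0 ≤ b) (hb' : 0 ≤ b') :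
    |(a + b) ^ p - (a' + b') ^ p| ≤ |a ^ p - a' ^ p| + |b ^ p - b' ^ p| := by
  have h1 := abs_rpow_add_sub_rpow_add_le hp hp1 ha ha' hb
  have h2 := abs_rpow_add_sub_rpow_add_le hp hp1 hb hb' ha'
  rw [add_comm b, add_comm b'] at h2
  exact (abs_sub_le _ ((a' + b) ^ p) _).trans (add_le_add h1 h2)

lemma tsum_le_tsum_of_merge {f g : ℕ → ℝ≥0∞} {i j : ℕ} (hij : i ≠ j) (hi : g i ≤ f i + f j)
    (hj : g j = 0) (h : ∀ k, k ≠ i → k ≠ j → g k ≤ f k) : ∑' k, g k ≤ ∑' k, f k := by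
  have hf : ∑' k, f k =
      f i + f j + ∑' k, if k = j then 0 else if k = i then 0 else f k := by
    rw [ENNReal.tsum_eq_add_tsum_ite i, add_assoc]
    congr 1
    rw [ENNReal.tsum_eq_add_tsum_ite j]
    simp only [hij.symm, if_false]
    congr! 2
    funext k
    split_ifs <;> rfl
  rw [ENNReal.tsum_eq_add_tsum_ite i, hf]
  refine add_le_add hi (ENNReal.tsum_le_tsum fun k => ?_)
  by_cases hk : k = j
  · subst hk; simp [hj]
  by_cases hk' : k = i
  · subst hk'; simp
  · simpa [hk, hk'] using h k hk' hk

lemma tsum_sum_type {α β : Type*} (f : α ⊕ β → ℝ≥0∞) :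
    ∑' i, f i = ∑' a, f (Sum.inl a) + ∑' b, f (Sum.inr b) :=
  (HasSum.sum (ENNReal.summable.hasSum) (ENNReal.summable.hasSum)).tsum_eq

/-- The family of masses whose rearrangement is `coalesce i j m`. -/
noncomputable def mergeFamily (i j : ℕ) (m : ℕ → ℝ≥0) (k : ℕ) : ℝ≥0 :=
  if k = i then m i + m j else if k = j then 0 else m k

lemma coalesce_eq (i j : ℕ) (m : ℕ → ℝ≥0) : coalesce i j m = reorder (mergeFamily i j m) := rfl

lemma bddAbove_mergeFamily {m : ℕ → ℝ≥0} (hm : Antitone m) (i j : ℕ) :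
    BddAbove (range (mergeFamily i j m)) := by
  refine ⟨m 0 + m 0, ?_⟩
  rintro _ ⟨k, rfl⟩
  have h : ∀ k, m k ≤ m 0 := fun k => hm (Nat.zero_le k)
  unfold mergeFamily
  split_ifs
  · exact add_le_add (h i) (h j)
  · exact zero_le
  · exact (h k).trans (le_add_of_nonneg_left zero_le)

/-- The family of masses whose rearrangement is `fragment i θ m`. -/
noncomputable def splitFamily (i : ℕ) (θ : ℕ → ℝ≥0) (m : ℕ → ℝ≥0) : ℕ ⊕ ℕ → ℝ≥0 :=
  Sum.elim (fun k => if k = i then 0 else m k) (fun n => θ n * m i)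

lemma fragment_eq (i : ℕ) (θ m : ℕ → ℝ≥0) : fragment i θ m = reorder (splitFamily i θ m) := rfl

lemma Ratios.le_one (θ : Ratios) (n : ℕ) : θ.1 n ≤ 1 :=
  (θ.2.2 (Nat.zero_le n)).trans θ.2.1.le

lemma bddAbove_splitFamily {m : ℕ → ℝ≥0} (hm : Antitone m) (i : ℕ) (θ : Ratios) :
    BddAbove (range (splitFamily i θ.1 m)) := by
  refine ⟨m 0, ?_⟩
  have h : ∀ k, m k ≤ m 0 := fun k => hm (Nat.zero_le k)
  rintro _ ⟨k | k, rfl⟩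
  · simp only [splitFamily, Sum.elim_inl]
    split_ifs
    · exact zero_le
    · exact h k
  · simp only [splitFamily, Sum.elim_inr]
    exact (mul_le_of_le_one_left zero_le (θ.le_one k)).trans (h i)

lemma reorder_self {m : ℕ → ℝ≥0} (hm : Antitone m) : reorder m = m :=
  reorder_eq_of_antitone hm id Function.injective_id (fun _ => rfl) (by simp)

/-- Coalescing with an absent particle has no effect. -/
lemma coalesce_of_right_eq_zero {m : ℕ → ℝ≥0} (hm : Antitone m) {i j : ℕ} (h : m j = 0) :
    coalesce i j m = m := by
  have : mergeFamily i j m = m := by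
    funext k
    unfold mergeFamily
    split_ifs with h1 h2
    · rw [h1, h, add_zero]
    · rw [h2, h]
    · rfl
  rw [coalesce_eq, this, reorder_self hm]

/-- The position, in the family split at `i`, of the members of the original sequence, when the
particle `i` is identified with its first fragment. -/
noncomputable def splitIndex (i k : ℕ) : ℕ ⊕ ℕ := if k = i then Sum.inr 0 else Sum.inl k

lemma splitIndex_injective (i : ℕ) : Function.Injective (splitIndex i) := by
  intro k l h
  unfold splitIndex at h
  split_ifs at h with h1 h2 h2
  · rw [h1, h2]
  · exact Sum.inl_injective h

/-- The particle `i` seen as a family with a single fragment. -/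
lemma reorder_splitFamily_single {m : ℕ → ℝ≥0} (hm : Antitone m) (i : ℕ) :
    reorder (splitFamily i (fun n => if n = 0 then 1 else 0) m) = m := by
  refine reorder_eq_of_antitone hm (splitIndex i) (splitIndex_injective i) ?_ ?_
  · intro k
    unfold splitIndex splitFamily
    split_ifs with h
    · simp [h]
    · simp [h]
  · rintro (k | k) hk
    · by_cases h : k = i
      · simp [splitFamily, h]
      · exact absurd ⟨k, by simp [splitIndex, h]⟩ hk
    · by_cases h : k = 0
      · exact absurd ⟨i, by simp [splitIndex, h]⟩ hk
      · simp [splitFamily, h]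

lemma bddAbove_splitFamily_single {m : ℕ → ℝ≥0} (hm : Antitone m) (i : ℕ) :
    BddAbove (range (splitFamily i (fun n => if n = 0 then 1 else 0) m)) := by
  refine ⟨m 0, ?_⟩
  have h : ∀ k, m k ≤ m 0 := fun k => hm (Nat.zero_le k)
  rintro _ ⟨k | k, rfl⟩
  · simp only [splitFamily, Sum.elim_inl]
    split_ifs
    · exact zero_le
    · exact h k
  · simp only [splitFamily, Sum.elim_inr]
    split_ifs
    · simpa using h i
    · simp

/-- Fragmenting an absent particle has no effect. -/
lemma fragment_of_eq_zero {m : ℕ → ℝ≥0} (hm : Antitone m) {i : ℕ} (θ : ℕ → ℝ≥0) (h : m i = 0) :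
    fragment i θ m = m := by
  have h1 : splitFamily i θ m = splitFamily i (fun n => if n = 0 then 1 else 0) m := by
    funext k
    rcases k with k | k <;> simp [splitFamily, h]
  rw [fragment_eq, h1, reorder_splitFamily_single hm i]

lemma delta_coalesce_coalesce_le {p : ℝ} (hp : 0 < p) (hp1 : p ≤ 1) {x x' : ℕ → ℝ≥0}
    (hx : Antitone x) (hx' : Antitone x') {i j : ℕ} (hij : i ≠ j) :
    delta p (coalesce i j x) (coalesce i j x') ≤ delta p x x' := by
  refine (delta_reorder_le hp (bddAbove_mergeFamily hx i j) (bddAbove_mergeFamily hx' i j)).trans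
    (tsum_le_tsum_of_merge hij ?_ ?_ ?_)
  · rw [← ENNReal.ofReal_add (abs_nonneg _) (abs_nonneg _)]
    simp only [mergeFamily, if_true, NNReal.coe_add]
    exact ENNReal.ofReal_le_ofReal (abs_add_rpow_sub_add_rpow_le hp hp1 (by simp) (by simp)
      (by simp) (by simp))
  · simp [mergeFamily, hij.symm]
  · intro k hki hkj
    simp [mergeFamily, hki, hkj]

lemma massNorm_coalesce_le {p : ℝ} (hp : 0 < p) (hp1 : p ≤ 1) {x : ℕ → ℝ≥0} (hx : Antitone x)
    {i j : ℕ} (hij : i ≠ j) : massNorm p (coalesce i j x) ≤ massNorm p x := by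
  refine (massNorm_reorder_le hp (bddAbove_mergeFamily hx i j)).trans
    (tsum_le_tsum_of_merge hij ?_ ?_ ?_)
  · simp only [mergeFamily, if_true, ENNReal.coe_add]
    exact ENNReal.rpow_add_le_add_rpow _ _ hp.le hp1
  · simp [mergeFamily, hij.symm, hp]
  · intro k hki hkj
    simp [mergeFamily, hki, hkj]

lemma ofReal_coe_rpow {p : ℝ} (hp : 0 ≤ p) (x : ℝ≥0) :
    ENNReal.ofReal ((x : ℝ) ^ p) = (x : ℝ≥0∞) ^ p := by
  rw [← NNReal.coe_rpow, ENNReal.ofReal_coe_nnreal, ENNReal.coe_rpow_of_nonneg _ hp]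

/-- A coalescence changes the two coordinates `i`, `j` of the unordered family, each by at most
`(x j) ^ p`. -/
lemma delta_coalesce_self_le {p : ℝ} (hp : 0 < p) (hp1 : p ≤ 1) {x : ℕ → ℝ≥0} (hx : Antitone x)
    {i j : ℕ} (hij : i ≠ j) : delta p (coalesce i j x) x ≤ 2 * (x j : ℝ≥0∞) ^ p := by
  have h := delta_reorder_le hp (bddAbove_mergeFamily hx i j) (bddAbove_range_of_antitone hx)
  rw [reorder_self hx] at h
  refine h.trans ?_
  rw [tsum_eq_sum (s := {i, j}), Finset.sum_pair hij, two_mul]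
  · refine add_le_add ?_ (le_of_eq ?_)
    · rw [← ofReal_coe_rpow hp.le]
      refine ENNReal.ofReal_le_ofReal ?_
      have := abs_add_rpow_sub_add_rpow_le hp hp1 (x i).2 (x i).2 (x j).2 le_rfl
      simpa [mergeFamily, Real.zero_rpow hp.ne', abs_of_nonneg, Real.rpow_nonneg] using this
    · rw [← ofReal_abs_rpow_sub_zero hp, abs_sub_comm]
      simp [mergeFamily, hij.symm]
  · intro k hk
    simp only [Finset.mem_insert, Finset.mem_singleton, not_or] at hk
    simp [mergeFamily, hk.1, hk.2]

lemma delta_fragment_fragment_le {p : ℝ} (hp : 0 < p) {x x' : ℕ → ℝ≥0}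
    (hx : Antitone x) (hx' : Antitone x') (i : ℕ) (θ : Ratios) :
    delta p (fragment i θ.1 x) (fragment i θ.1 x') ≤ delta p x x' +
      (∑' k, (θ.1 (k + 1) : ℝ≥0∞) ^ p) * ENNReal.ofReal |(x i : ℝ) ^ p - (x' i : ℝ) ^ p| := by
  refine (delta_reorder_le hp (bddAbove_splitFamily hx i θ) (bddAbove_splitFamily hx' i θ)).trans ?_
  rw [tsum_sum_type]
  have h1 : ∀ n, ENNReal.ofReal |((splitFamily i θ.1 x (Sum.inr n) : ℝ≥0) : ℝ) ^ p -
      ((splitFamily i θ.1 x' (Sum.inr n) : ℝ≥0) : ℝ) ^ p| =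
      (θ.1 n : ℝ≥0∞) ^ p * ENNReal.ofReal |(x i : ℝ) ^ p - (x' i : ℝ) ^ p| := by
    intro n
    simp only [splitFamily, Sum.elim_inr, NNReal.coe_mul]
    rw [Real.mul_rpow (by simp) (by simp), Real.mul_rpow (by simp) (by simp), ← mul_sub, abs_mul,
      abs_of_nonneg (by positivity), ENNReal.ofReal_mul (by positivity), ofReal_coe_rpow hp.le]
  simp_rw [h1]
  rw [ENNReal.tsum_mul_right,
    tsum_eq_zero_add' (f := fun k => (θ.1 k : ℝ≥0∞) ^ p) ENNReal.summable, add_mul, ← add_assoc]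
  refine add_le_add ?_ le_rfl
  unfold delta
  rw [ENNReal.tsum_eq_add_tsum_ite
      (f := fun k => ENNReal.ofReal |(x k : ℝ) ^ p - (x' k : ℝ) ^ p|) i,
    add_comm]
  refine add_le_add (mul_le_of_le_one_left zero_le ?_) (ENNReal.tsum_le_tsum fun k => ?_)
  · exact ENNReal.rpow_le_one (by exact_mod_cast θ.le_one 0) hp.le
  · simp only [splitFamily, Sum.elim_inl]
    split_ifs <;> simp

/-- The total mass does not increase when the ratios sum to at most `1`. -/
lemma massNorm_one_fragment_le {x : ℕ → ℝ≥0} (hx : Antitone x) (i : ℕ) (θ : Ratios)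
    (hθ : ∑' k, (θ.1 k : ℝ≥0∞) ≤ 1) : massNorm 1 (fragment i θ.1 x) ≤ massNorm 1 x := by
  refine (massNorm_reorder_le one_pos (bddAbove_splitFamily hx i θ)).trans ?_
  simp only [ENNReal.rpow_one, massNorm]
  rw [tsum_sum_type, ENNReal.tsum_eq_add_tsum_ite (f := fun k => (x k : ℝ≥0∞)) i, add_comm]
  simp only [splitFamily, Sum.elim_inr, Sum.elim_inl, ENNReal.coe_mul]
  rw [ENNReal.tsum_mul_right]
  refine add_le_add (mul_le_of_le_one_left zero_le hθ) (ENNReal.tsum_le_tsum fun k => ?_)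
  split_ifs <;> simp

/-- The weight `∑_{k ≥ 1} θₖ ^ p + (1 - θ₀) ^ p` of a dislocation. -/
noncomputable def dislocationWeight (p : ℝ) (θ : Ratios) : ℝ≥0∞ :=
  (∑' k, (θ.1 (k + 1) : ℝ≥0∞) ^ p) + (1 - (θ.1 0 : ℝ≥0∞)) ^ p

/-- A fragmentation moves a state by at most the weight of the dislocation: the first fragment is
matched with the broken particle, and the other fragments with absent particles. -/
lemma delta_fragment_self_le {p : ℝ} (hp : 0 < p) (hp1 : p ≤ 1) {x : ℕ → ℝ≥0} (hx : Antitone x)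
    (i : ℕ) (θ : Ratios) :
    delta p (fragment i θ.1 x) x ≤ dislocationWeight p θ * (x i : ℝ≥0∞) ^ p := by
  have h := delta_reorder_le hp (bddAbove_splitFamily hx i θ) (bddAbove_splitFamily_single hx i)
  rw [reorder_splitFamily_single hx] at h
  refine h.trans ?_
  have h1 : ∀ k : ℕ, ENNReal.ofReal |((splitFamily i θ.1 x (Sum.inl k) : ℝ≥0) : ℝ) ^ p -
      ((splitFamily i (fun n => if n = 0 then 1 else 0) x (Sum.inl k) : ℝ≥0) : ℝ) ^ p| = 0 := by
    intro k; simp [splitFamily]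
  have h2 : ∀ k : ℕ, ENNReal.ofReal |((splitFamily i θ.1 x (Sum.inr (k + 1)) : ℝ≥0) : ℝ) ^ p -
      ((splitFamily i (fun n => if n = 0 then 1 else 0) x (Sum.inr (k + 1)) : ℝ≥0) : ℝ) ^ p| =
      (θ.1 (k + 1) : ℝ≥0∞) ^ p * (x i : ℝ≥0∞) ^ p := by
    intro k
    have : splitFamily i (fun n => if n = 0 then 1 else 0) x (Sum.inr (k + 1)) = 0 := by
      simp [splitFamily]
    rw [this, NNReal.coe_zero, ofReal_abs_rpow_sub_zero hp]
    simp only [splitFamily, Sum.elim_inr, ENNReal.coe_mul]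
    rw [ENNReal.mul_rpow_of_nonneg _ _ hp.le]
  rw [tsum_sum_type, tsum_congr h1, tsum_eq_zero_add' (f := fun k => ENNReal.ofReal
    |((splitFamily i θ.1 x (Sum.inr k) : ℝ≥0) : ℝ) ^ p -
      ((splitFamily i (fun n => if n = 0 then 1 else 0) x (Sum.inr k) : ℝ≥0) : ℝ) ^ p|)
    ENNReal.summable, tsum_congr h2]
  rw [tsum_zero, zero_add, ENNReal.tsum_mul_right, add_comm, dislocationWeight, add_mul]
  refine add_le_add le_rfl ?_
  have h3 : (1 - (θ.1 0 : ℝ≥0∞)) = ((1 - θ.1 0 : ℝ≥0) : ℝ≥0∞) := by simp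
  rw [h3, ← ofReal_coe_rpow hp.le, ← ofReal_coe_rpow hp.le, ← ENNReal.ofReal_mul (by positivity)]
  refine ENNReal.ofReal_le_ofReal ?_
  simp only [splitFamily, Sum.elim_inr, if_true, one_mul, NNReal.coe_mul]
  rw [Real.mul_rpow (by simp) (by simp)]
  have h4 : ((θ.1 0 : ℝ≥0) : ℝ) ^ p * (x i : ℝ) ^ p - (x i : ℝ) ^ p =
      -((1 - ((θ.1 0 : ℝ≥0) : ℝ) ^ p) * (x i : ℝ) ^ p) := by ring
  have h5 : ((θ.1 0 : ℝ≥0) : ℝ) ^ p ≤ 1 :=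
    Real.rpow_le_one (by simp) (by exact_mod_cast θ.le_one 0) hp.le
  rw [h4, abs_neg, abs_of_nonneg (mul_nonneg (by linarith) (by positivity))]
  refine mul_le_mul_of_nonneg_right ?_ (by positivity)
  rw [NNReal.coe_sub (θ.le_one 0), NNReal.coe_one]
  have h6 := abs_add_rpow_sub_add_rpow_le hp hp1 (a := ((θ.1 0 : ℝ≥0) : ℝ))
    (b := 1 - ((θ.1 0 : ℝ≥0) : ℝ)) (by simp) (le_refl 0)
    (sub_nonneg.2 (by exact_mod_cast θ.le_one 0)) (le_refl 0)
  have h7 : (0 : ℝ) ≤ (1 - ((θ.1 0 : ℝ≥0) : ℝ)) ^ p :=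
    Real.rpow_nonneg (sub_nonneg.2 (by exact_mod_cast θ.le_one 0)) _
  simp only [add_sub_cancel, Real.one_rpow, add_zero, Real.zero_rpow hp.ne', sub_zero, abs_one,
    abs_of_nonneg h7, abs_of_nonneg (Real.rpow_nonneg (NNReal.coe_nonneg (θ.1 0)) p)] at h6
  linarith

/-! ### Measurability of the jump maps -/

lemma measurable_encard_lt {ι : Type*} [Countable ι] (x : ℝ≥0) :
    Measurable fun a : ι → ℝ≥0 => ({i | x < a i}.encard : ℝ≥0∞) := by
  simp_rw [← tsum_indicator_one_eq_encard]
  refine Measurable.tsum fun i => ?_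
  have : (fun a : ι → ℝ≥0 => {i | x < a i}.indicator (1 : ι → ℝ≥0∞) i) =
      {a : ι → ℝ≥0 | x < a i}.indicator 1 := by
    funext a
    simp [indicator_apply]
  rw [this]
  exact measurable_one.indicator (measurableSet_lt measurable_const (measurable_pi_apply i))

lemma measurable_reorder {ι : Type*} [Countable ι] :
    Measurable (reorder : (ι → ℝ≥0) → ℕ → ℝ≥0) := by
  refine measurable_pi_iff.2 fun k => measurable_of_Ioi fun x => ?_
  have h : (fun a : ι → ℝ≥0 => reorder a k) ⁻¹' Ioi x =
      {a | (k : ℝ≥0∞) < ({i | x < a i}.encard : ℝ≥0∞)} ∩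
        ⋃ n : ℕ, {a | ({i | (n : ℝ≥0) < a i}.encard : ℝ≥0∞) ≤ (k : ℝ≥0∞)} := by
    ext a
    simp only [mem_preimage, mem_Ioi, mem_inter_iff, mem_ofPred_eq, mem_iUnion]
    have e1 : ∀ s : Set ι, ((k : ℝ≥0∞) < (s.encard : ℝ≥0∞)) ↔ (k : ℕ∞) < s.encard := fun s => by
      exact_mod_cast Iff.rfl
    have e2 : ∀ s : Set ι, ((s.encard : ℝ≥0∞) ≤ (k : ℝ≥0∞)) ↔ s.encard ≤ (k : ℕ∞) := fun s => by
      exact_mod_cast Iff.rfl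
    simp only [e1, e2]
    by_cases hne : {y : ℝ≥0 | {i | y < a i}.encard ≤ k}.Nonempty
    · rw [lt_reorder_iff_of_nonempty hne]
      refine ⟨fun h => ⟨h, ?_⟩, fun h => h.1⟩
      obtain ⟨y, hy⟩ := hne
      obtain ⟨n, hn⟩ := exists_nat_ge y
      exact ⟨n, (encard_le_encard fun i hi => lt_of_le_of_lt hn hi).trans hy⟩
    · have h0 : reorder a k = 0 := by
        unfold reorder
        rw [not_nonempty_iff_eq_empty.1 hne, NNReal.sInf_empty]
      rw [h0]
      refine ⟨fun h => absurd h (by simp), fun h => ?_⟩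
      obtain ⟨-, n, hn⟩ := h
      exact absurd ⟨(n : ℝ≥0), hn⟩ hne
  rw [h]
  exact (measurableSet_lt measurable_const (measurable_encard_lt x)).inter
    (MeasurableSet.iUnion fun n => measurableSet_le (measurable_encard_lt _) measurable_const)

lemma measurable_coalesce (i j : ℕ) : Measurable (coalesce i j) := by
  refine measurable_reorder.comp (measurable_pi_iff.2 fun k => ?_)
  split_ifs <;> fun_prop

lemma measurable_fragment (i : ℕ) :
    Measurable fun q : (ℕ → ℝ≥0) × (ℕ → ℝ≥0) => fragment i q.1 q.2 := by
  refine measurable_reorder.comp (measurable_pi_iff.2 fun k => ?_)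
  rcases k with k | k
  · simp only [Sum.elim_inl]
    split_ifs <;> fun_prop
  · simp only [Sum.elim_inr]
    fun_prop

lemma measurable_delta {α : Type*} [MeasurableSpace α] (p : ℝ) {f g : α → ℕ → ℝ≥0}
    (hf : Measurable f) (hg : Measurable g) : Measurable fun a => delta p (f a) (g a) := by
  unfold delta
  refine Measurable.tsum fun k => ENNReal.measurable_ofReal.comp ?_
  have h1 : Measurable fun a => (f a k : ℝ) :=
    measurable_coe_nnreal_real.comp ((measurable_pi_apply k).comp hf)
  have h2 : Measurable fun a => (g a k : ℝ) :=
    measurable_coe_nnreal_real.comp ((measurable_pi_apply k).comp hg)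
  exact ((h1.pow_const p).sub (h2.pow_const p)).abs

lemma measurable_massNorm (p : ℝ) : Measurable (massNorm p) := by
  unfold massNorm
  refine Measurable.tsum fun k => ?_
  exact (measurable_coe_nnreal_ennreal.comp (measurable_pi_apply k)).pow_const p

lemma IsCoagulationKernel.measurable {p : ℝ} (hp : 0 < p) {K : ℝ≥0 → ℝ≥0 → ℝ≥0}
    (hK : IsCoagulationKernel p K) : Measurable fun q : ℝ≥0 × ℝ≥0 => K q.1 q.2 := by
  classical
  have hcont : ContinuousOn (fun q : ℝ≥0 × ℝ≥0 => K q.1 q.2) (Ioi 0 ×ˢ Ioi 0) := by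
    intro q hq
    obtain ⟨κ, -, hκ⟩ := hK.holder (max q.1 q.2 + 1) (by positivity)
    rw [ContinuousWithinAt, tendsto_iff_dist_tendsto_zero]
    have hlim : Tendsto (fun r : ℝ≥0 × ℝ≥0 => κ * (|(r.1 : ℝ) ^ p - (q.1 : ℝ) ^ p| +
        |(r.2 : ℝ) ^ p - (q.2 : ℝ) ^ p|)) (𝓝[Ioi 0 ×ˢ Ioi 0] q) (𝓝 0) := by
      have hc : Continuous fun r : ℝ≥0 × ℝ≥0 => κ * (|(r.1 : ℝ) ^ p - (q.1 : ℝ) ^ p| +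
          |(r.2 : ℝ) ^ p - (q.2 : ℝ) ^ p|) := by
        have h1 : Continuous fun r : ℝ≥0 × ℝ≥0 => (r.1 : ℝ) ^ p :=
          (NNReal.continuous_coe.comp continuous_fst).rpow_const fun _ => Or.inr hp.le
        have h2 : Continuous fun r : ℝ≥0 × ℝ≥0 => (r.2 : ℝ) ^ p :=
          (NNReal.continuous_coe.comp continuous_snd).rpow_const fun _ => Or.inr hp.le
        fun_prop
      have := (hc.tendsto q).mono_left (nhdsWithin_le_nhds (s := Ioi 0 ×ˢ Ioi 0))
      simpa using this
    refine squeeze_zero' (Eventually.of_forall fun _ => dist_nonneg) ?_ hlim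
    have hnear : ∀ᶠ r : ℝ≥0 × ℝ≥0 in 𝓝 q, r.1 < max q.1 q.2 + 1 ∧ r.2 < max q.1 q.2 + 1 := by
      have h1 : q.1 < max q.1 q.2 + 1 :=
        lt_of_le_of_lt (le_max_left _ _) (lt_add_of_pos_right _ one_pos)
      have h2 : q.2 < max q.1 q.2 + 1 :=
        lt_of_le_of_lt (le_max_right _ _) (lt_add_of_pos_right _ one_pos)
      exact (continuous_fst.continuousAt.eventually_lt_const h1).and
        (continuous_snd.continuousAt.eventually_lt_const h2)
    filter_upwards [self_mem_nhdsWithin, nhdsWithin_le_nhds hnear] with r hr hr'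
    exact hκ _ ⟨hr.1, hr'.1.le⟩ _ ⟨hr.2, hr'.2.le⟩ _
      ⟨hq.1, (le_max_left _ _).trans le_self_add⟩ _ ⟨hq.2, (le_max_right _ _).trans le_self_add⟩
  have heq : (fun q : ℝ≥0 × ℝ≥0 => K q.1 q.2) =
      (Ioi 0 ×ˢ Ioi 0 : Set (ℝ≥0 × ℝ≥0)).piecewise (fun q => K q.1 q.2) 0 := by
    funext q
    by_cases hq : q ∈ (Ioi 0 ×ˢ Ioi 0 : Set (ℝ≥0 × ℝ≥0))
    · rw [piecewise_eq_of_mem _ _ _ hq]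
    · rw [piecewise_eq_of_notMem _ _ _ hq]
      simp only [mem_prod, mem_Ioi, pos_iff_ne_zero, not_and_or, not_not] at hq
      rcases hq with h | h
      · rw [h, hK.symm, hK.zero_right]; rfl
      · rw [h, hK.zero_right]; rfl
  rw [heq]
  exact hcont.measurable_piecewise continuousOn_const (measurableSet_Ioi.prod measurableSet_Ioi)

lemma IsFragmentationKernel.measurable {q : ℝ} {F : ℝ≥0 → ℝ≥0}
    (hF : IsFragmentationKernel q F) : Measurable F := by
  classical
  have hcont : ContinuousOn F (Ioi 0) := by
    intro x hx
    obtain ⟨μ, -, hμ⟩ := hF.holder (x + 1) (by positivity)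
    rw [ContinuousWithinAt, tendsto_iff_dist_tendsto_zero]
    have hlim : Tendsto (fun r : ℝ≥0 => μ * |(r : ℝ) ^ q - (x : ℝ) ^ q|)
        (𝓝[Ioi 0] x) (𝓝 0) := by
      have hx0 : (x : ℝ) ≠ 0 := by
        have : x ≠ 0 := ne_of_gt hx
        exact_mod_cast this
      have hc : ContinuousAt (fun r : ℝ≥0 => μ * |(r : ℝ) ^ q - (x : ℝ) ^ q|) x := by
        have h1 : ContinuousAt (fun r : ℝ≥0 => (r : ℝ) ^ q) x :=
          NNReal.continuous_coe.continuousAt.rpow_const (Or.inl hx0)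
        exact continuousAt_const.mul (h1.sub continuousAt_const).abs
      have := hc.tendsto.mono_left (nhdsWithin_le_nhds (s := Ioi 0))
      simpa using this
    refine squeeze_zero' (Eventually.of_forall fun _ => dist_nonneg) ?_ hlim
    have hnear : ∀ᶠ r : ℝ≥0 in 𝓝 x, r < x + 1 :=
      eventually_lt_nhds (lt_add_of_pos_right _ one_pos)
    filter_upwards [self_mem_nhdsWithin, nhdsWithin_le_nhds hnear] with r hr hr'
    exact hμ _ ⟨hr, hr'.le⟩ _ ⟨hx, le_self_add⟩
  have heq : F = (Ioi 0 : Set ℝ≥0).piecewise F 0 := by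
    funext x
    by_cases hx : x ∈ (Ioi 0 : Set ℝ≥0)
    · rw [piecewise_eq_of_mem _ _ _ hx]
    · rw [piecewise_eq_of_notMem _ _ _ hx]
      simp only [mem_Ioi, pos_iff_ne_zero, not_not] at hx
      rw [hx, hF.zero]; rfl
  rw [heq]
  exact hcont.measurable_piecewise continuousOn_const measurableSet_Ioi

lemma measurable_dislocationWeight (p : ℝ) : Measurable (dislocationWeight p) := by
  unfold dislocationWeight
  have h : ∀ k, Measurable fun θ : Ratios => (θ.1 k : ℝ≥0∞) := fun k =>
    measurable_coe_nnreal_ennreal.comp ((measurable_pi_apply k).comp measurable_subtype_coe)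
  exact (Measurable.tsum fun k => (h (k + 1)).pow_const p).add
    ((measurable_const.sub (h 0)).pow_const p)

/-- The marks of coalescence events, without their times. -/
abbrev CoagMark : Type := Pairs × ℝ≥0

/-- The marks of fragmentation events, without their times. -/
abbrev FragMark : Type := ℕ × Ratios × ℝ≥0

/-- The effect on the state `x` of a coalescence event with mark `e`. -/
noncomputable def coagStep (K : ℝ≥0 → ℝ≥0 → ℝ≥0) (e : CoagMark) (x : ℕ → ℝ≥0) : ℕ → ℝ≥0 :=
  if e.2 ≤ K (x e.1.1.1) (x e.1.1.2) then coalesce e.1.1.1 e.1.1.2 x else x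

/-- The effect on the state `x` of a fragmentation event with mark `e`. -/
noncomputable def fragStep (F : ℝ≥0 → ℝ≥0) (e : FragMark) (x : ℕ → ℝ≥0) : ℕ → ℝ≥0 :=
  if e.2.2 ≤ F (x e.1) then fragment e.1 e.2.1.1 x else x

/-- The intensity of the marks of coalescence events per unit of time. -/
noncomputable def coagMarkIntensity : Measure CoagMark :=
  (Measure.count : Measure Pairs).prod lebesgueNN

/-- The intensity of the marks of fragmentation events per unit of time. -/
noncomputable def fragMarkIntensity (β : Measure Ratios) : Measure FragMark :=
  (Measure.count : Measure ℕ).prod (β.prod lebesgueNN)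

lemma measurable_coagStep {K : ℝ≥0 → ℝ≥0 → ℝ≥0} (hK : Measurable fun q : ℝ≥0 × ℝ≥0 => K q.1 q.2) :
    Measurable fun q : CoagMark × (ℕ → ℝ≥0) => coagStep K q.1 q.2 := by
  have h : ∀ ij : Pairs, Measurable fun q : ℝ≥0 × (ℕ → ℝ≥0) => coagStep K (ij, q.1) q.2 := by
    intro ij
    have hi : ∀ i : ℕ, Measurable fun q : ℝ≥0 × (ℕ → ℝ≥0) => q.2 i := fun i => by fun_prop
    have hKi : Measurable fun q : ℝ≥0 × (ℕ → ℝ≥0) => K (q.2 ij.1.1) (q.2 ij.1.2) :=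
      hK.comp ((hi _).prodMk (hi _))
    exact Measurable.ite (measurableSet_le measurable_fst hKi)
      ((measurable_coalesce ij.1.1 ij.1.2).comp measurable_snd) measurable_snd
  have h2 : Measurable fun q : Pairs × (ℝ≥0 × (ℕ → ℝ≥0)) => coagStep K (q.1, q.2.1) q.2.2 :=
    measurable_from_prod_countable_right h
  have h3 : Measurable fun q : CoagMark × (ℕ → ℝ≥0) => (q.1.1, (q.1.2, q.2)) := by fun_prop
  exact h2.comp h3

lemma measurable_fragStep {F : ℝ≥0 → ℝ≥0} (hF : Measurable F) :
    Measurable fun q : FragMark × (ℕ → ℝ≥0) => fragStep F q.1 q.2 := by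
  have h : ∀ i : ℕ, Measurable fun q : (Ratios × ℝ≥0) × (ℕ → ℝ≥0) =>
      fragStep F (i, q.1) q.2 := by
    intro i
    have hi : Measurable fun q : (Ratios × ℝ≥0) × (ℕ → ℝ≥0) => q.2 i := by fun_prop
    have hθ : Measurable fun q : (Ratios × ℝ≥0) × (ℕ → ℝ≥0) => (q.1.1.1, q.2) :=
      (measurable_subtype_coe.comp (measurable_fst.comp measurable_fst)).prodMk measurable_snd
    have hfr : Measurable fun q : (Ratios × ℝ≥0) × (ℕ → ℝ≥0) => fragment i q.1.1.1 q.2 := by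
      have := (measurable_fragment i).comp hθ
      simpa only [Function.comp_def] using this
    have hz : Measurable fun q : (Ratios × ℝ≥0) × (ℕ → ℝ≥0) => q.1.2 := by fun_prop
    have hFi : Measurable fun q : (Ratios × ℝ≥0) × (ℕ → ℝ≥0) => F (q.2 i) := hF.comp hi
    simp only [fragStep]
    exact Measurable.ite (measurableSet_le hz hFi) hfr measurable_snd
  have h2 : Measurable fun q : ℕ × ((Ratios × ℝ≥0) × (ℕ → ℝ≥0)) =>
      fragStep F (q.1, q.2.1) q.2.2 :=
    measurable_from_prod_countable_right h
  have h3 : Measurable fun q : FragMark × (ℕ → ℝ≥0) => (q.1.1, (q.1.2, q.2)) := by fun_prop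
  exact h2.comp h3

lemma lebesgueNN_apply {s : Set ℝ≥0} (hs : MeasurableSet s) :
    lebesgueNN s = volume ((↑) '' s : Set ℝ) :=
  Measure.comap_apply _ NNReal.coe_injective
    (fun _ ht => (MeasurableEmbedding.subtype_coe measurableSet_Ici).measurableSet_image.2 ht) _ hs

lemma lebesgueNN_Iic (a : ℝ≥0) : lebesgueNN (Iic a) = a := by
  rw [lebesgueNN_apply measurableSet_Iic]
  have : ((↑) '' Iic a : Set ℝ) = Icc 0 (a : ℝ) := by
    ext y
    constructor
    · rintro ⟨z, hz, rfl⟩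
      exact ⟨z.2, by exact_mod_cast hz⟩
    · rintro ⟨h0, h1⟩
      exact ⟨⟨y, h0⟩, by exact_mod_cast h1, rfl⟩
  rw [this, Real.volume_Icc, sub_zero, ENNReal.ofReal_coe_nnreal]

lemma lebesgueNN_Ioc (a b : ℝ≥0) : lebesgueNN (Ioc a b) = ENNReal.ofReal (b - a) := by
  rw [lebesgueNN_apply measurableSet_Ioc]
  have : ((↑) '' Ioc a b : Set ℝ) = Ioc (a : ℝ) (b : ℝ) := by
    ext y
    constructor
    · rintro ⟨z, hz, rfl⟩
      exact ⟨by exact_mod_cast hz.1, by exact_mod_cast hz.2⟩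
    · rintro ⟨h0, h1⟩
      exact ⟨⟨y, a.2.trans h0.le⟩, ⟨by exact_mod_cast h0, by exact_mod_cast h1⟩, rfl⟩
  rw [this, Real.volume_Ioc]

instance : SigmaFinite lebesgueNN := by
  refine ⟨⟨⟨fun n : ℕ => Iic (n : ℝ≥0), fun _ => trivial, fun n => ?_, ?_⟩⟩⟩
  · rw [lebesgueNN_Iic]; exact ENNReal.coe_lt_top
  · ext x
    simpa using exists_nat_ge x

instance : SigmaFinite coagMarkIntensity := by
  unfold coagMarkIntensity
  infer_instance

instance (β : Measure Ratios) [SigmaFinite β] : SigmaFinite (fragMarkIntensity β) := by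
  unfold fragMarkIntensity
  infer_instance

/-! ### Mean drift of the distance -/

lemma delta_comm (p : ℝ) (x y : ℕ → ℝ≥0) : delta p x y = delta p y x := by
  unfold delta
  simp_rw [abs_sub_comm]

lemma delta_triangle (p : ℝ) (x y z : ℕ → ℝ≥0) : delta p x z ≤ delta p x y + delta p y z := by
  unfold delta
  rw [← ENNReal.tsum_add]
  refine ENNReal.tsum_le_tsum fun k => ?_
  rw [← ENNReal.ofReal_add (abs_nonneg _) (abs_nonneg _)]
  exact ENNReal.ofReal_le_ofReal (abs_sub_le _ _ _)

lemma delta_le_massNorm_add_massNorm {p : ℝ} (hp : 0 < p) (x y : ℕ → ℝ≥0) :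
    delta p x y ≤ massNorm p x + massNorm p y := by
  rw [massNorm_eq_delta_zero hp, massNorm_eq_delta_zero hp y, delta_comm p y]
  exact delta_triangle p x 0 y

/-- A coalescence event increases the distance of two states only if it affects exactly one of
them, and the particle `j` is present in both: if `j` is missing in one of the states, then the
coalescence would not modify this state, so that both states may be considered as coalescing
together, which does not increase their distance. Hence no comparison of `K(x, y)` with `K(x, 0)`
is needed, where the Hölder condition is not available. -/
lemma delta_coagStep_sub_le {p : ℝ} (hp : 0 < p) (hp1 : p ≤ 1) {K : ℝ≥0 → ℝ≥0 → ℝ≥0}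
    {x x' : ℕ → ℝ≥0} (hx : Antitone x) (hx' : Antitone x') (ij : Pairs) (z : ℝ≥0) :
    delta p (coagStep K (ij, z) x) (coagStep K (ij, z) x') - delta p x x' ≤
      {z | (0 < x ij.1.2 ∧ 0 < x' ij.1.2) ∧
          z ∈ Ioc (min (K (x ij.1.1) (x ij.1.2)) (K (x' ij.1.1) (x' ij.1.2)))
            (max (K (x ij.1.1) (x ij.1.2)) (K (x' ij.1.1) (x' ij.1.2)))}.indicator
        (fun _ => 2 * ((x ij.1.2 : ℝ≥0∞) ^ p + (x' ij.1.2 : ℝ≥0∞) ^ p)) z := by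
  obtain ⟨⟨i, j⟩, hij⟩ := ij
  have hne : i ≠ j := ne_of_lt hij
  have hcc := delta_coalesce_coalesce_le hp hp1 hx hx' hne
  rw [tsub_le_iff_left]
  simp only [coagStep, indicator_apply, mem_ofPred_eq, mem_Ioc, min_lt_iff, le_max_iff]
  split_ifs with h1 h2 h3 h3 h2 h3 h3
  · exact hcc.trans le_self_add
  · exact hcc.trans le_self_add
  · rw [add_comm]
    refine (delta_triangle p _ x _).trans (add_le_add ?_ le_rfl)
    refine (delta_coalesce_self_le hp hp1 hx hne).trans ?_
    gcongr
    exact le_self_add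
  · have h0 : x j = 0 ∨ x' j = 0 := by
      by_contra hc
      push Not at hc
      exact h3 ⟨⟨pos_iff_ne_zero.2 hc.1, pos_iff_ne_zero.2 hc.2⟩, Or.inr (not_le.1 h2), Or.inl h1⟩
    rw [add_zero]
    rcases h0 with h0 | h0
    · rw [coalesce_of_right_eq_zero hx h0]
    · rwa [coalesce_of_right_eq_zero hx' h0] at hcc
  · refine (delta_triangle p _ x' _).trans (add_le_add le_rfl ?_)
    rw [delta_comm]
    refine (delta_coalesce_self_le hp hp1 hx' hne).trans ?_
    gcongr
    exact le_add_self
  · have h0 : x j = 0 ∨ x' j = 0 := by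
      by_contra hc
      push Not at hc
      exact h3 ⟨⟨pos_iff_ne_zero.2 hc.1, pos_iff_ne_zero.2 hc.2⟩, Or.inl (not_le.1 h1), Or.inr h2⟩
    rw [add_zero]
    rcases h0 with h0 | h0
    · rwa [coalesce_of_right_eq_zero hx h0] at hcc
    · rw [coalesce_of_right_eq_zero hx' h0]
  · exact le_self_add
  · exact le_self_add

lemma lebesgueNN_Ioc_min_max (a b : ℝ≥0) :
    lebesgueNN (Ioc (min a b) (max a b)) = ENNReal.ofReal |(a : ℝ) - b| := by
  rw [lebesgueNN_Ioc, NNReal.coe_max, NNReal.coe_min, max_sub_min_eq_abs, abs_sub_comm]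

/-- The mean increase of the distance per unit of time, caused by the coalescences. -/
lemma lintegral_delta_coagStep_sub_le {p : ℝ} (hp : 0 < p) (hp1 : p ≤ 1) {K : ℝ≥0 → ℝ≥0 → ℝ≥0}
    {x x' : ℕ → ℝ≥0} (hx : Antitone x) (hx' : Antitone x') {a : ℝ≥0} (hxa : ∀ k, x k ≤ a)
    (hxa' : ∀ k, x' k ≤ a) {κ : ℝ} (hκ0 : 0 ≤ κ)
    (hκ : ∀ x ∈ Ioc 0 a, ∀ y ∈ Ioc 0 a, ∀ x' ∈ Ioc 0 a, ∀ y' ∈ Ioc 0 a,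
      |(K x y : ℝ) - K x' y'| ≤
        κ * (|(x : ℝ) ^ p - (x' : ℝ) ^ p| + |(y : ℝ) ^ p - (y' : ℝ) ^ p|)) :
    ∫⁻ e, (delta p (coagStep K e x) (coagStep K e x') - delta p x x') ∂coagMarkIntensity ≤
      ENNReal.ofReal (4 * κ) * (massNorm p x + massNorm p x') * delta p x x' := by
  set D : ℕ → ℝ≥0∞ := fun k => ENNReal.ofReal |(x k : ℝ) ^ p - (x' k : ℝ) ^ p| with hD
  set w : ℕ → ℝ≥0∞ := fun k => (x k : ℝ≥0∞) ^ p + (x' k : ℝ≥0∞) ^ p with hw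
  have hwanti : Antitone w := fun k l hkl =>
    add_le_add (ENNReal.rpow_le_rpow (by exact_mod_cast hx hkl) hp.le)
      (ENNReal.rpow_le_rpow (by exact_mod_cast hx' hkl) hp.le)
  have hpair : ∀ ij : Pairs, ∫⁻ z, (delta p (coagStep K (ij, z) x) (coagStep K (ij, z) x') -
      delta p x x') ∂lebesgueNN ≤
      ENNReal.ofReal (2 * κ) * (D ij.1.1 * w ij.1.2 + D ij.1.2 * w ij.1.1) := by
    intro ij
    refine (lintegral_mono fun z => delta_coagStep_sub_le hp hp1 hx hx' ij z).trans ?_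
    by_cases hpos : 0 < x ij.1.2 ∧ 0 < x' ij.1.2
    · simp only [hpos, true_and]
      have hset : ∀ s : Set ℝ≥0, {z | z ∈ s} = s := fun s => rfl
      rw [hset, lintegral_indicator_const measurableSet_Ioc, lebesgueNN_Ioc_min_max]
      have h1 : x ij.1.1 ∈ Ioc 0 a := ⟨hpos.1.trans_le (hx ij.2.le), hxa _⟩
      have h1' : x' ij.1.1 ∈ Ioc 0 a := ⟨hpos.2.trans_le (hx' ij.2.le), hxa' _⟩
      have h2 := hκ _ h1 _ ⟨hpos.1, hxa _⟩ _ h1' _ ⟨hpos.2, hxa' _⟩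
      have h3 : ENNReal.ofReal |(K (x ij.1.1) (x ij.1.2) : ℝ) - K (x' ij.1.1) (x' ij.1.2)| ≤
          ENNReal.ofReal κ * (D ij.1.1 + D ij.1.2) := by
        rw [hD, ← ENNReal.ofReal_add (abs_nonneg _) (abs_nonneg _), ← ENNReal.ofReal_mul hκ0]
        exact ENNReal.ofReal_le_ofReal h2
      calc 2 * w ij.1.2 * ENNReal.ofReal _
          ≤ 2 * w ij.1.2 * (ENNReal.ofReal κ * (D ij.1.1 + D ij.1.2)) := by gcongr
        _ = ENNReal.ofReal (2 * κ) * (D ij.1.1 * w ij.1.2 + D ij.1.2 * w ij.1.2) := by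
            rw [ENNReal.ofReal_mul zero_le_two, ENNReal.ofReal_ofNat]; ring
        _ ≤ _ := by gcongr; exact hwanti ij.2.le
    · simp [hpos]
  have hsum : ∀ f g : ℕ → ℝ≥0∞, ∑' ij : Pairs, f ij.1.1 * g ij.1.2 ≤ (∑' i, f i) * ∑' j, g j := by
    intro f g
    refine (ENNReal.tsum_comp_le_tsum_of_injective Subtype.val_injective
      (fun q : ℕ × ℕ => f q.1 * g q.2)).trans (le_of_eq ?_)
    rw [ENNReal.tsum_prod']
    simp_rw [ENNReal.tsum_mul_left]
    rw [ENNReal.tsum_mul_right]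
  have hW : ∑' k, w k = massNorm p x + massNorm p x' := ENNReal.tsum_add
  have hdel : ∑' k, D k = delta p x x' := rfl
  calc _ ≤ ∫⁻ ij : Pairs, ∫⁻ z, (delta p (coagStep K (ij, z) x) (coagStep K (ij, z) x') -
        delta p x x') ∂lebesgueNN ∂Measure.count := lintegral_prod_le _
    _ ≤ ∫⁻ ij : Pairs, ENNReal.ofReal (2 * κ) * (D ij.1.1 * w ij.1.2 + D ij.1.2 * w ij.1.1)
        ∂Measure.count := lintegral_mono hpair
    _ = ENNReal.ofReal (2 * κ) * (∑' ij : Pairs, D ij.1.1 * w ij.1.2 +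
        ∑' ij : Pairs, w ij.1.1 * D ij.1.2) := by
        rw [lintegral_count, ENNReal.tsum_mul_left, ENNReal.tsum_add]
        simp_rw [mul_comm (w _)]
    _ ≤ ENNReal.ofReal (2 * κ) * ((∑' k, D k) * (∑' k, w k) + (∑' k, w k) * ∑' k, D k) := by
        gcongr <;> exact hsum _ _
    _ = _ := by
        have : ENNReal.ofReal (4 * κ) = 2 * ENNReal.ofReal (2 * κ) := by
          rw [← ENNReal.ofReal_ofNat 2, ← ENNReal.ofReal_mul zero_le_two]
          ring_nf
        rw [hW, hdel, this]; ring

lemma sum_rpow_le_dislocationWeight (p : ℝ) (θ : Ratios) :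
    ∑' k, (θ.1 (k + 1) : ℝ≥0∞) ^ p ≤ dislocationWeight p θ := le_self_add

/-- As for coalescences, a fragmentation event that meets a missing particle in one of the states
may be considered as affecting both of them. -/
lemma delta_fragStep_sub_le {p : ℝ} (hp : 0 < p) (hp1 : p ≤ 1) {F : ℝ≥0 → ℝ≥0}
    {x x' : ℕ → ℝ≥0} (hx : Antitone x) (hx' : Antitone x') (i : ℕ) (θ : Ratios) (z : ℝ≥0) :
    delta p (fragStep F (i, θ, z) x) (fragStep F (i, θ, z) x') - delta p x x' ≤
      dislocationWeight p θ *
        ((Iic (max (F (x i)) (F (x' i)))).indicator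
            (fun _ => ENNReal.ofReal |(x i : ℝ) ^ p - (x' i : ℝ) ^ p|) z +
          {z | (0 < x i ∧ 0 < x' i) ∧ z ∈ Ioc (min (F (x i)) (F (x' i)))
            (max (F (x i)) (F (x' i)))}.indicator
            (fun _ => (max (x i) (x' i) : ℝ≥0∞) ^ p) z) := by
  have hff := (delta_fragment_fragment_le hp hx hx' i θ).trans
    (add_le_add le_rfl (mul_le_mul_left (sum_rpow_le_dislocationWeight p θ) _))
  rw [tsub_le_iff_left]
  set T : Set ℝ≥0 := {z | (0 < x i ∧ 0 < x' i) ∧ z ∈ Ioc (min (F (x i)) (F (x' i)))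
    (max (F (x i)) (F (x' i)))} with hT
  have hmax : ∀ {z}, z ≤ F (x i) ∨ z ≤ F (x' i) → z ∈ Iic (max (F (x i)) (F (x' i))) :=
    fun h => le_max_iff.2 h
  simp only [fragStep]
  split_ifs with h1 h2 h2
  · rw [indicator_of_mem (hmax (Or.inl h1)), mul_add, ← add_assoc]
    exact hff.trans le_self_add
  · by_cases hpos : 0 < x i ∧ 0 < x' i
    · have hzT : z ∈ T := ⟨hpos, min_lt_iff.2 (Or.inr (not_le.1 h2)), le_max_iff.2 (Or.inl h1)⟩
      rw [indicator_of_mem hzT, mul_add, add_comm]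
      refine (delta_triangle p _ x _).trans (add_le_add ?_ le_rfl)
      refine ((delta_fragment_self_le hp hp1 hx i θ).trans ?_).trans le_add_self
      gcongr
      exact le_max_left _ _
    · rw [indicator_of_mem (hmax (Or.inl h1)), mul_add, ← add_assoc]
      refine le_trans ?_ le_self_add
      have h0 : x i = 0 ∨ x' i = 0 := by
        by_contra hc
        push Not at hc
        exact hpos ⟨pos_iff_ne_zero.2 hc.1, pos_iff_ne_zero.2 hc.2⟩
      rcases h0 with h0 | h0
      · rw [fragment_of_eq_zero hx θ.1 h0]; exact le_self_add
      · rwa [fragment_of_eq_zero hx' θ.1 h0] at hff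
  · by_cases hpos : 0 < x i ∧ 0 < x' i
    · have hzT : z ∈ T := ⟨hpos, min_lt_iff.2 (Or.inl (not_le.1 h1)), le_max_iff.2 (Or.inr h2)⟩
      rw [indicator_of_mem hzT, mul_add]
      refine (delta_triangle p _ x' _).trans (add_le_add le_rfl ?_)
      rw [delta_comm]
      refine ((delta_fragment_self_le hp hp1 hx' i θ).trans ?_).trans le_add_self
      gcongr
      exact le_max_right _ _
    · rw [indicator_of_mem (hmax (Or.inr h2)), mul_add, ← add_assoc]
      refine le_trans ?_ le_self_add
      have h0 : x i = 0 ∨ x' i = 0 := by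
        by_contra hc
        push Not at hc
        exact hpos ⟨pos_iff_ne_zero.2 hc.1, pos_iff_ne_zero.2 hc.2⟩
      rcases h0 with h0 | h0
      · rwa [fragment_of_eq_zero hx θ.1 h0] at hff
      · rw [fragment_of_eq_zero hx' θ.1 h0]; exact le_self_add
  · exact le_self_add

/-- The mean increase of the distance per unit of time, caused by the fragmentations; `L` controls
the effect of the fragmentations that affect only one of the states. -/
lemma lintegral_delta_fragStep_sub_le {p : ℝ} (hp : 0 < p) (hp1 : p ≤ 1) {F : ℝ≥0 → ℝ≥0}
    (β : Measure Ratios) [SFinite β]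
    {x x' : ℕ → ℝ≥0} (hx : Antitone x) (hx' : Antitone x') {B L : ℝ≥0∞}
    (hB : ∀ k, (F (x k) : ℝ≥0∞) ≤ B) (hB' : ∀ k, (F (x' k) : ℝ≥0∞) ≤ B)
    (hL : ∀ k, 0 < x k → 0 < x' k → ENNReal.ofReal |(F (x k) : ℝ) - F (x' k)| *
      (max (x k) (x' k) : ℝ≥0∞) ^ p ≤ L * ENNReal.ofReal |(x k : ℝ) ^ p - (x' k : ℝ) ^ p|) :
    ∫⁻ e, (delta p (fragStep F e x) (fragStep F e x') - delta p x x') ∂fragMarkIntensity β ≤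
      (B + L) * betaConst p β * delta p x x' := by
  set D : ℕ → ℝ≥0∞ := fun k => ENNReal.ofReal |(x k : ℝ) ^ p - (x' k : ℝ) ^ p| with hD
  have hz : ∀ i θ, ∫⁻ z, (delta p (fragStep F (i, θ, z) x) (fragStep F (i, θ, z) x') -
      delta p x x') ∂lebesgueNN ≤ dislocationWeight p θ * ((B + L) * D i) := by
    intro i θ
    refine (lintegral_mono fun z => delta_fragStep_sub_le hp hp1 hx hx' i θ z).trans ?_
    have hm : MeasurableSet {z | (0 < x i ∧ 0 < x' i) ∧ z ∈ Ioc (min (F (x i)) (F (x' i)))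
            (max (F (x i)) (F (x' i)))} := (MeasurableSet.const _).inter measurableSet_Ioc
    rw [lintegral_const_mul _ (by
        exact (measurable_const.indicator measurableSet_Iic).add (measurable_const.indicator hm)),
      lintegral_add_left (measurable_const.indicator measurableSet_Iic),
      lintegral_indicator_const measurableSet_Iic, lebesgueNN_Iic, lintegral_indicator_const hm,
      add_mul]
    refine mul_le_mul_right (add_le_add ?_ ?_) _
    · rw [mul_comm]
      refine mul_le_mul_left ?_ _
      rw [ENNReal.coe_max]
      exact max_le (hB i) (hB' i)
    · by_cases hpos : 0 < x i ∧ 0 < x' i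
      · have hset : {z | (0 < x i ∧ 0 < x' i) ∧ z ∈ Ioc (min (F (x i)) (F (x' i)))
            (max (F (x i)) (F (x' i)))} = Ioc (min (F (x i)) (F (x' i)))
            (max (F (x i)) (F (x' i))) := by ext; simp [hpos]
        rw [hset, lebesgueNN_Ioc_min_max, mul_comm]
        exact hL i hpos.1 hpos.2
      · simp [hpos]
  calc _ ≤ ∫⁻ i : ℕ, ∫⁻ e, (delta p (fragStep F (i, e) x) (fragStep F (i, e) x') -
        delta p x x') ∂(β.prod lebesgueNN) ∂Measure.count := lintegral_prod_le _
    _ ≤ ∫⁻ i : ℕ, (B + L) * betaConst p β * D i ∂Measure.count := by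
        refine lintegral_mono fun i => (lintegral_prod_le _).trans ?_
        refine (lintegral_mono fun θ => hz i θ).trans (le_of_eq ?_)
        rw [lintegral_mul_const _ (measurable_dislocationWeight p)]
        have : ∫⁻ θ, dislocationWeight p θ ∂β = betaConst p β := rfl
        rw [this]; ring
    _ = _ := by rw [lintegral_count, ENNReal.tsum_mul_left]; rfl

/-- Comparison of a power difference of exponent `q` with one of exponent `p`. By homogeneity this
reduces to `1 - r ^ q ≤ max (q / p) 1 * (1 - r ^ p)` for `0 < r ≤ 1`, which is Bernoulli's
inequality if `p ≤ q`, and monotonicity in the exponent otherwise. -/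
lemma abs_rpow_sub_mul_max_rpow_le {p q : ℝ} (hp : 0 < p) (hq : 0 ≤ q) {u v a : ℝ} (hu : 0 < u)
    (hv : 0 < v) (hua : u ≤ a) (hva : v ≤ a) :
    |u ^ q - v ^ q| * max u v ^ p ≤ max (q / p) 1 * a ^ q * |u ^ p - v ^ p| := by
  wlog h : v ≤ u generalizing u v
  · rw [abs_sub_comm, max_comm, abs_sub_comm (u ^ p)]
    exact this hv hu hva hua (le_of_not_ge h)
  rw [max_eq_left h, abs_of_nonneg (sub_nonneg.2 (Real.rpow_le_rpow hv.le h hq)),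
    abs_of_nonneg (sub_nonneg.2 (Real.rpow_le_rpow hv.le h hp.le))]
  obtain ⟨r, hr0, hr1, rfl⟩ : ∃ r : ℝ, 0 < r ∧ r ≤ 1 ∧ v = r * u :=
    ⟨v / u, by positivity, (div_le_one hu).2 h, by field_simp⟩
  rw [Real.mul_rpow hr0.le hu.le, Real.mul_rpow hr0.le hu.le]
  have hrp : r ^ p ≤ 1 := Real.rpow_le_one hr0.le hr1 hp.le
  have key : 1 - r ^ q ≤ max (q / p) 1 * (1 - r ^ p) := by
    rcases le_or_gt 1 (q / p) with h1 | h1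
    · rw [max_eq_left h1]
      have h2 := one_add_mul_self_le_rpow_one_add (s := r ^ p - 1)
        (by have := Real.rpow_pos_of_pos hr0 p; linarith) h1
      rw [add_sub_cancel, ← Real.rpow_mul hr0.le, mul_div_cancel₀ _ hp.ne'] at h2
      linarith
    · rw [max_eq_right h1.le, one_mul]
      have h2 : r ^ p ≤ r ^ q :=
        Real.rpow_le_rpow_of_exponent_ge hr0 hr1 ((div_lt_one hp).1 h1).le
      linarith
  have huq : u ^ q ≤ a ^ q := Real.rpow_le_rpow hu.le hua hq
  have h0 : 0 ≤ u ^ p := by positivity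
  have h1 : 0 ≤ u ^ q := by positivity
  have h2 : 0 ≤ max (q / p) 1 * (1 - r ^ p) := mul_nonneg (by positivity) (by linarith)
  calc (u ^ q - r ^ q * u ^ q) * u ^ p = u ^ q * (1 - r ^ q) * u ^ p := by ring
    _ ≤ u ^ q * (max (q / p) 1 * (1 - r ^ p)) * u ^ p := by gcongr
    _ ≤ a ^ q * (max (q / p) 1 * (1 - r ^ p)) * u ^ p := by gcongr
    _ = _ := by ring

/-! ### Poisson measures: independence of the future and mean measure -/

lemma lintegral_natCast_poissonMeasure (r : ℝ≥0) :
    ∫⁻ n : ℕ, (n : ℝ≥0∞) ∂poissonMeasure r = r := by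
  rw [poissonMeasure, lintegral_sum_measure]
  simp_rw [lintegral_smul_measure, lintegral_dirac, smul_eq_mul]
  rw [tsum_eq_zero_add' ENNReal.summable]
  have h : ∀ n : ℕ, ENNReal.ofReal (Real.exp (-(r : ℝ)) * (r : ℝ) ^ (n + 1) / (n + 1).factorial) *
      ((n + 1 : ℕ) : ℝ≥0∞) =
      r * ENNReal.ofReal (Real.exp (-(r : ℝ)) * (r : ℝ) ^ n / n.factorial) := by
    intro n
    rw [← ENNReal.ofReal_natCast, ← ENNReal.ofReal_mul (by positivity),
      ← ENNReal.ofReal_coe_nnreal (p := r), ← ENNReal.ofReal_mul (by positivity)]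
    congr 1
    rw [Nat.factorial_succ]
    push_cast
    field_simp
    ring
  simp_rw [h]
  rw [ENNReal.tsum_mul_left, ← ENNReal.ofReal_tsum_of_nonneg (fun n => by positivity)
    (hasSum_one_poissonMeasure r).summable, (hasSum_one_poissonMeasure r).tsum_eq]
  simp

lemma poissonMeasure_two_le (r : ℝ≥0) : poissonMeasure r {n | 2 ≤ n} ≤ (r : ℝ≥0∞) ^ 2 := by
  have hc : {n : ℕ | 2 ≤ n} = ({0} ∪ {1})ᶜ := by
    ext n; simp; omega
  rw [hc, prob_compl_eq_one_sub (MeasurableSet.of_discrete),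
    measure_union (by simp) MeasurableSet.of_discrete, poissonMeasure_singleton,
    poissonMeasure_singleton, ← ENNReal.ofReal_add (by positivity) (by positivity),
    ← ENNReal.ofReal_one, ← ENNReal.ofReal_sub _ (by positivity), ← ENNReal.ofReal_coe_nnreal,
    ← ENNReal.ofReal_pow (by positivity)]
  refine ENNReal.ofReal_le_ofReal ?_
  have h1 := Real.add_one_le_exp (-(r : ℝ))
  have h2 : (0 : ℝ) ≤ r := r.2
  simp only [pow_zero, mul_one, Nat.factorial_zero, Nat.cast_one, div_one, pow_one,
    Nat.factorial_one]
  nlinarith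

section PoissonMeasure

variable {Ω E : Type*} [MeasurableSpace Ω] [MeasurableSpace E] {P : Measure Ω} {N : Ω → Measure E}
  {ν : Measure E}

lemma IsPoissonMeasure.measurable_apply (h : IsPoissonMeasure P N ν) {A : Set E}
    (hA : MeasurableSet A) : Measurable fun ω => N ω A :=
  (Measure.measurable_coe hA).comp h.measurable

lemma IsPoissonMeasure.lintegral_apply (h : IsPoissonMeasure P N ν) {A : Set E}
    (hA : MeasurableSet A) (hν : ν A < ∞) : ∫⁻ ω, N ω A ∂P = ν A := by
  have h1 : ∫⁻ ω, N ω A ∂P = ∫⁻ y, y ∂(P.map fun ω => N ω A) :=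
    (lintegral_map measurable_id (h.measurable_apply hA)).symm
  rw [h1, h.law_of_lt_top A hA hν,
    lintegral_map (f := fun y => y) measurable_id' (by fun_prop),
    lintegral_natCast_poissonMeasure, ENNReal.coe_toNNReal hν.ne]

lemma IsPoissonMeasure.measure_two_le (h : IsPoissonMeasure P N ν) {A : Set E}
    (hA : MeasurableSet A) (hν : ν A < ∞) : P {ω | 2 ≤ N ω A} ≤ ν A ^ 2 := by
  have h1 : P {ω | 2 ≤ N ω A} = (P.map fun ω => N ω A) (Ici 2) :=
    (Measure.map_apply (h.measurable_apply hA) measurableSet_Ici).symm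
  rw [h1, h.law_of_lt_top A hA hν, Measure.map_apply (by fun_prop) measurableSet_Ici]
  have h2 : (fun n : ℕ => (n : ℝ≥0∞)) ⁻¹' Ici 2 = {n | 2 ≤ n} := by
    ext n
    simp only [mem_preimage, mem_Ici, mem_ofPred_eq]
    exact_mod_cast Iff.rfl
  rw [h2]
  refine (poissonMeasure_two_le _).trans (le_of_eq ?_)
  rw [ENNReal.coe_toNNReal hν.ne]

lemma IsPoissonMeasure.measure_one_le (h : IsPoissonMeasure P N ν) {A : Set E}
    (hA : MeasurableSet A) (hν : ν A < ∞) : P {ω | 1 ≤ N ω A} ≤ ν A := by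
  have := mul_meas_ge_le_lintegral (μ := P) (h.measurable_apply hA) 1
  rwa [one_mul, h.lintegral_apply hA hν] at this

/-- The `indep` field for an arbitrary finite index type. -/
lemma IsPoissonMeasure.iIndepFun_apply (h : IsPoissonMeasure P N ν) {ι : Type*} [Fintype ι]
    (A : ι → Set E) (hA : ∀ i, MeasurableSet (A i))
    (hd : Pairwise fun i j => Disjoint (A i) (A j)) : iIndepFun (fun i ω => N ω (A i)) P := by
  have e := Fintype.equivFin ι
  have h1 := h.indep (Fintype.card ι) (fun k => A (e.symm k)) (fun k => hA _)
    fun k l hkl => hd (e.symm.injective.ne hkl)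
  have h2 := h1.precomp (g := e) e.injective
  simpa using h2

/-- The restriction of a Poisson measure to a set `D` is independent of the mass of any set `C`
disjoint from `D`. Finitely many subsets of `D` generate a finite partition of `D`, to which the
independence of the masses of disjoint sets applies. -/
lemma IsPoissonMeasure.indep_comap_restrict [IsProbabilityMeasure P] (h : IsPoissonMeasure P N ν)
    {D C : Set E} (hD : MeasurableSet D) (hC : MeasurableSet C) (hDC : Disjoint D C) :
    Indep (MeasurableSpace.comap (fun ω => (N ω).restrict D) inferInstance)
      (MeasurableSpace.comap (fun ω => N ω C) inferInstance) P := by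
  classical
  set m : Finset {A : Set E // MeasurableSet A} → MeasurableSpace Ω := fun S =>
    ⨆ A ∈ S, MeasurableSpace.comap (fun ω => N ω (A.1 ∩ D)) inferInstance with hm
  have hle : MeasurableSpace.comap (fun ω => (N ω).restrict D) inferInstance ≤ ⨆ S, m S := by
    refine Measurable.comap_le ?_
    refine @Measure.measurable_of_measurable_coe E Ω _ (⨆ S, m S) _ fun A hA => ?_
    have h1 : MeasurableSpace.comap (fun ω => N ω (A ∩ D)) inferInstance ≤ ⨆ S, m S := by
      refine le_trans ?_ (le_iSup m {⟨A, hA⟩})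
      simp only [hm, Finset.mem_singleton, iSup_iSup_eq_left]
      exact le_rfl
    simp_rw [Measure.restrict_apply hA]
    exact Measurable.mono (comap_measurable (fun ω => N ω (A ∩ D))) h1 le_rfl
  refine indep_of_indep_of_le_left (indep_iSup_of_directed_le (m := m) ?_ ?_ ?_ ?_) hle
  · intro S
    -- the members of the partition of `D` generated by `S`, together with `C`
    set B : Option (S → Bool) → Set E := fun T => T.elim C fun T =>
      D ∩ ⋂ A : S, if T A then A.1.1 else A.1.1ᶜ with hB
    have hBm : ∀ T, MeasurableSet (B T) := by
      rintro (_ | T)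
      · exact hC
      · refine hD.inter (MeasurableSet.iInter fun A => ?_)
        split_ifs
        · exact A.1.2
        · exact A.1.2.compl
    have hBd : Pairwise fun T T' => Disjoint (B T) (B T') := by
      rintro (_ | T) (_ | T') hne
      · exact absurd rfl hne
      · exact hDC.symm.mono_right inter_subset_left
      · exact hDC.mono_left inter_subset_left
      · have : T ≠ T' := fun h => hne (by rw [h])
        obtain ⟨A, hA⟩ := Function.ne_iff.1 this
        rw [Set.disjoint_left]
        intro e he he'
        have h1 := mem_iInter.1 he.2 A
        have h2 := mem_iInter.1 he'.2 A
        cases hT : T A <;> cases hT' : T' A <;> simp_all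
    have hind := (h.iIndepFun_apply B hBm hBd).indepFun_finset {none}ᶜ {none}
      disjoint_compl_left fun T => h.measurable_apply (hBm T)
    have hsum : ∀ A : S, ∀ ω, N ω (A.1.1 ∩ D) =
        ∑ T : ({none}ᶜ : Finset (Option (S → Bool))),
          if (T.1.elim false fun T => T A) then N ω (B T.1) else 0 := by
      intro A ω
      have hU : A.1.1 ∩ D = ⋃ T : {T : ({none}ᶜ : Finset (Option (S → Bool))) //
          (T.1.elim false fun T => T A) = true}, B T.1.1 := by
        ext e
        simp only [mem_inter_iff, mem_iUnion]
        constructor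
        · rintro ⟨heA, heD⟩
          refine ⟨⟨⟨some fun A => decide (e ∈ A.1.1), by simp⟩, by simpa using heA⟩, heD, ?_⟩
          refine mem_iInter.2 fun A' => ?_
          by_cases h' : e ∈ A'.1.1 <;> simp [h']
        · rintro ⟨⟨⟨T, hT⟩, hTA⟩, he⟩
          rcases T with _ | T
          · simp at hT
          · have h1 := mem_iInter.1 he.2 A
            simp only [Option.elim] at hTA
            rw [hTA] at h1
            exact ⟨by simpa using h1, he.1⟩
      rw [hU, measure_iUnion, tsum_fintype, ← Finset.sum_filter]
      · refine (Finset.sum_subtype (p := fun T : ({none}ᶜ : Finset (Option (S → Bool))) =>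
          (T.1.elim false fun T => T A) = true) _ (by simp) (fun T => N ω (B T.1))).symm
      · intro T T' hne
        exact hBd fun h => hne (Subtype.ext (Subtype.ext h))
      · exact fun T => hBm _
    refine indep_of_indep_of_le_left (indep_of_indep_of_le_right hind ?_) ?_
    · refine Measurable.comap_le ?_
      have : Measurable fun g : ({none} : Finset (Option (S → Bool))) → ℝ≥0∞ =>
        g ⟨none, by simp⟩ := measurable_pi_apply _
      exact this.comp (comap_measurable _)
    · refine iSup₂_le fun A hA => Measurable.comap_le ?_
      have h1 : Measurable fun g : ({none}ᶜ : Finset (Option (S → Bool))) → ℝ≥0∞ =>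
          ∑ T, if (T.1.elim false fun T => T ⟨A, hA⟩) then g T else 0 := by
        refine Finset.measurable_sum _ fun T _ => ?_
        split_ifs
        · exact measurable_pi_apply _
        · exact measurable_const
      simp_rw [hsum ⟨A, hA⟩]
      exact h1.comp (comap_measurable _)
  · intro S
    exact iSup₂_le fun A _ => (h.measurable_apply (A.2.inter hD)).comap_le
  · exact (h.measurable_apply hC).comap_le
  · intro S T
    refine ⟨S ∪ T, ?_, ?_⟩
    · exact iSup₂_le fun A hA => le_iSup₂_of_le A (Finset.mem_union_left _ hA) le_rfl
    · exact iSup₂_le fun A hA => le_iSup₂_of_le A (Finset.mem_union_right _ hA) le_rfl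

end PoissonMeasure

lemma indep_sup_left_of_indep_sup {Ω : Type*} {m1 m2 m3 mΩ : MeasurableSpace Ω} {P : Measure Ω}
    [IsProbabilityMeasure P] (h1 : m1 ≤ mΩ) (h2 : m2 ≤ mΩ) (h3 : m3 ≤ mΩ) (h12 : Indep m1 m2 P)
    (h : Indep (m1 ⊔ m2) m3 P) : Indep (m1 ⊔ m3) m2 P := by
  set π : Set (Set Ω) := {s | ∃ a b, MeasurableSet[m1] a ∧ MeasurableSet[m3] b ∧ s = a ∩ b} with hπ
  have hgen : m1 ⊔ m3 = MeasurableSpace.generateFrom π := by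
    apply le_antisymm
    · refine sup_le (fun a ha => ?_) (fun b hb => ?_)
      · exact MeasurableSpace.measurableSet_generateFrom ⟨a, univ, ha, .univ, by simp⟩
      · exact MeasurableSpace.measurableSet_generateFrom ⟨univ, b, .univ, hb, by simp⟩
    · refine MeasurableSpace.generateFrom_le ?_
      rintro s ⟨a, b, ha, hb, rfl⟩
      exact MeasurableSet.inter ((le_sup_left : m1 ≤ m1 ⊔ m3) a ha)
        ((le_sup_right : m3 ≤ m1 ⊔ m3) b hb)
  have hpi : IsPiSystem π := by
    rintro s ⟨a, b, ha, hb, rfl⟩ t ⟨a', b', ha', hb', rfl⟩ -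
    exact ⟨a ∩ a', b ∩ b', ha.inter ha', hb.inter hb', inter_inter_inter_comm a b a' b'⟩
  refine IndepSets.indep (sup_le h1 h3) h2 hpi (@MeasurableSpace.isPiSystem_measurableSet Ω m2)
    hgen (@MeasurableSpace.generateFrom_measurableSet Ω m2).symm ?_
  rw [IndepSets_iff]
  rintro s t ⟨a, b, ha, hb, rfl⟩ ht
  rw [Indep_iff] at h12 h
  have e1 := h (a ∩ t) b (MeasurableSet.inter ((le_sup_left : m1 ≤ m1 ⊔ m2) a ha)
        ((le_sup_right : m2 ≤ m1 ⊔ m2) t ht)) hb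
  have e2 := h a b ((le_sup_left : m1 ≤ m1 ⊔ m2) a ha) hb
  rw [inter_right_comm, e1, e2, h12 a t ha ht]
  ring

section Compensation

variable {Ω S E : Type*} [MeasurableSpace Ω] [MeasurableSpace S] [MeasurableSpace E]
  {P : Measure Ω} [IsProbabilityMeasure P]

/-- Let the random measure `κ` have mean `ν` and let the mass under `κ` of any set of finite mean be
independent of `Y`. Then `κ` may be replaced by `ν` in the mean of the integral of a function of
`Y` and of the integration variable. -/
lemma lintegral_lintegral_of_indepFun {Y : Ω → S} (hY : Measurable Y) {κ : Ω → Measure E}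
    (hκ : ∀ B, MeasurableSet B → Measurable fun ω => κ ω B) {ν : Measure E} [SigmaFinite ν]
    (hmean : ∀ B, MeasurableSet B → ν B < ∞ → ∫⁻ ω, κ ω B ∂P = ν B)
    (hind : ∀ B, MeasurableSet B → ν B < ∞ → IndepFun Y (fun ω => κ ω B) P)
    {h : S × E → ℝ≥0∞} (hh : Measurable h) :
    AEMeasurable (fun ω => ∫⁻ e, h (Y ω, e) ∂κ ω) P ∧
      ∫⁻ ω, ∫⁻ e, h (Y ω, e) ∂κ ω ∂P = ∫⁻ ω, ∫⁻ e, h (Y ω, e) ∂ν ∂P := by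
  have hsec : ∀ (T : Set (S × E)) (ω : Ω), MeasurableSet T →
      MeasurableSet (Prod.mk (Y ω) ⁻¹' T) := fun T ω hT => measurable_prodMk_left hT
  have hνm : ∀ T : Set (S × E), MeasurableSet T →
      Measurable fun ω => ν (Prod.mk (Y ω) ⁻¹' T) := fun T hT =>
    (measurable_measure_prodMk_left (ν := ν) hT).comp hY
  -- sets, inside a set `B` of finite measure
  have hfin : ∀ B, MeasurableSet B → ν B < ∞ → ∀ T : Set (S × E), MeasurableSet T →
      AEMeasurable (fun ω => κ ω (B ∩ Prod.mk (Y ω) ⁻¹' T)) P ∧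
        ∫⁻ ω, κ ω (B ∩ Prod.mk (Y ω) ⁻¹' T) ∂P = ∫⁻ ω, ν (B ∩ Prod.mk (Y ω) ⁻¹' T) ∂P := by
    intro B hB hBν
    have hBκ : ∀ᵐ ω ∂P, κ ω B < ∞ := by
      refine ae_lt_top (hκ B hB) ?_
      rw [hmean B hB hBν]; exact hBν.ne
    have hνBm : ∀ T : Set (S × E), MeasurableSet T →
        Measurable fun ω => ν (B ∩ Prod.mk (Y ω) ⁻¹' T) := fun T hT => by
      have h1 := hνm _ ((measurable_snd hB).inter hT)
      exact h1
    refine MeasurableSpace.induction_on_inter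
      (C := fun T _ => AEMeasurable (fun ω => κ ω (B ∩ Prod.mk (Y ω) ⁻¹' T)) P ∧
        ∫⁻ ω, κ ω (B ∩ Prod.mk (Y ω) ⁻¹' T) ∂P = ∫⁻ ω, ν (B ∩ Prod.mk (Y ω) ⁻¹' T) ∂P)
      generateFrom_prod.symm isPiSystem_prod ?_ ?_ ?_ ?_
    · simp
    · rintro _ ⟨U, hU, V, hV, rfl⟩
      have hset : ∀ (μ : Measure E) (ω : Ω), μ (B ∩ Prod.mk (Y ω) ⁻¹' (U ×ˢ V)) =
          U.indicator 1 (Y ω) * μ (B ∩ V) := by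
        intro μ ω
        by_cases hω : Y ω ∈ U
        · simp [mk_preimage_prod_right, hω]
        · simp [mk_preimage_prod_right_eq_empty, hω]
      simp_rw [hset]
      have hBV : ν (B ∩ V) < ∞ := (measure_mono inter_subset_left).trans_lt hBν
      have hi : Measurable fun ω => U.indicator (1 : S → ℝ≥0∞) (Y ω) :=
        (measurable_one.indicator hU).comp hY
      refine ⟨(hi.mul (hκ _ (hB.inter hV))).aemeasurable, ?_⟩
      have hI : IndepFun (fun ω => U.indicator (1 : S → ℝ≥0∞) (Y ω)) (fun ω => κ ω (B ∩ V)) P :=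
        (hind _ (hB.inter hV) hBV).comp (φ := U.indicator (1 : S → ℝ≥0∞)) (ψ := id)
          (measurable_one.indicator hU) measurable_id
      have := lintegral_mul_eq_lintegral_mul_lintegral_of_indepFun hi (hκ _ (hB.inter hV)) hI
      simp only [Pi.mul_apply] at this
      rw [this, hmean _ (hB.inter hV) hBV, lintegral_mul_const _ hi]
    · intro T hT ⟨ih1, ih2⟩
      have hc : ∀ (μ : Measure E) (ω : Ω), μ B < ∞ → μ (B ∩ Prod.mk (Y ω) ⁻¹' Tᶜ) =
          μ B - μ (B ∩ Prod.mk (Y ω) ⁻¹' T) := by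
        intro μ ω hμ
        have : B ∩ Prod.mk (Y ω) ⁻¹' Tᶜ = B \ (B ∩ Prod.mk (Y ω) ⁻¹' T) := by
          ext e
          exact ⟨fun h => ⟨h.1, fun h' => h.2 h'.2⟩, fun h => ⟨h.1, fun h' => h.2 ⟨h.1, h'⟩⟩⟩
        rw [this, measure_sdiff inter_subset_left (hB.inter (hsec T ω hT)).nullMeasurableSet
          ((measure_mono inter_subset_left).trans_lt hμ).ne]
      have hlt : ∫⁻ ω, ν (B ∩ Prod.mk (Y ω) ⁻¹' T) ∂P < ∞ := by
        refine lt_of_le_of_lt (lintegral_mono (g := fun _ => ν B)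
          fun ω => measure_mono inter_subset_left) ?_
        simpa using hBν
      have hcκ : (fun ω => κ ω (B ∩ Prod.mk (Y ω) ⁻¹' Tᶜ)) =ᵐ[P]
          fun ω => κ ω B - κ ω (B ∩ Prod.mk (Y ω) ⁻¹' T) := by
        filter_upwards [hBκ] with ω hω using hc _ ω hω
      refine ⟨((hκ B hB).aemeasurable.sub ih1).congr hcκ.symm, ?_⟩
      rw [lintegral_congr_ae hcκ]
      simp_rw [hc ν _ hBν]
      rw [lintegral_sub' ih1 ?_ (Eventually.of_forall fun ω => measure_mono inter_subset_left),
        lintegral_sub' (hνBm T hT).aemeasurable ?_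
        (Eventually.of_forall fun ω => measure_mono inter_subset_left), ih2, hmean B hB hBν]
      · simp
      · exact hlt.ne
      · rw [ih2]; exact hlt.ne
    · intro T hTd hTm ih
      have hU : ∀ (μ : Measure E) (ω : Ω), μ (B ∩ Prod.mk (Y ω) ⁻¹' ⋃ i, T i) =
          ∑' i, μ (B ∩ Prod.mk (Y ω) ⁻¹' T i) := by
        intro μ ω
        rw [preimage_iUnion, inter_iUnion, measure_iUnion]
        · intro i j hij
          exact ((hTd hij).preimage _).mono inter_subset_right inter_subset_right
        · exact fun i => hB.inter (hsec _ ω (hTm i))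
      simp_rw [hU]
      refine ⟨AEMeasurable.tsum fun i => (ih i).1, ?_⟩
      rw [lintegral_tsum fun i => (ih i).1,
        lintegral_tsum fun i => (hνBm _ (hTm i)).aemeasurable]
      exact tsum_congr fun i => (ih i).2
  -- arbitrary measurable sets
  have hset : ∀ T : Set (S × E), MeasurableSet T →
      AEMeasurable (fun ω => κ ω (Prod.mk (Y ω) ⁻¹' T)) P ∧
        ∫⁻ ω, κ ω (Prod.mk (Y ω) ⁻¹' T) ∂P = ∫⁻ ω, ν (Prod.mk (Y ω) ⁻¹' T) ∂P := by
    intro T hT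
    set B := disjointed (spanningSets ν) with hBdef
    have hBm : ∀ n, MeasurableSet (B n) := fun n =>
      MeasurableSet.disjointed (fun n => measurableSet_spanningSets ν n) n
    have hBf : ∀ n, ν (B n) < ∞ := fun n =>
      (measure_mono (disjointed_subset _ n)).trans_lt (measure_spanningSets_lt_top ν n)
    have hU : ∀ (μ : Measure E) (ω : Ω), μ (Prod.mk (Y ω) ⁻¹' T) =
        ∑' n, μ (B n ∩ Prod.mk (Y ω) ⁻¹' T) := by
      intro μ ω
      have : Prod.mk (Y ω) ⁻¹' T = ⋃ n, B n ∩ Prod.mk (Y ω) ⁻¹' T := by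
        rw [← iUnion_inter, hBdef, iUnion_disjointed, iUnion_spanningSets, univ_inter]
      conv_lhs => rw [this]
      rw [measure_iUnion]
      · intro i j hij
        exact (disjoint_disjointed _ hij).mono inter_subset_left inter_subset_left
      · exact fun n => (hBm n).inter (hsec _ ω hT)
    simp_rw [hU]
    refine ⟨AEMeasurable.tsum fun n => (hfin _ (hBm n) (hBf n) T hT).1, ?_⟩
    rw [lintegral_tsum fun n => (hfin _ (hBm n) (hBf n) T hT).1, lintegral_tsum fun n => ?_]
    · exact tsum_congr fun n => (hfin _ (hBm n) (hBf n) T hT).2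
    · exact (hνm _ ((measurable_snd (hBm n)).inter hT)).aemeasurable
  have hνf : ∀ {f : S × E → ℝ≥0∞}, Measurable f → Measurable fun ω => ∫⁻ e, f (Y ω, e) ∂ν :=
    fun hf => hf.lintegral_prod_right'.comp hY
  have hsecf : ∀ {f : S × E → ℝ≥0∞}, Measurable f → ∀ ω, Measurable fun e => f (Y ω, e) :=
    fun hf ω => hf.comp measurable_prodMk_left
  refine Measurable.ennreal_induction (motive := fun h : S × E → ℝ≥0∞ =>
    AEMeasurable (fun ω => ∫⁻ e, h (Y ω, e) ∂κ ω) P ∧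
      ∫⁻ ω, ∫⁻ e, h (Y ω, e) ∂κ ω ∂P = ∫⁻ ω, ∫⁻ e, h (Y ω, e) ∂ν ∂P) ?_ ?_ ?_ hh
  · intro c T hT
    have h1 : ∀ (μ : Measure E) (ω : Ω), ∫⁻ e, T.indicator (fun _ => c) (Y ω, e) ∂μ =
        c * μ (Prod.mk (Y ω) ⁻¹' T) := by
      intro μ ω
      have : (fun e => T.indicator (fun _ => c) (Y ω, e)) =
        (Prod.mk (Y ω) ⁻¹' T).indicator fun _ => c := rfl
      rw [this, lintegral_indicator_const (hsec T ω hT)]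
    simp_rw [h1]
    refine ⟨(hset T hT).1.const_mul c, ?_⟩
    rw [lintegral_const_mul'' _ (hset T hT).1, lintegral_const_mul _ (hνm T hT), (hset T hT).2]
  · intro f g _ hf hg ihf ihg
    have h1 : ∀ (μ : Measure E) (ω : Ω), ∫⁻ e, (f + g) (Y ω, e) ∂μ =
        ∫⁻ e, f (Y ω, e) ∂μ + ∫⁻ e, g (Y ω, e) ∂μ := fun μ ω =>
      lintegral_add_left (hsecf hf ω) _
    simp_rw [h1]
    refine ⟨ihf.1.add ihg.1, ?_⟩
    rw [lintegral_add_left' ihf.1, lintegral_add_left (hνf hf), ihf.2,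
      ihg.2]
  · intro f hf hmono ih
    have h1 : ∀ (μ : Measure E) (ω : Ω), ∫⁻ e, (⨆ n, f n (Y ω, e)) ∂μ =
        ⨆ n, ∫⁻ e, f n (Y ω, e) ∂μ := fun μ ω =>
      lintegral_iSup (fun n => hsecf (hf n) ω) fun i j hij e => hmono hij _
    simp_rw [h1]
    refine ⟨AEMeasurable.iSup fun n => (ih n).1, ?_⟩
    rw [lintegral_iSup' (fun n => (ih n).1) (Eventually.of_forall fun ω i j hij =>
        lintegral_mono fun e => hmono hij _),
      lintegral_iSup (fun n => hνf (hf n)) fun i j hij ω =>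
        lintegral_mono fun e => hmono hij _]
    exact iSup_congr fun n => (ih n).2

/-- The compensation formula on the time interval `(r, r']`, for an integrand which depends on the
mark and on a random variable `Y` independent of the masses of the sets of later events. -/
lemma IsPoissonMeasure.lintegral_lintegral {N : Ω → Measure (ℝ≥0 × E)} {μ : Measure E}
    [SigmaFinite μ] (hN : IsPoissonMeasure P N (lebesgueNN.prod μ)) (r r' : ℝ≥0) {Y : Ω → S}
    (hY : Measurable Y)
    (hind : ∀ C, MeasurableSet C → C ⊆ Ioi r ×ˢ univ → IndepFun Y (fun ω => N ω C) P)
    {h : S × E → ℝ≥0∞} (hh : Measurable h) :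
    AEMeasurable (fun ω => ∫⁻ e in Ioc r r' ×ˢ univ, h (Y ω, e.2) ∂N ω) P ∧
      ∫⁻ ω, ∫⁻ e in Ioc r r' ×ˢ univ, h (Y ω, e.2) ∂N ω ∂P =
        ENNReal.ofReal (r' - r) * ∫⁻ ω, ∫⁻ e, h (Y ω, e) ∂μ ∂P := by
  set κ : Ω → Measure E := fun ω => ((N ω).restrict (Ioc r r' ×ˢ univ)).map Prod.snd with hκ
  have hκB : ∀ B, MeasurableSet B → ∀ ω, κ ω B = N ω (Ioc r r' ×ˢ B) := by
    intro B hB ω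
    rw [hκ, Measure.map_apply measurable_snd hB, Measure.restrict_apply (measurable_snd hB)]
    congr 1
    ext e; simp [and_comm]
  have hνB : ∀ B : Set E, (ENNReal.ofReal (r' - r) • μ) B = lebesgueNN.prod μ (Ioc r r' ×ˢ B) := by
    intro B
    rw [Measure.prod_prod, lebesgueNN_Ioc]
    rfl
  have : SigmaFinite (ENNReal.ofReal (r' - r) • μ) := by
    rw [ENNReal.ofReal]
    exact SMul.sigmaFinite (μ := μ) (Real.toNNReal (r' - r))
  have key := lintegral_lintegral_of_indepFun (P := P) (κ := κ) (ν := ENNReal.ofReal (r' - r) • μ)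
    hY (fun B hB => by
      simp_rw [hκB B hB]
      exact hN.measurable_apply (measurableSet_Ioc.prod hB))
    (fun B hB hBν => by
      simp_rw [hκB B hB]
      rw [hνB] at hBν ⊢
      exact hN.lintegral_apply (measurableSet_Ioc.prod hB) hBν)
    (fun B hB _ => by
      simp_rw [hκB B hB]
      exact hind _ (measurableSet_Ioc.prod hB) (prod_mono (fun s hs => hs.1) (subset_univ _)))
    hh
  have hκi : ∀ ω, ∫⁻ e, h (Y ω, e) ∂κ ω = ∫⁻ e in Ioc r r' ×ˢ univ, h (Y ω, e.2) ∂N ω := fun ω =>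
    lintegral_map (hh.comp measurable_prodMk_left) measurable_snd
  simp_rw [hκi, lintegral_smul_measure, smul_eq_mul] at key
  have hm : Measurable fun ω => ∫⁻ e, h (Y ω, e) ∂μ := hh.lintegral_prod_right'.comp hY
  rw [lintegral_const_mul _ hm] at key
  exact key

end Compensation

/-! ### Isolation of the events by a dyadic grid -/

section Grid

variable {Ω E₁ E₂ : Type*} [MeasurableSpace Ω] [MeasurableSpace E₁] [MeasurableSpace E₂]

/-- The `k`-th point of the subdivision of `[0, t]` into `2 ^ j` intervals of equal length. -/
noncomputable def gridPoint (t : ℝ≥0) (j k : ℕ) : ℝ≥0 := t * k / 2 ^ j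

lemma gridPoint_zero (t : ℝ≥0) (j : ℕ) : gridPoint t j 0 = 0 := by simp [gridPoint]

lemma gridPoint_last (t : ℝ≥0) (j : ℕ) : gridPoint t j (2 ^ j) = t := by
  simp [gridPoint]

lemma gridPoint_mono (t : ℝ≥0) (j : ℕ) : Monotone (gridPoint t j) := fun k l h => by
  unfold gridPoint
  gcongr

lemma gridPoint_lt_succ {t : ℝ≥0} (ht : 0 < t) (j k : ℕ) :
    gridPoint t j k < gridPoint t j (k + 1) := by
  unfold gridPoint
  gcongr
  exact_mod_cast Nat.lt_succ_self k

lemma gridPoint_two_mul (t : ℝ≥0) (j k : ℕ) : gridPoint t (j + 1) (2 * k) = gridPoint t j k := by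
  unfold gridPoint
  push_cast
  field_simp
  ring

lemma gridPoint_succ_sub (t : ℝ≥0) (j k : ℕ) :
    ENNReal.ofReal ((gridPoint t j (k + 1) : ℝ) - gridPoint t j k) = t * (2 ^ j)⁻¹ := by
  have h : (gridPoint t j (k + 1) : ℝ) - gridPoint t j k = ((t * (2 ^ j)⁻¹ : ℝ≥0) : ℝ) := by
    unfold gridPoint
    push_cast
    field_simp
    ring
  rw [h, ENNReal.ofReal_coe_nnreal, ENNReal.coe_mul, ENNReal.coe_inv (by positivity)]
  simp

/-- At most one event of `N₁` or `N₂` has its time in `(r, r']` and its mark in `B₁` or `B₂`,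
respectively. -/
def AtMostOneEvent (N₁ : Measure (ℝ≥0 × E₁)) (N₂ : Measure (ℝ≥0 × E₂)) (B₁ : Set E₁) (B₂ : Set E₂)
    (r r' : ℝ≥0) : Prop :=
  N₁ (Ioc r r' ×ˢ B₁) < 2 ∧ N₂ (Ioc r r' ×ˢ B₂) < 2 ∧
    (N₁ (Ioc r r' ×ˢ B₁) < 1 ∨ N₂ (Ioc r r' ×ˢ B₂) < 1)

lemma AtMostOneEvent.mono {N₁ : Measure (ℝ≥0 × E₁)} {N₂ : Measure (ℝ≥0 × E₂)} {B₁ : Set E₁}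
    {B₂ : Set E₂} {r r' s s' : ℝ≥0} (h : AtMostOneEvent N₁ N₂ B₁ B₂ r r') (hr : r ≤ s)
    (hr' : s' ≤ r') : AtMostOneEvent N₁ N₂ B₁ B₂ s s' := by
  have h1 : N₁ (Ioc s s' ×ˢ B₁) ≤ N₁ (Ioc r r' ×ˢ B₁) :=
    measure_mono (prod_mono (Ioc_subset_Ioc hr hr') le_rfl)
  have h2 : N₂ (Ioc s s' ×ˢ B₂) ≤ N₂ (Ioc r r' ×ˢ B₂) :=
    measure_mono (prod_mono (Ioc_subset_Ioc hr hr') le_rfl)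
  exact ⟨h1.trans_lt h.1, h2.trans_lt h.2.1, h.2.2.imp h1.trans_lt h2.trans_lt⟩

/-- For independent Poisson measures, almost surely, any sufficiently fine dyadic grid isolates the
events with marks in given sets of finite measure. A cell of length `h` contains two events with
probability `O(h ^ 2)`. -/
lemma ae_eventually_atMostOneEvent {P : Measure Ω} [IsProbabilityMeasure P]
    {N₁ : Ω → Measure (ℝ≥0 × E₁)} {N₂ : Ω → Measure (ℝ≥0 × E₂)} {μ₁ : Measure E₁} {μ₂ : Measure E₂}
    [SFinite μ₁] [SFinite μ₂]
    (h₁ : IsPoissonMeasure P N₁ (lebesgueNN.prod μ₁))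
    (h₂ : IsPoissonMeasure P N₂ (lebesgueNN.prod μ₂))
    (hind : IndepFun N₁ N₂ P) {B₁ : Set E₁} {B₂ : Set E₂} (hB₁ : MeasurableSet B₁)
    (hB₂ : MeasurableSet B₂) (hf₁ : μ₁ B₁ < ∞) (hf₂ : μ₂ B₂ < ∞) (t : ℝ≥0) :
    ∀ᵐ ω ∂P, ∃ j₀, ∀ j ≥ j₀, ∀ k < 2 ^ j,
      AtMostOneEvent (N₁ ω) (N₂ ω) B₁ B₂ (gridPoint t j k) (gridPoint t j (k + 1)) := by
  set bad : ℕ → Set Ω := fun j => {ω | ∃ k < 2 ^ j,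
    ¬ AtMostOneEvent (N₁ ω) (N₂ ω) B₁ B₂ (gridPoint t j k) (gridPoint t j (k + 1))} with hbad
  have hanti : Antitone bad := by
    refine antitone_nat_of_succ_le fun j ω => ?_
    rintro ⟨k, hk, hω⟩
    refine ⟨k / 2, by rw [pow_succ] at hk; omega, fun h => hω (h.mono ?_ ?_)⟩
    · rw [← gridPoint_two_mul t j (k / 2)]
      exact gridPoint_mono _ _ (by omega)
    · rw [← gridPoint_two_mul t j (k / 2 + 1)]
      exact gridPoint_mono _ _ (by omega)
  set m : ℝ≥0∞ := t * (μ₁ B₁ + μ₂ B₂) with hm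
  have hm' : m ≠ ∞ := ENNReal.mul_ne_top ENNReal.coe_ne_top (ENNReal.add_ne_top.2 ⟨hf₁.ne, hf₂.ne⟩)
  have hcell : ∀ j k, P {ω | ¬ AtMostOneEvent (N₁ ω) (N₂ ω) B₁ B₂ (gridPoint t j k)
      (gridPoint t j (k + 1))} ≤ 3 * (m * (2 ^ j)⁻¹) ^ 2 := by
    intro j k
    set C₁ := Ioc (gridPoint t j k) (gridPoint t j (k + 1)) ×ˢ B₁ with hC₁
    set C₂ := Ioc (gridPoint t j k) (gridPoint t j (k + 1)) ×ˢ B₂ with hC₂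
    have hC₁m : MeasurableSet C₁ := measurableSet_Ioc.prod hB₁
    have hC₂m : MeasurableSet C₂ := measurableSet_Ioc.prod hB₂
    have e₁ : (lebesgueNN.prod μ₁) C₁ ≤ m * (2 ^ j)⁻¹ := by
      rw [hC₁, Measure.prod_prod, lebesgueNN_Ioc, gridPoint_succ_sub, hm, mul_right_comm]
      gcongr
      exact le_self_add
    have e₂ : (lebesgueNN.prod μ₂) C₂ ≤ m * (2 ^ j)⁻¹ := by
      rw [hC₂, Measure.prod_prod, lebesgueNN_Ioc, gridPoint_succ_sub, hm, mul_right_comm]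
      gcongr
      exact le_add_self
    have htop : m * (2 ^ j)⁻¹ < ∞ := ENNReal.mul_lt_top hm'.lt_top
      (ENNReal.inv_lt_top.2 (by positivity))
    have hsub : {ω | ¬ AtMostOneEvent (N₁ ω) (N₂ ω) B₁ B₂ (gridPoint t j k)
        (gridPoint t j (k + 1))} ⊆ ({ω | 2 ≤ N₁ ω C₁} ∪ {ω | 2 ≤ N₂ ω C₂}) ∪
          ({ω | 1 ≤ N₁ ω C₁} ∩ {ω | 1 ≤ N₂ ω C₂}) := by
      intro ω hω
      simp only [AtMostOneEvent, mem_ofPred_eq, not_and_or, not_or, not_lt] at hω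
      rcases hω with h | h | h
      · exact Or.inl (Or.inl h)
      · exact Or.inl (Or.inr h)
      · exact Or.inr h
    have hboth : P ({ω | 1 ≤ N₁ ω C₁} ∩ {ω | 1 ≤ N₂ ω C₂}) ≤ (m * (2 ^ j)⁻¹) ^ 2 := by
      have hi := hind.measure_inter_preimage_eq_mul {μ | 1 ≤ μ C₁} {μ | 1 ≤ μ C₂}
        (measurableSet_le measurable_const (Measure.measurable_coe hC₁m))
        (measurableSet_le measurable_const (Measure.measurable_coe hC₂m))
      have hi' : P ({ω | 1 ≤ N₁ ω C₁} ∩ {ω | 1 ≤ N₂ ω C₂}) =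
        P {ω | 1 ≤ N₁ ω C₁} * P {ω | 1 ≤ N₂ ω C₂} := hi
      rw [hi', sq]
      exact mul_le_mul' ((h₁.measure_one_le hC₁m (e₁.trans_lt htop)).trans e₁)
        ((h₂.measure_one_le hC₂m (e₂.trans_lt htop)).trans e₂)
    calc _ ≤ P _ := measure_mono hsub
      _ ≤ (P {ω | 2 ≤ N₁ ω C₁} + P {ω | 2 ≤ N₂ ω C₂}) +
          P ({ω | 1 ≤ N₁ ω C₁} ∩ {ω | 1 ≤ N₂ ω C₂}) :=
        (measure_union_le _ _).trans (add_le_add (measure_union_le _ _) le_rfl)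
      _ ≤ ((m * (2 ^ j)⁻¹) ^ 2 + (m * (2 ^ j)⁻¹) ^ 2) + (m * (2 ^ j)⁻¹) ^ 2 := by
        refine add_le_add (add_le_add ?_ ?_) hboth
        · exact (h₁.measure_two_le hC₁m (e₁.trans_lt htop)).trans (pow_le_pow_left' e₁ 2)
        · exact (h₂.measure_two_le hC₂m (e₂.trans_lt htop)).trans (pow_le_pow_left' e₂ 2)
      _ = _ := by ring
  have hbadm : ∀ j, P (bad j) ≤ 3 * m ^ 2 * (2⁻¹) ^ j := by
    intro j
    have hU : bad j = ⋃ k ∈ Finset.range (2 ^ j), {ω | ¬ AtMostOneEvent (N₁ ω) (N₂ ω) B₁ B₂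
        (gridPoint t j k) (gridPoint t j (k + 1))} := by
      ext ω; simp [hbad]
    rw [hU]
    refine (measure_biUnion_finset_le _ _).trans ((Finset.sum_le_sum fun k _ => hcell j k).trans ?_)
    rw [Finset.sum_const, Finset.card_range, nsmul_eq_mul, ENNReal.inv_pow, mul_pow]
    have h2 : (2 ^ j : ℝ≥0∞) * (2⁻¹) ^ j = 1 := by
      rw [← mul_pow, ENNReal.mul_inv_cancel two_ne_zero ENNReal.ofNat_ne_top, one_pow]
    push_cast
    calc (2 : ℝ≥0∞) ^ j * (3 * (m ^ 2 * ((2⁻¹) ^ j) ^ 2))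
        = (2 ^ j * (2⁻¹) ^ j) * (3 * m ^ 2 * (2⁻¹) ^ j) := by ring
      _ ≤ _ := by rw [h2, one_mul]
  have hlim : Tendsto (fun j : ℕ => 3 * m ^ 2 * (2⁻¹ : ℝ≥0∞) ^ j) atTop (𝓝 0) := by
    have h2 : Tendsto (fun j : ℕ => (2⁻¹ : ℝ≥0∞) ^ j) atTop (𝓝 0) :=
      ENNReal.tendsto_pow_atTop_nhds_zero_of_lt_one (by norm_num)
    have := ENNReal.Tendsto.const_mul (a := 3 * m ^ 2) h2
      (Or.inr (ENNReal.mul_ne_top (by simp) (ENNReal.pow_ne_top hm')))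
    simpa using this
  have hzero : P (⋂ j, bad j) = 0 := by
    refine le_antisymm (ge_of_tendsto' hlim fun j => ?_) zero_le
    exact (measure_mono (iInter_subset _ j)).trans (hbadm j)
  have hae : ∀ᵐ ω ∂P, ω ∉ ⋂ j, bad j := measure_eq_zero_iff_ae_notMem.1 hzero
  filter_upwards [hae] with ω hω
  obtain ⟨j₀, hj₀⟩ := not_forall.1 (fun h => hω (mem_iInter.2 h))
  refine ⟨j₀, fun j hj k hk => ?_⟩
  by_contra hc
  exact hj₀ (hanti hj ⟨k, hk, hc⟩)

end Grid

lemma restrict_eq_zero_or_dirac {E : Type*} [MeasurableSpace E] {N : Measure E}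
    (h : ∃ (s : Set ℕ) (x : s → E), N = Measure.sum fun n => Measure.dirac (x n)) {C : Set E}
    (hC : MeasurableSet C) (hN : N C < 2) :
    N.restrict C = 0 ∨ ∃ e ∈ C, N.restrict C = Measure.dirac e := by
  classical
  obtain ⟨s, x, rfl⟩ := h
  have hap : ∀ A, MeasurableSet A → (Measure.sum fun n => Measure.dirac (x n)) A =
      ∑' n, A.indicator (1 : E → ℝ≥0∞) (x n) := fun A hA => by
    rw [Measure.sum_apply _ hA]
    exact tsum_congr fun n => Measure.dirac_apply' _ hA
  by_cases hT : ∃ n, x n ∈ C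
  · obtain ⟨n, hn⟩ := hT
    have huniq : ∀ n', n' ≠ n → x n' ∉ C := by
      intro n' hne hn'
      rw [hap C hC] at hN
      have h2 := ENNReal.sum_le_tsum (f := fun n => C.indicator (1 : E → ℝ≥0∞) (x n)) {n', n}
      rw [Finset.sum_pair hne] at h2
      simp only [hn', hn, indicator_of_mem, Pi.one_apply, one_add_one_eq_two] at h2
      exact absurd (h2.trans_lt hN) (lt_irrefl _)
    refine Or.inr ⟨x n, hn, Measure.ext fun A hA => ?_⟩
    rw [Measure.restrict_apply hA, hap _ (hA.inter hC), tsum_eq_single n, Measure.dirac_apply' _ hA]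
    · by_cases hA' : x n ∈ A <;> simp [hA', hn]
    · intro n' hne
      exact indicator_of_notMem (fun h => huniq n' hne h.2) _
  · refine Or.inl (Measure.restrict_eq_zero.2 ?_)
    rw [hap C hC]
    push Not at hT
    simp [hT]

/-! ### Regularity of the paths -/

lemma tendsto_of_tendsto_delta {p : ℝ} (hp : 0 < p) {α : Type*} {l : Filter α} {x : α → ℕ → ℝ≥0}
    {y : ℕ → ℝ≥0} (h : Tendsto (fun s => delta p (x s) y) l (𝓝 0)) : Tendsto x l (𝓝 y) := by
  refine tendsto_pi_nhds.2 fun k => ?_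
  have h1 : Tendsto (fun s => ENNReal.ofReal |(x s k : ℝ) ^ p - (y k : ℝ) ^ p|) l (𝓝 0) :=
    tendsto_of_tendsto_of_tendsto_of_le_of_le tendsto_const_nhds h (fun _ => zero_le)
      fun s => ENNReal.le_tsum (f := fun k => ENNReal.ofReal |(x s k : ℝ) ^ p - (y k : ℝ) ^ p|) k
  have h2 : Tendsto (fun s => |(x s k : ℝ) ^ p - (y k : ℝ) ^ p|) l (𝓝 0) := by
    have := (ENNReal.tendsto_toReal ENNReal.zero_ne_top).comp h1
    simpa [Function.comp_def, ENNReal.toReal_ofReal] using this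
  have h3 : Tendsto (fun s => (x s k : ℝ) ^ p) l (𝓝 ((y k : ℝ) ^ p)) :=
    tendsto_iff_dist_tendsto_zero.2 h2
  have h4 := h3.rpow_const (p := p⁻¹) (Or.inr (inv_nonneg.2 hp.le))
  simp_rw [Real.rpow_rpow_inv (NNReal.coe_nonneg _) hp.ne'] at h4
  exact_mod_cast h4

namespace IsCadlag

variable {p : ℝ} {x : ℝ≥0 → ℕ → ℝ≥0}

lemma antitone (h : IsCadlag p x) (t : ℝ≥0) : Antitone (x t) := (h.mem_ell t).1

lemma tendsto_right (hp : 0 < p) (h : IsCadlag p x) (t : ℝ≥0) : Tendsto x (𝓝[>] t) (𝓝 (x t)) :=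
  tendsto_of_tendsto_delta hp (h.right_cont t)

lemma tendsto_left (hp : 0 < p) (h : IsCadlag p x) {t : ℝ≥0} (ht : 0 < t) :
    Tendsto x (𝓝[<] t) (𝓝 (Function.leftLim x t)) := by
  obtain ⟨l, -, hl⟩ := h.left_lim t
  have : (𝓝[<] t).NeBot := nhdsLT_neBot_of_exists_lt ⟨0, ht⟩
  have hl' := tendsto_of_tendsto_delta hp hl
  rwa [leftLim_eq_of_tendsto hl']

lemma leftLim_mem_of_isClosed (hp : 0 < p) (h : IsCadlag p x) {t : ℝ≥0} (ht : 0 < t)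
    {C : Set (ℕ → ℝ≥0)} (hC : IsClosed C) (hx : ∀ s < t, x s ∈ C) : Function.leftLim x t ∈ C := by
  have : (𝓝[<] t).NeBot := nhdsLT_neBot_of_exists_lt ⟨0, ht⟩
  exact hC.mem_of_tendsto (h.tendsto_left hp ht)
    (eventually_nhdsWithin_of_forall fun s hs => hx s hs)

lemma antitone_leftLim (hp : 0 < p) (h : IsCadlag p x) {t : ℝ≥0} (ht : 0 < t) :
    Antitone (Function.leftLim x t) := by
  intro k l hkl
  exact h.leftLim_mem_of_isClosed hp ht (C := {y | y l ≤ y k})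
    (isClosed_le (continuous_apply l) (continuous_apply k)) fun s _ => h.antitone s hkl

/-- The largest mass is bounded on bounded time intervals. -/
lemma exists_bound (hp : 0 < p) (h : IsCadlag p x) (T : ℝ≥0) : ∃ A : ℝ≥0, ∀ s ≤ T, x s 0 ≤ A := by
  have hK : IsCompact (Icc 0 T) := isCompact_Icc
  have := hK.induction_on (p := fun S => ∃ A : ℝ≥0, ∀ s ∈ S, x s 0 ≤ A) ⟨0, by simp⟩
    (fun S S' hS ⟨A, hA⟩ => ⟨A, fun s hs => hA s (hS hs)⟩)
    (fun S S' ⟨A, hA⟩ ⟨A', hA'⟩ => ⟨max A A', fun s hs => hs.elim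
      (fun h => (hA s h).trans (le_max_left _ _)) (fun h => (hA' s h).trans (le_max_right _ _))⟩)
    (fun t _ => by
      obtain ⟨l, -, hl⟩ := h.left_lim t
      have h1 := ((tendsto_pi_nhds.1 (tendsto_of_tendsto_delta hp hl) 0).eventually_le_const
        (lt_add_of_pos_right (l 0) one_pos))
      have h2 := ((tendsto_pi_nhds.1 (h.tendsto_right hp t) 0).eventually_le_const
        (lt_add_of_pos_right (x t 0) one_pos))
      have h3 : ∀ᶠ s in 𝓝 t, x s 0 ≤ max (l 0 + 1) (x t 0 + 1) := by
        rw [← nhdsNE_sup_pure, ← nhdsLT_sup_nhdsGT]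
        exact eventually_sup.2 ⟨eventually_sup.2 ⟨h1.mono fun s hs => hs.trans (le_max_left _ _),
          h2.mono fun s hs => hs.trans (le_max_right _ _)⟩,
          eventually_pure.2 (le_trans le_self_add (le_max_right _ _))⟩
      exact ⟨_, mem_nhdsWithin_of_mem_nhds h3, _, fun s hs => hs⟩)
  obtain ⟨A, hA⟩ := this
  exact ⟨A, fun s hs => hA s ⟨zero_le, hs⟩⟩

end IsCadlag

lemma IsCoagulationKernel.exists_bound {p : ℝ} (hp : 0 < p) {K : ℝ≥0 → ℝ≥0 → ℝ≥0}
    (hK : IsCoagulationKernel p K) (a : ℝ≥0) : ∃ b : ℝ≥0, ∀ x ≤ a, ∀ y ≤ a, K x y ≤ b := by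
  rcases eq_or_ne a 0 with rfl | ha
  · refine ⟨0, fun x _ y hy => ?_⟩
    rw [nonpos_iff_eq_zero.1 hy, hK.zero_right]
  have ha' : a ∈ Ioc 0 a := ⟨pos_iff_ne_zero.2 ha, le_rfl⟩
  obtain ⟨κ, hκ0, hκ⟩ := hK.holder a ha'.1
  refine ⟨K a a + (κ * (2 * (a : ℝ) ^ p)).toNNReal, fun x hx y hy => ?_⟩
  rcases eq_or_ne y 0 with rfl | hy0
  · rw [hK.zero_right]; exact zero_le
  rcases eq_or_ne x 0 with rfl | hx0
  · rw [hK.symm, hK.zero_right]; exact zero_le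
  have h1 := hκ x ⟨pos_iff_ne_zero.2 hx0, hx⟩ y ⟨pos_iff_ne_zero.2 hy0, hy⟩ a ha' a ha'
  have h2 : ∀ z ≤ a, |(z : ℝ) ^ p - (a : ℝ) ^ p| ≤ (a : ℝ) ^ p := fun z hz => by
    have hz1 : (z : ℝ) ^ p ≤ (a : ℝ) ^ p := Real.rpow_le_rpow z.2 (by exact_mod_cast hz) hp.le
    have hz2 : (0 : ℝ) ≤ (z : ℝ) ^ p := by positivity
    rw [abs_sub_comm, abs_of_nonneg (by linarith)]
    linarith
  rw [← NNReal.coe_le_coe, NNReal.coe_add, Real.coe_toNNReal _ (by positivity)]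
  have h3 := (le_abs_self _).trans h1
  have h4 := mul_le_mul_of_nonneg_left (add_le_add (h2 x hx) (h2 y hy)) hκ0.le
  linarith

lemma IsFragmentationKernel.exists_bound {q : ℝ} (hq : 0 ≤ q) {F : ℝ≥0 → ℝ≥0}
    (hF : IsFragmentationKernel q F) (a : ℝ≥0) : ∃ b : ℝ≥0, ∀ x ≤ a, F x ≤ b := by
  rcases eq_or_ne a 0 with rfl | ha
  · refine ⟨0, fun x hx => ?_⟩
    rw [nonpos_iff_eq_zero.1 hx, hF.zero]
  have ha' : a ∈ Ioc 0 a := ⟨pos_iff_ne_zero.2 ha, le_rfl⟩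
  obtain ⟨μ, hμ0, hμ⟩ := hF.holder a ha'.1
  refine ⟨F a + (μ * (a : ℝ) ^ q).toNNReal, fun x hx => ?_⟩
  rcases eq_or_ne x 0 with rfl | hx0
  · rw [hF.zero]; exact zero_le
  have h1 := hμ x ⟨pos_iff_ne_zero.2 hx0, hx⟩ a ha'
  have h2 : |(x : ℝ) ^ q - (a : ℝ) ^ q| ≤ (a : ℝ) ^ q := by
    have hz1 : (x : ℝ) ^ q ≤ (a : ℝ) ^ q := Real.rpow_le_rpow x.2 (by exact_mod_cast hx) hq
    have hz2 : (0 : ℝ) ≤ (x : ℝ) ^ q := by positivity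
    rw [abs_sub_comm, abs_of_nonneg (by linarith)]
    linarith
  rw [← NNReal.coe_le_coe, NNReal.coe_add, Real.coe_toNNReal _ (by positivity)]
  have h3 := (le_abs_self _).trans h1
  have h4 := mul_le_mul_of_nonneg_left h2 hμ0.le
  linarith

/-- The marks `((i, j), z)` of coalescences of two of the particles `0, …, l - 1`, with `z ≤ l`. -/
def coagRegion (l : ℕ) : Set CoagMark := {e | e.1.1.2 < l ∧ e.2 ≤ l}

/-- The marks `(i, θ, z)` of fragmentations of one of the particles `0, …, l - 1`, with `z ≤ l`. -/
def fragRegion (l : ℕ) : Set FragMark := {e | e.1 < l ∧ e.2.2 ≤ l}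

lemma coagRegion_eq (l : ℕ) :
    coagRegion l = {q : Pairs | q.1.2 < l} ×ˢ Iic (l : ℝ≥0) := by
  ext e; simp [coagRegion]

lemma fragRegion_eq (l : ℕ) :
    fragRegion l = {i : ℕ | i < l} ×ˢ ((univ : Set Ratios) ×ˢ Iic (l : ℝ≥0)) := by
  ext e; simp [fragRegion]

lemma measurableSet_coagRegion (l : ℕ) : MeasurableSet (coagRegion l) := by
  rw [coagRegion_eq]
  exact MeasurableSet.prod (MeasurableSet.of_discrete) measurableSet_Iic

lemma measurableSet_fragRegion (l : ℕ) : MeasurableSet (fragRegion l) := by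
  rw [fragRegion_eq]
  exact MeasurableSet.prod (MeasurableSet.of_discrete)
    (MeasurableSet.univ.prod measurableSet_Iic)

lemma coagMarkIntensity_coagRegion_lt_top (l : ℕ) : coagMarkIntensity (coagRegion l) < ∞ := by
  rw [coagRegion_eq, coagMarkIntensity, Measure.prod_prod, lebesgueNN_Iic]
  refine ENNReal.mul_lt_top ?_ ENNReal.coe_lt_top
  refine Measure.count_apply_lt_top.2 ?_
  refine Set.Finite.of_finite_image (f := Subtype.val) ?_ Subtype.val_injective.injOn
  refine ((finite_Iio l).prod (finite_Iio l)).subset ?_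
  rintro _ ⟨q, hq, rfl⟩
  have h : q.1.2 < l := hq
  exact ⟨q.2.trans h, h⟩

lemma fragMarkIntensity_fragRegion_lt_top (β : Measure Ratios) [IsFiniteMeasure β] (l : ℕ) :
    fragMarkIntensity β (fragRegion l) < ∞ := by
  rw [fragRegion_eq, fragMarkIntensity, Measure.prod_prod, Measure.prod_prod, lebesgueNN_Iic]
  refine ENNReal.mul_lt_top ?_ (ENNReal.mul_lt_top (measure_lt_top _ _) ENNReal.coe_lt_top)
  exact Measure.count_apply_lt_top.2 (finite_Iio l)

/-- On a bounded time interval, where the masses and the number of particles are bounded, all the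
events with marks outside of a large region leave the state unchanged. -/
lemma exists_region {p q : ℝ} (hp : 0 < p) (hq : 0 ≤ q) {K : ℝ≥0 → ℝ≥0 → ℝ≥0} {F : ℝ≥0 → ℝ≥0}
    (hK : IsCoagulationKernel p K) (hF : IsFragmentationKernel q F) {x : ℝ≥0 → ℕ → ℝ≥0}
    (hx : IsCadlag p x) {T : ℝ≥0} {n : ℕ} (hn : ∀ s ≤ T, {k | x s k ≠ 0}.encard ≤ n) :
    ∃ l₀, ∀ l ≥ l₀, ∀ s ∈ Ioc 0 T,
      (∀ e ∉ coagRegion l, coagStep K e (Function.leftLim x s) = Function.leftLim x s) ∧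
        ∀ e ∉ fragRegion l, fragStep F e (Function.leftLim x s) = Function.leftLim x s := by
  obtain ⟨A, hA⟩ := hx.exists_bound hp T
  obtain ⟨b, hb⟩ := hK.exists_bound hp A
  obtain ⟨b', hb'⟩ := hF.exists_bound hq A
  obtain ⟨N, hN⟩ := exists_nat_ge (max b b')
  have hxn : ∀ s ≤ T, x s n = 0 := by
    intro s hs
    by_contra h0
    have hsub : ((Finset.range (n + 1) : Finset ℕ) : Set ℕ) ⊆ {k | x s k ≠ 0} := fun k hk => by
      have hk' : k ≤ n := by simpa [Nat.lt_succ_iff] using hk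
      exact ((pos_iff_ne_zero.2 h0).trans_le (hx.antitone s hk')).ne'
    have h1 := (encard_le_encard hsub).trans (hn s hs)
    rw [encard_coe_eq_coe_finsetCard, Finset.card_range] at h1
    have : n + 1 ≤ n := by exact_mod_cast h1
    omega
  refine ⟨max n N, fun l hl s hs => ?_⟩
  have hanti := hx.antitone_leftLim hp hs.1
  have h0 : Function.leftLim x s n = 0 :=
    hx.leftLim_mem_of_isClosed hp hs.1 (C := {y | y n = 0})
      (isClosed_eq (continuous_apply n) continuous_const) fun u hu => hxn u (hu.le.trans hs.2)
  have hAl : ∀ k, Function.leftLim x s k ≤ A := fun k =>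
    hx.leftLim_mem_of_isClosed hp hs.1 (C := {y | y k ≤ A})
      (isClosed_le (continuous_apply k) continuous_const)
      fun u hu => (hx.antitone u (Nat.zero_le k)).trans (hA u (hu.le.trans hs.2))
  have hl0 : ∀ k, l ≤ k → Function.leftLim x s k = 0 := fun k hk =>
    nonpos_iff_eq_zero.1 ((hanti ((le_max_left n N).trans (hl.trans hk))).trans h0.le)
  have hNl : (N : ℝ≥0) ≤ l := by exact_mod_cast (le_max_right n N).trans hl
  constructor
  · intro e he
    unfold coagStep
    split_ifs with hz
    · by_cases hj : e.1.1.2 < l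
      · refine absurd ⟨hj, hz.trans ?_⟩ he
        exact (hb _ (hAl _) _ (hAl _)).trans ((le_max_left b b').trans (hN.trans hNl))
      · exact coalesce_of_right_eq_zero hanti (hl0 _ (not_lt.1 hj))
    · rfl
  · intro e he
    unfold fragStep
    split_ifs with hz
    · by_cases hj : e.1 < l
      · refine absurd ⟨hj, hz.trans ?_⟩ he
        exact (hb' _ (hAl _)).trans ((le_max_right b b').trans (hN.trans hNl))
      · exact fragment_of_eq_zero hanti _ (hl0 _ (not_lt.1 hj))
    · rfl

/-! ### The paths between isolated events -/

/-- The restriction to the time interval `(0, t]` of a function of the time and the mark. -/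
noncomputable def timeCut {E : Type*} (G : ℝ≥0 × E → ℝ) (t : ℝ≥0) (e : ℝ≥0 × E) : ℝ :=
  open Classical in if e.1 ∈ Ioc 0 t then G e else 0

lemma coagIntegrand_eq_timeCut (K : ℝ≥0 → ℝ≥0 → ℝ≥0) (x : ℝ≥0 → ℕ → ℝ≥0) (t : ℝ≥0) (k : ℕ) :
    coagIntegrand K x t k = timeCut (fun e : ℝ≥0 × CoagMark =>
      (coagStep K e.2 (Function.leftLim x e.1) k : ℝ) - Function.leftLim x e.1 k) t := by
  funext ⟨s, q, z⟩
  simp only [coagIntegrand, timeCut, coagStep]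
  by_cases h1 : s ∈ Ioc 0 t <;>
    by_cases h2 : z ≤ K (Function.leftLim x s q.1.1) (Function.leftLim x s q.1.2) <;> simp [h1, h2]

lemma fragIntegrand_eq_timeCut (F : ℝ≥0 → ℝ≥0) (x : ℝ≥0 → ℕ → ℝ≥0) (t : ℝ≥0) (k : ℕ) :
    fragIntegrand F x t k = timeCut (fun e : ℝ≥0 × FragMark =>
      (fragStep F e.2 (Function.leftLim x e.1) k : ℝ) - Function.leftLim x e.1 k) t := by
  funext ⟨s, i, θ, z⟩
  simp only [fragIntegrand, timeCut, fragStep]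
  by_cases h1 : s ∈ Ioc 0 t <;>
    by_cases h2 : z ≤ F (Function.leftLim x s i) <;> simp [h1, h2]

lemma integral_timeCut_sub {E : Type*} [MeasurableSpace E] {μ : Measure (ℝ≥0 × E)}
    {G : ℝ≥0 × E → ℝ} {B : Set E} {r u r' : ℝ≥0} (hru : r ≤ u) (hur : u ≤ r')
    (hG : ∀ e, e.1 ∈ Ioc 0 r' → e.2 ∉ B → G e = 0) (hr : Integrable (timeCut G r) μ)
    (hu : Integrable (timeCut G u) μ) :
    ∫ e, timeCut G u e ∂μ = ∫ e, timeCut G r e ∂μ +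
      ∫ e in Ioc r r' ×ˢ B, (if e.1 ≤ u then G e else 0) ∂μ := by
  classical
  rw [← sub_eq_iff_eq_add', ← integral_sub hu hr]
  have h1 : ∀ e, timeCut G u e - timeCut G r e =
      (if r < e.1 ∧ e.1 ≤ u then G e else 0) := by
    intro e
    simp only [timeCut, mem_Ioc]
    by_cases ha : e.1 ≤ r
    · have hb : e.1 ≤ u := ha.trans hru
      simp [ha, hb, not_lt.2 ha]
    · have hc : 0 < e.1 := zero_le.trans_lt (not_le.1 ha)
      simp [ha, hc, not_le.1 ha]
  simp_rw [h1]
  rw [← setIntegral_eq_integral_of_forall_compl_eq_zero (s := Ioc r r' ×ˢ B)]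
  · refine integral_congr_ae ?_
    have hae : ∀ᵐ e ∂(μ.restrict (Ioc r r' ×ˢ B)), e ∈ {e : ℝ≥0 × E | r < e.1} := by
      have hm : MeasurableSet {e : ℝ≥0 × E | r < e.1} :=
        measurableSet_lt measurable_const measurable_fst
      refine (ae_restrict_iff (p := fun e : ℝ≥0 × E => r < e.1) hm).2
        (Eventually.of_forall fun e he => he.1.1)
    filter_upwards [hae] with e he
    simp [show r < e.1 from he]
  · intro e he
    split_ifs with h2
    · have h3 : e.1 ∈ Ioc r r' := ⟨h2.1, h2.2.trans hur⟩
      exact hG e ⟨zero_le.trans_lt h3.1, h3.2⟩ fun hB => he ⟨h3, hB⟩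
    · rfl

/-- If a càdlàg path is a step function with a single jump at the times of a dense set, then it is
one at all times, by right continuity. -/
lemma path_eq_of_jump {p : ℝ} (hp : 0 < p) {x : ℝ≥0 → ℕ → ℝ≥0} (hx : IsCadlag p x) {D : Set ℝ≥0}
    (hD : Dense D) {r s r' : ℝ≥0} (hs : s ∈ Ioc r r') (hr' : r' ∈ D) {J : ℕ → ℝ}
    (h : ∀ u ∈ D, r ≤ u → u ≤ r' → ∀ k, (x u k : ℝ) = x r k + if s ≤ u then J k else 0) :
    (∀ u ∈ Ico r s, x u = x r) ∧ ∀ u ∈ Icc s r', ∀ k, (x u k : ℝ) = x r k + J k := by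
  have key : ∀ u, r ≤ u → u ≤ r' → ∀ k, (x u k : ℝ) = x r k + if s ≤ u then J k else 0 := by
    intro u hru hur k
    rcases eq_or_lt_of_le hur with rfl | hur
    · exact h u hr' hru le_rfl k
    have hne : (𝓝[D ∩ Ioi u] u).NeBot := by
      rw [← mem_closure_iff_nhdsWithin_neBot, inter_comm]
      have h1 : closure (Ioi u) ⊆ closure (Ioi u ∩ D) :=
        closure_minimal (hD.open_subset_closure_inter isOpen_Ioi) isClosed_closure
      refine h1 ?_
      rw [closure_Ioi' ⟨r', hur⟩]
      exact self_mem_Ici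
    have hlim : Tendsto (fun v => (x v k : ℝ)) (𝓝[D ∩ Ioi u] u) (𝓝 (x u k)) := by
      have h1 := (tendsto_pi_nhds.1 (hx.tendsto_right hp u) k).mono_left
        (nhdsWithin_mono u (inter_subset_right : D ∩ Ioi u ⊆ Ioi u))
      exact_mod_cast h1
    have hlim' : Tendsto (fun v => (x v k : ℝ)) (𝓝[D ∩ Ioi u] u)
        (𝓝 (x r k + if s ≤ u then J k else 0)) := by
      refine tendsto_const_nhds.congr' ?_
      have hside : ∀ᶠ v in 𝓝[D ∩ Ioi u] u, (s ≤ u ↔ s ≤ v) := by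
        rcases le_or_gt s u with hsu | hsu
        · filter_upwards [self_mem_nhdsWithin] with v hv
          exact ⟨fun _ => hsu.trans (show u < v from hv.2).le, fun _ => hsu⟩
        · filter_upwards [nhdsWithin_le_nhds (eventually_lt_nhds hsu)] with v hv
          exact ⟨fun h => absurd h (not_le.2 hsu), fun h => absurd h (not_le.2 hv)⟩
      filter_upwards [self_mem_nhdsWithin, nhdsWithin_le_nhds (eventually_lt_nhds hur), hside]
        with v hv hvr hsv
      rw [h v hv.1 (hru.trans (show u < v from hv.2).le) hvr.le k]
      simp only [hsv]
    exact tendsto_nhds_unique hlim hlim'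
  refine ⟨fun u hu => ?_, fun u hu k => ?_⟩
  · funext k
    have h1 := key u hu.1 (hu.2.le.trans hs.2) k
    rw [if_neg (not_le.2 hu.2), add_zero] at h1
    exact_mod_cast h1
  · have h1 := key u (hs.1.le.trans hu.1) hu.2 k
    rwa [if_pos hu.1] at h1

lemma leftLim_eq_of_eqOn_Ico {x : ℝ≥0 → ℕ → ℝ≥0} {r s : ℝ≥0} (hrs : r < s)
    (h : ∀ u ∈ Ico r s, x u = x r) : Function.leftLim x s = x r := by
  have : (𝓝[<] s).NeBot := nhdsLT_neBot_of_exists_lt ⟨r, hrs⟩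
  refine leftLim_eq_of_tendsto (tendsto_const_nhds.congr' ?_)
  filter_upwards [Ico_mem_nhdsLT hrs] with u hu using (h u hu).symm

/-- The equation of a solution holds at time `u` for the path `x`. -/
def PathEquation (K : ℝ≥0 → ℝ≥0 → ℝ≥0) (F : ℝ≥0 → ℝ≥0) (m : ℕ → ℝ≥0) (x : ℝ≥0 → ℕ → ℝ≥0)
    (N : Measure CoagSpace) (M : Measure FragSpace) (u : ℝ≥0) : Prop :=
  ∀ k, Integrable (coagIntegrand K x u k) N ∧ Integrable (fragIntegrand F x u k) M ∧
    (x u k : ℝ) = m k + (∫ e, coagIntegrand K x u k e ∂N) + ∫ e, fragIntegrand F x u k e ∂M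

/-- The path `x` solves the equation at the times of a set `D`, and up to time `T` only events
with marks in the regions of size `l` affect it. -/
structure IsSolutionPath (p : ℝ) (K : ℝ≥0 → ℝ≥0 → ℝ≥0) (F : ℝ≥0 → ℝ≥0) (m : ℕ → ℝ≥0)
    (N : Measure CoagSpace) (M : Measure FragSpace) (D : Set ℝ≥0) (l : ℕ) (T : ℝ≥0)
    (x : ℝ≥0 → ℕ → ℝ≥0) : Prop where
  cadlag : IsCadlag p x
  equation : ∀ u ∈ D, PathEquation K F m x N M u
  coag_region : ∀ s ∈ Ioc 0 T, ∀ e ∉ coagRegion l,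
    coagStep K e (Function.leftLim x s) = Function.leftLim x s
  frag_region : ∀ s ∈ Ioc 0 T, ∀ e ∉ fragRegion l,
    fragStep F e (Function.leftLim x s) = Function.leftLim x s

namespace IsSolutionPath

variable {p : ℝ} {K : ℝ≥0 → ℝ≥0 → ℝ≥0} {F : ℝ≥0 → ℝ≥0} {m : ℕ → ℝ≥0} {x : ℝ≥0 → ℕ → ℝ≥0}
  {N : Measure CoagSpace} {M : Measure FragSpace} {D : Set ℝ≥0} {l : ℕ} {r r' T : ℝ≥0}

lemma eq_add (h : IsSolutionPath p K F m N M D l T x) {u : ℝ≥0} (hr : r ∈ D) (hu : u ∈ D)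
    (hru : r ≤ u) (hur : u ≤ r') (hT : r' ≤ T) (k : ℕ) :
    (x u k : ℝ) = x r k +
      (∫ e in Ioc r r' ×ˢ coagRegion l, (if e.1 ≤ u then
        (coagStep K e.2 (Function.leftLim x e.1) k : ℝ) - Function.leftLim x e.1 k else 0) ∂N) +
      ∫ e in Ioc r r' ×ˢ fragRegion l, (if e.1 ≤ u then
        (fragStep F e.2 (Function.leftLim x e.1) k : ℝ) - Function.leftLim x e.1 k else 0) ∂M := by
  obtain ⟨a1, a2, a3⟩ := h.equation r hr k
  obtain ⟨b1, b2, b3⟩ := h.equation u hu k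
  rw [coagIntegrand_eq_timeCut] at a1 a3 b1 b3
  rw [fragIntegrand_eq_timeCut] at a2 a3 b2 b3
  rw [b3, a3, integral_timeCut_sub hru hur (B := coagRegion l) ?_ a1 b1,
    integral_timeCut_sub hru hur (B := fragRegion l) ?_ a2 b2]
  · ring
  · intro e he he'
    simp [h.frag_region e.1 ⟨he.1, he.2.trans hT⟩ e.2 he']
  · intro e he he'
    simp [h.coag_region e.1 ⟨he.1, he.2.trans hT⟩ e.2 he']

/-- Between isolated events the path is constant. -/
lemma eq_of_no_event (h : IsSolutionPath p K F m N M D l T x) (hp : 0 < p) (hD : Dense D)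
    (hr : r ∈ D) (hr' : r' ∈ D) (hT : r' ≤ T) (hrr : r < r')
    (hN : N.restrict (Ioc r r' ×ˢ coagRegion l) = 0)
    (hM : M.restrict (Ioc r r' ×ˢ fragRegion l) = 0) : ∀ u ∈ Icc r r', x u = x r := by
  have hj := path_eq_of_jump hp h.cadlag hD (r := r) (s := r') (r' := r') ⟨hrr, le_rfl⟩ hr'
    (J := 0) ?_
  · intro u hu
    rcases eq_or_lt_of_le hu.2 with rfl | hur
    · funext k
      have := hj.2 u ⟨le_rfl, le_rfl⟩ k
      simp only [Pi.zero_apply, add_zero] at this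
      exact_mod_cast this
    · exact hj.1 u ⟨hu.1, hur⟩
  · intro u hu hru hur k
    rw [h.eq_add hr hu hru hur hT k, hN, hM]
    simp

/-- A single coalescence event of mark `e` at time `s` makes the path jump from `x r` to
`coagStep K e (x r)`, since `x r` is also its left limit at `s`. -/
lemma eq_of_coag_event (h : IsSolutionPath p K F m N M D l T x) (hp : 0 < p) (hD : Dense D)
    (hr : r ∈ D) (hr' : r' ∈ D) (hT : r' ≤ T) {s : ℝ≥0} {e : CoagMark} (hs : s ∈ Ioc r r')
    (hN : N.restrict (Ioc r r' ×ˢ coagRegion l) = Measure.dirac (s, e))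
    (hM : M.restrict (Ioc r r' ×ˢ fragRegion l) = 0) :
    (∀ u ∈ Ico r s, x u = x r) ∧ ∀ u ∈ Icc s r', x u = coagStep K e (x r) := by
  have hj := path_eq_of_jump hp h.cadlag hD hs hr'
    (J := fun k => (coagStep K e (Function.leftLim x s) k : ℝ) - Function.leftLim x s k) ?_
  · refine ⟨hj.1, fun u hu => ?_⟩
    have h2 := hj.2 u hu
    rw [leftLim_eq_of_eqOn_Ico hs.1 hj.1] at h2
    funext k
    have := h2 k
    rw [add_sub_cancel] at this
    exact_mod_cast this
  · intro u hu hru hur k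
    rw [h.eq_add hr hu hru hur hT k, hN, hM, integral_dirac]
    simp

lemma eq_of_frag_event (h : IsSolutionPath p K F m N M D l T x) (hp : 0 < p) (hD : Dense D)
    (hr : r ∈ D) (hr' : r' ∈ D) (hT : r' ≤ T) {s : ℝ≥0} {e : FragMark} (hs : s ∈ Ioc r r')
    (hN : N.restrict (Ioc r r' ×ˢ coagRegion l) = 0)
    (hM : M.restrict (Ioc r r' ×ˢ fragRegion l) = Measure.dirac (s, e)) :
    (∀ u ∈ Ico r s, x u = x r) ∧ ∀ u ∈ Icc s r', x u = fragStep F e (x r) := by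
  have hj := path_eq_of_jump hp h.cadlag hD hs hr'
    (J := fun k => (fragStep F e (Function.leftLim x s) k : ℝ) - Function.leftLim x s k) ?_
  · refine ⟨hj.1, fun u hu => ?_⟩
    have h2 := hj.2 u hu
    rw [leftLim_eq_of_eqOn_Ico hs.1 hj.1] at h2
    funext k
    have := h2 k
    rw [add_sub_cancel] at this
    exact_mod_cast this
  · intro u hu hru hur k
    rw [h.eq_add hr hu hru hur hT k, hN, hM, integral_dirac]
    simp

end IsSolutionPath

/-! ### Step paths on the grid -/

section StepPath

variable {S E₁ E₂ : Type*} [MeasurableSpace E₁] [MeasurableSpace E₂]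

/-- On the time interval `[r, r']` the path `z` has at most one jump, and such a jump is caused by
an event of `N₁` or `N₂`, whose mark acts on the states through `T₁` or `T₂`, respectively. -/
def IsCellStep (N₁ : Measure (ℝ≥0 × E₁)) (N₂ : Measure (ℝ≥0 × E₂)) (T₁ : E₁ → S → S)
    (T₂ : E₂ → S → S) (z : ℝ≥0 → S) (r r' : ℝ≥0) : Prop :=
  ∃ s ∈ Ioc r r', (∀ u ∈ Ico r s, z u = z r) ∧ (∀ u ∈ Icc s r', z u = z r') ∧
    (z r' = z r ∨
      (∃ s' e, Measure.dirac (s', e) ≤ N₁.restrict (Ioc r r' ×ˢ univ) ∧ z r' = T₁ e (z r)) ∨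
      ∃ s' e, Measure.dirac (s', e) ≤ N₂.restrict (Ioc r r' ×ˢ univ) ∧ z r' = T₂ e (z r))

/-- The supremum of `φ` over the path `z` on `[0, t]`, up to and including the time at which `z`
leaves `D`. -/
noncomputable def stoppedSup (φ : S → ℝ≥0∞) (D : Set S) (z : ℝ≥0 → S) (t : ℝ≥0) : ℝ≥0∞ :=
  ⨆ (s : ℝ≥0) (_ : s ≤ t ∧ ∀ r < s, z r ∈ D), φ (z s)

open Classical in
/-- The analogue of `stoppedSup` for the values of the path on a dyadic grid. -/
noncomputable def gridSup (φ : S → ℝ≥0∞) (D : Set S) (z : ℝ≥0 → S) (t : ℝ≥0) (j : ℕ) : ℝ≥0∞ :=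
  ⨆ k, if k ≤ 2 ^ j ∧ ∀ i < k, z (gridPoint t j i) ∈ D then φ (z (gridPoint t j k)) else 0

lemma exists_mem_Ioc_gridPoint {t s : ℝ≥0} (hs : 0 < s) (j : ℕ) {n : ℕ}
    (hsn : s ≤ gridPoint t j n) :
    ∃ k < n, s ∈ Ioc (gridPoint t j k) (gridPoint t j (k + 1)) := by
  induction n with
  | zero =>
    rw [gridPoint_zero] at hsn
    exact absurd hs (not_lt.2 hsn)
  | succ n ih =>
    by_cases h : s ≤ gridPoint t j n
    · obtain ⟨k, hk, hks⟩ := ih h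
      exact ⟨k, hk.trans (Nat.lt_succ_self n), hks⟩
    · exact ⟨n, Nat.lt_succ_self n, not_le.1 h, hsn⟩

variable {N₁ : Measure (ℝ≥0 × E₁)} {N₂ : Measure (ℝ≥0 × E₂)} {T₁ : E₁ → S → S} {T₂ : E₂ → S → S}
  {z : ℝ≥0 → S} {φ : S → ℝ≥0∞} {D : Set S} {t : ℝ≥0} {j : ℕ}

lemma stoppedSup_eq_gridSup (h : ∀ k < 2 ^ j, IsCellStep N₁ N₂ T₁ T₂ z (gridPoint t j k)
    (gridPoint t j (k + 1))) : stoppedSup φ D z t = gridSup φ D z t j := by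
  apply le_antisymm
  · refine iSup₂_le fun s hs => ?_
    have hval : ∀ k, (k ≤ 2 ^ j ∧ ∀ i < k, z (gridPoint t j i) ∈ D) → z s = z (gridPoint t j k) →
        φ (z s) ≤ gridSup φ D z t j := by
      intro k hk hz
      unfold gridSup
      refine le_iSup_of_le k ?_
      rw [if_pos hk, hz]
    rcases eq_or_ne s 0 with rfl | hs0
    · exact hval 0 ⟨Nat.zero_le _, by simp⟩ (by rw [gridPoint_zero])
    obtain ⟨k, hk, hks⟩ := exists_mem_Ioc_gridPoint (pos_iff_ne_zero.2 hs0) j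
      (hs.1.trans_eq (gridPoint_last t j).symm)
    obtain ⟨u, hu, hu1, hu2, -⟩ := h k hk
    have hD : ∀ i ≤ k, z (gridPoint t j i) ∈ D := fun i hi =>
      hs.2 _ ((gridPoint_mono t j hi).trans_lt hks.1)
    rcases lt_or_ge s u with hsu | hsu
    · exact hval k ⟨hk.le, fun i hi => hD i hi.le⟩ (hu1 s ⟨hks.1.le, hsu⟩)
    · exact hval (k + 1) ⟨hk, fun i hi => hD i (Nat.lt_succ_iff.1 hi)⟩ (hu2 s ⟨hsu, hks.2⟩)
  · refine iSup_le fun k => ?_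
    split_ifs with hk
    · have hval : ∀ s, s ≤ t → (∀ r < s, z r ∈ D) → z s = z (gridPoint t j k) →
          φ (z (gridPoint t j k)) ≤ stoppedSup φ D z t := by
        intro s hst hs hz
        rw [← hz]
        exact le_iSup₂_of_le (f := fun s (_ : s ≤ t ∧ ∀ r < s, z r ∈ D) => φ (z s)) s
          ⟨hst, hs⟩ le_rfl
      obtain ⟨hkn, hkD⟩ := hk
      rcases k with _ | k
      · exact hval 0 zero_le (by simp) (by rw [gridPoint_zero])
      obtain ⟨u, hu, hu1, hu2, -⟩ := h k hkn
      refine hval u (hu.2.trans ((gridPoint_mono t j hkn).trans_eq (gridPoint_last t j))) ?_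
        (hu2 u ⟨le_rfl, hu.2⟩)
      intro r hr
      rcases eq_or_ne r 0 with rfl | hr0
      · have := hkD 0 (Nat.succ_pos k)
        rwa [gridPoint_zero] at this
      obtain ⟨i, hi, hir⟩ := exists_mem_Ioc_gridPoint (pos_iff_ne_zero.2 hr0) j (hr.le.trans hu.2)
      rcases eq_or_lt_of_le (Nat.lt_succ_iff.1 hi) with rfl | hik
      · rw [hu1 r ⟨hir.1.le, hr⟩]
        exact hkD i hi
      · obtain ⟨v, hv, hv1, hv2, -⟩ := h i (hi.trans_le hkn)
        rcases lt_or_ge r v with hrv | hrv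
        · rw [hv1 r ⟨hir.1.le, hrv⟩]
          exact hkD i hi
        · rw [hv2 r ⟨hrv, hir.2⟩]
          exact hkD (i + 1) (Nat.succ_lt_succ hik)
    · exact zero_le

lemma IsCellStep.le_add_lintegral [MeasurableSpace S] {r r' : ℝ≥0}
    (h : IsCellStep N₁ N₂ T₁ T₂ z r r') (hφ : Measurable φ)
    (hT₁ : Measurable fun q : E₁ × S => T₁ q.1 q.2)
    (hT₂ : Measurable fun q : E₂ × S => T₂ q.1 q.2) :
    φ (z r') ≤ φ (z r) + (∫⁻ e in Ioc r r' ×ˢ univ, (φ (T₁ e.2 (z r)) - φ (z r)) ∂N₁ +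
      ∫⁻ e in Ioc r r' ×ˢ univ, (φ (T₂ e.2 (z r)) - φ (z r)) ∂N₂) := by
  obtain ⟨-, -, -, -, h | ⟨s, e, hle, he⟩ | ⟨s, e, hle, he⟩⟩ := h
  · rw [h]; exact le_self_add
  · have hm : Measurable fun e : ℝ≥0 × E₁ => φ (T₁ e.2 (z r)) - φ (z r) :=
      (hφ.comp (hT₁.comp (measurable_snd.prodMk measurable_const))).sub measurable_const
    have h1 := lintegral_mono' hle (le_refl fun e : ℝ≥0 × E₁ => φ (T₁ e.2 (z r)) - φ (z r))
    rw [lintegral_dirac' _ hm] at h1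
    rw [he]
    refine le_trans (b := φ (z r) + (φ (T₁ e (z r)) - φ (z r))) le_add_tsub ?_
    exact add_le_add le_rfl (h1.trans le_self_add)
  · have hm : Measurable fun e : ℝ≥0 × E₂ => φ (T₂ e.2 (z r)) - φ (z r) :=
      (hφ.comp (hT₂.comp (measurable_snd.prodMk measurable_const))).sub measurable_const
    have h1 := lintegral_mono' hle (le_refl fun e : ℝ≥0 × E₂ => φ (T₂ e.2 (z r)) - φ (z r))
    rw [lintegral_dirac' _ hm] at h1
    rw [he]
    refine le_trans (b := φ (z r) + (φ (T₂ e (z r)) - φ (z r))) le_add_tsub ?_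
    exact add_le_add le_rfl (h1.trans le_add_self)

end StepPath

/-! ### A moment bound for step processes -/

lemma one_add_div_pow_le_exp (c t : ℝ≥0) (n : ℕ) (hn : n ≠ 0) :
    (1 + (t * (n : ℝ≥0∞)⁻¹ * c)) ^ n ≤ ENNReal.ofReal (Real.exp (c * t)) := by
  have h : (1 + (t * (n : ℝ≥0∞)⁻¹ * c)) = ENNReal.ofReal (1 + c * t / n) := by
    rw [ENNReal.ofReal_add zero_le_one (by positivity), ENNReal.ofReal_one,
      ENNReal.ofReal_div_of_pos (by positivity),
      ENNReal.ofReal_mul (p := (c : ℝ)) (NNReal.coe_nonneg c),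
      ENNReal.ofReal_coe_nnreal, ENNReal.ofReal_coe_nnreal, ENNReal.ofReal_natCast, div_eq_mul_inv]
    ring
  rw [h, ← ENNReal.ofReal_pow (by positivity)]
  refine ENNReal.ofReal_le_ofReal ?_
  have h1 : 1 + (c : ℝ) * t / n ≤ Real.exp (c * t / n) := by
    rw [add_comm]; exact Real.add_one_le_exp _
  calc (1 + (c : ℝ) * t / n) ^ n ≤ Real.exp (c * t / n) ^ n :=
        pow_le_pow_left₀ (by positivity) h1 n
    _ = _ := by
        rw [← Real.exp_nat_mul]
        congr 1
        field_simp

section Moment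

variable {Ω S E₁ E₂ : Type*} [mΩ : MeasurableSpace Ω] [MeasurableSpace S] [MeasurableSpace E₁]
  [MeasurableSpace E₂] {P : Measure Ω} [IsProbabilityMeasure P]

/-- The expectation of the increase of `φ` on a time interval `(r, r']`, on an event prior to `r`
with indicator `a`. -/
lemma lintegral_increment_le {E : Type*} [MeasurableSpace E] {N : Ω → Measure (ℝ≥0 × E)}
    {μ : Measure E} [SigmaFinite μ] (hN : IsPoissonMeasure P N (lebesgueNN.prod μ))
    {𝓕 : ℝ≥0 → MeasurableSpace Ω} {r : ℝ≥0} (h𝓕 : 𝓕 r ≤ mΩ) (r' : ℝ≥0)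
    (hind : ∀ C, MeasurableSet C → C ⊆ Ioi r ×ˢ univ →
      Indep (𝓕 r) (MeasurableSpace.comap (fun ω => N ω C) inferInstance) P)
    {Z : Ω → S} (hZ : Measurable[𝓕 r] Z) {a : Ω → ℝ≥0∞} (ha : Measurable[𝓕 r] a) {T : E → S → S}
    (hT : Measurable fun q : E × S => T q.1 q.2) {φ : S → ℝ≥0∞} (hφ : Measurable φ) :
    AEMeasurable (fun ω => a ω *
        ∫⁻ e in Ioc r r' ×ˢ univ, (φ (T e.2 (Z ω)) - φ (Z ω)) ∂N ω) P ∧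
      ∫⁻ ω, a ω * ∫⁻ e in Ioc r r' ×ˢ univ, (φ (T e.2 (Z ω)) - φ (Z ω)) ∂N ω ∂P =
        ENNReal.ofReal (r' - r) * ∫⁻ ω, a ω * ∫⁻ e, (φ (T e (Z ω)) - φ (Z ω)) ∂μ ∂P := by
  have hY : Measurable[𝓕 r] fun ω => (Z ω, a ω) := hZ.prodMk ha
  have hh : Measurable fun q : (S × ℝ≥0∞) × E => q.1.2 * (φ (T q.2 q.1.1) - φ q.1.1) := by
    have h1 : Measurable fun q : (S × ℝ≥0∞) × E => T q.2 q.1.1 :=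
      hT.comp (measurable_snd.prodMk (measurable_fst.comp measurable_fst))
    exact (measurable_snd.comp measurable_fst).mul
      ((hφ.comp h1).sub (hφ.comp (measurable_fst.comp measurable_fst)))
  have hYi : ∀ C, MeasurableSet C → C ⊆ Ioi r ×ˢ univ →
      IndepFun (fun ω => (Z ω, a ω)) (fun ω => N ω C) P := fun C hC hCr =>
    indep_of_indep_of_le_left (hind C hC hCr) hY.comap_le
  have key := hN.lintegral_lintegral r r' (hY.mono h𝓕 le_rfl) hYi hh
  have hm : ∀ ω, Measurable fun e => φ (T e (Z ω)) - φ (Z ω) := fun ω =>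
    (hφ.comp (hT.comp (measurable_id.prodMk measurable_const))).sub measurable_const
  have e1 : ∀ ω, ∫⁻ e in Ioc r r' ×ˢ univ, a ω * (φ (T e.2 (Z ω)) - φ (Z ω)) ∂N ω =
      a ω * ∫⁻ e in Ioc r r' ×ˢ univ, (φ (T e.2 (Z ω)) - φ (Z ω)) ∂N ω := fun ω =>
    lintegral_const_mul _ ((hm ω).comp measurable_snd)
  have e2 : ∀ ω, ∫⁻ e, a ω * (φ (T e (Z ω)) - φ (Z ω)) ∂μ =
      a ω * ∫⁻ e, (φ (T e (Z ω)) - φ (Z ω)) ∂μ := fun ω => lintegral_const_mul _ (hm ω)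
  simp only [e1, e2] at key
  exact key

/-- Let `Z` be an adapted process whose paths are step functions, with jumps caused by the events
of two Poisson measures. If the mean increase of `φ` per unit of time is at most `c φ` on the set
`D`, on which `φ` is bounded, then the mean of the supremum of `φ` over the stopped path grows at
most like `exp (c t)`. The proof is a discrete Gronwall argument on a dyadic grid: on a fine grid
`φ` is dominated by its initial value plus the sum of its increases over the cells, up to an error
which vanishes in the mean since a fine grid isolates the events. -/
theorem lintegral_stoppedSup_le {N₁ : Ω → Measure (ℝ≥0 × E₁)} {N₂ : Ω → Measure (ℝ≥0 × E₂)}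
    {μ₁ : Measure E₁} {μ₂ : Measure E₂} [SigmaFinite μ₁] [SigmaFinite μ₂]
    (hN₁ : IsPoissonMeasure P N₁ (lebesgueNN.prod μ₁))
    (hN₂ : IsPoissonMeasure P N₂ (lebesgueNN.prod μ₂))
    {𝓕 : ℝ≥0 → MeasurableSpace Ω} (h𝓕 : ∀ r, 𝓕 r ≤ mΩ) (h𝓕mono : Monotone 𝓕)
    (hind₁ : ∀ r C, MeasurableSet C → C ⊆ Ioi r ×ˢ univ →
      Indep (𝓕 r) (MeasurableSpace.comap (fun ω => N₁ ω C) inferInstance) P)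
    (hind₂ : ∀ r C, MeasurableSet C → C ⊆ Ioi r ×ˢ univ →
      Indep (𝓕 r) (MeasurableSpace.comap (fun ω => N₂ ω C) inferInstance) P)
    {Z : ℝ≥0 → Ω → S} (hZ : ∀ r, Measurable[𝓕 r] (Z r)) {T₁ : E₁ → S → S} {T₂ : E₂ → S → S}
    (hT₁ : Measurable fun q : E₁ × S => T₁ q.1 q.2) (hT₂ : Measurable fun q : E₂ × S => T₂ q.1 q.2)
    {φ : S → ℝ≥0∞} (hφ : Measurable φ) {D : Set S} (hD : MeasurableSet D) {t : ℝ≥0}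
    (hstep : ∀ᵐ ω ∂P, ∃ j₀, ∀ j ≥ j₀, ∀ k < 2 ^ j, IsCellStep (N₁ ω) (N₂ ω) T₁ T₂
      (fun s => Z s ω) (gridPoint t j k) (gridPoint t j (k + 1)))
    {c : ℝ≥0} (hdrift : ∀ r, ∀ᵐ ω ∂P, Z r ω ∈ D →
      ∫⁻ e, (φ (T₁ e (Z r ω)) - φ (Z r ω)) ∂μ₁ + ∫⁻ e, (φ (T₂ e (Z r ω)) - φ (Z r ω)) ∂μ₂ ≤
        c * φ (Z r ω))
    {R : ℝ≥0} (hR : ∀ z ∈ D, φ z ≤ R) {z₀ : S} (hz₀ : ∀ᵐ ω ∂P, Z 0 ω = z₀) :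
    AEMeasurable (fun ω => stoppedSup φ D (fun s => Z s ω) t) P ∧
      ∫⁻ ω, stoppedSup φ D (fun s => Z s ω) t ∂P ≤ φ z₀ * ENNReal.ofReal (Real.exp (c * t)) := by
  classical
  have hZm : ∀ r, Measurable (Z r) := fun r => (hZ r).mono (h𝓕 r) le_rfl
  have hsup : ∀ᵐ ω ∂P, ∀ᶠ j in atTop, stoppedSup φ D (fun s => Z s ω) t =
      gridSup φ D (fun s => Z s ω) t j := by
    filter_upwards [hstep] with ω ⟨j₀, hj₀⟩
    exact eventually_atTop.2 ⟨j₀, fun j hj => stoppedSup_eq_gridSup (hj₀ j hj)⟩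
  refine ⟨?_, ?_⟩
  · refine aemeasurable_of_tendsto_metrizable_ae' (f := fun j ω => gridSup φ D (fun s => Z s ω) t j)
      (fun j => ?_) ?_
    · refine (Measurable.iSup fun k => Measurable.ite ?_ (hφ.comp (hZm _))
        measurable_const).aemeasurable
      refine (MeasurableSet.const _).inter ?_
      have : {ω | ∀ i < k, Z (gridPoint t j i) ω ∈ D} =
          ⋂ i, ⋂ (_ : i < k), Z (gridPoint t j i) ⁻¹' D := by ext ω; simp
      change MeasurableSet {ω | ∀ i < k, Z (gridPoint t j i) ω ∈ D}
      rw [this]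
      exact MeasurableSet.iInter fun i => MeasurableSet.iInter fun _ => hZm _ hD
    · filter_upwards [hsup] with ω hω
      exact tendsto_const_nhds.congr' hω
  -- `a j k` is the indicator of the event that the path has not left `D` at the `k`-th grid point
  set a : ℕ → ℕ → Ω → ℝ≥0∞ := fun j k =>
    {ω | ∀ i ≤ k, Z (gridPoint t j i) ω ∈ D}.indicator 1 with ha
  have ham : ∀ j k, Measurable[𝓕 (gridPoint t j k)] (a j k) := by
    intro j k
    have hset : {ω | ∀ i ≤ k, Z (gridPoint t j i) ω ∈ D} =
        ⋂ i, ⋂ (_ : i ≤ k), Z (gridPoint t j i) ⁻¹' D := by ext ω; simp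
    refine Measurable.indicator (@measurable_const _ _ _ (𝓕 (gridPoint t j k)) 1) ?_
    rw [hset]
    exact MeasurableSet.iInter fun i => MeasurableSet.iInter fun hi =>
      h𝓕mono (gridPoint_mono t j hi) _ (hZ _ hD)
  set I : ℕ → ℕ → Ω → ℝ≥0∞ := fun j k ω =>
    a j k ω * ∫⁻ e in Ioc (gridPoint t j k) (gridPoint t j (k + 1)) ×ˢ univ,
      (φ (T₁ e.2 (Z (gridPoint t j k) ω)) - φ (Z (gridPoint t j k) ω)) ∂N₁ ω +
    a j k ω * ∫⁻ e in Ioc (gridPoint t j k) (gridPoint t j (k + 1)) ×ˢ univ,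
      (φ (T₂ e.2 (Z (gridPoint t j k) ω)) - φ (Z (gridPoint t j k) ω)) ∂N₂ ω with hI
  have hI₁ := fun j k => lintegral_increment_le hN₁ (h𝓕 (gridPoint t j k)) (gridPoint t j (k + 1))
    (hind₁ _) (hZ (gridPoint t j k)) (ham j k) hT₁ hφ
  have hI₂ := fun j k => lintegral_increment_le hN₂ (h𝓕 (gridPoint t j k)) (gridPoint t j (k + 1))
    (hind₂ _) (hZ (gridPoint t j k)) (ham j k) hT₂ hφ
  have hIm : ∀ j k, AEMeasurable (I j k) P := fun j k => (hI₁ j k).1.add (hI₂ j k).1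
  set U : ℕ → ℕ → Ω → ℝ≥0∞ := fun j k ω => φ (Z 0 ω) + ∑ i ∈ Finset.range k, I j i ω with hU
  have hUm : ∀ j k, AEMeasurable (U j k) P := fun j k =>
    (hφ.comp (hZm 0)).aemeasurable.add (Finset.aemeasurable_fun_sum _ fun i _ => hIm j i)
  have hUmono : ∀ j ω, Monotone fun k => U j k ω := fun j ω k l hkl =>
    add_le_add le_rfl (Finset.sum_le_sum_of_subset (Finset.range_mono hkl))
  -- on a grid which isolates the events, `U` dominates `φ`
  have hpath : ∀ ω j, (∀ k < 2 ^ j, IsCellStep (N₁ ω) (N₂ ω) T₁ T₂ (fun s => Z s ω)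
      (gridPoint t j k) (gridPoint t j (k + 1))) → ∀ k ≤ 2 ^ j,
      (∀ i < k, Z (gridPoint t j i) ω ∈ D) → φ (Z (gridPoint t j k) ω) ≤ U j k ω := by
    intro ω j hω k
    induction k with
    | zero => intro _ _; simp [hU, gridPoint_zero]
    | succ k ih =>
      intro hk hkD
      have h1 := ih (Nat.le_of_succ_le hk) fun i hi => hkD i (hi.trans (Nat.lt_succ_self k))
      have h2 := (hω k hk).le_add_lintegral hφ hT₁ hT₂
      have hak : a j k ω = 1 := by
        rw [ha]
        exact indicator_of_mem (s := {ω | ∀ i ≤ k, Z (gridPoint t j i) ω ∈ D})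
          (fun i hi => hkD i (Nat.lt_succ_of_le hi)) _
      have h3 : U j (k + 1) ω = U j k ω + I j k ω := by
        simp only [hU]
        rw [Finset.sum_range_succ, add_assoc]
      rw [h3, hI]
      simp only [hak, one_mul]
      exact h2.trans (add_le_add h1 le_rfl)
  set b : ℕ → Ω → ℝ≥0∞ := fun j ω =>
    ⨆ k ∈ Finset.range (2 ^ j), (a j k ω * φ (Z (gridPoint t j k) ω) - U j k ω) with hb
  have hbm : ∀ j, AEMeasurable (b j) P := fun j =>
    AEMeasurable.biSup _ (Finset.countable_toSet _) fun k _ =>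
      ((((ham j k).mono (h𝓕 _) le_rfl).mul (hφ.comp (hZm _))).aemeasurable.sub (hUm j k))
  have hbR : ∀ j ω, b j ω ≤ R := by
    intro j ω
    refine iSup₂_le fun k _ => tsub_le_self.trans ?_
    rw [ha]
    by_cases h : ω ∈ {ω | ∀ i ≤ k, Z (gridPoint t j i) ω ∈ D}
    · simp only [indicator_of_mem h, Pi.one_apply, one_mul]
      exact hR _ (h k le_rfl)
    · simp only [indicator_of_notMem h, zero_mul, zero_le]
  have hb0 : Tendsto (fun j => ∫⁻ ω, b j ω ∂P) atTop (𝓝 0) := by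
    have h0 : (0 : ℝ≥0∞) = ∫⁻ _, 0 ∂P := by simp
    rw [h0]
    refine tendsto_lintegral_of_dominated_convergence' (fun _ => (R : ℝ≥0∞)) hbm
      (fun j => Eventually.of_forall (hbR j)) (by simp) ?_
    filter_upwards [hstep] with ω ⟨j₀, hj₀⟩
    refine tendsto_const_nhds.congr' (eventually_atTop.2 ⟨j₀, fun j hj => ?_⟩)
    refine (nonpos_iff_eq_zero.1 (iSup₂_le fun k hk => ?_)).symm
    rw [tsub_eq_zero_of_le]
    rw [ha]
    by_cases h : ω ∈ {ω | ∀ i ≤ k, Z (gridPoint t j i) ω ∈ D}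
    · simp only [indicator_of_mem h, Pi.one_apply, one_mul]
      exact hpath ω j (hj₀ j hj) k (Finset.mem_range.1 hk).le fun i hi => h i hi.le
    · simp only [indicator_of_notMem h, zero_mul, zero_le]
  -- the discrete Gronwall inequality
  have hrec : ∀ j k, k < 2 ^ j → ∫⁻ ω, U j (k + 1) ω ∂P ≤ ∫⁻ ω, U j k ω ∂P +
      t * (2 ^ j)⁻¹ * c * (∫⁻ ω, U j k ω ∂P + ∫⁻ ω, b j ω ∂P) := by
    intro j k hk
    have h3 : ∀ ω, U j (k + 1) ω = U j k ω + I j k ω := fun ω => by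
      simp only [hU]
      rw [Finset.sum_range_succ, add_assoc]
    simp_rw [h3]
    rw [lintegral_add_left' (hUm j k)]
    refine add_le_add le_rfl ?_
    rw [hI, lintegral_add_left' (hI₁ j k).1, (hI₁ j k).2, (hI₂ j k).2, gridPoint_succ_sub,
      ← mul_add, mul_assoc (_ * _)]
    refine mul_le_mul_right ?_ _
    have hm1 : Measurable fun ω => a j k ω * ∫⁻ e, (φ (T₁ e (Z (gridPoint t j k) ω)) -
        φ (Z (gridPoint t j k) ω)) ∂μ₁ := by
      refine ((ham j k).mono (h𝓕 _) le_rfl).mul ?_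
      have h1 : Measurable fun q : S × E₁ => φ (T₁ q.2 q.1) - φ q.1 :=
        (hφ.comp (hT₁.comp measurable_swap)).sub (hφ.comp measurable_fst)
      exact h1.lintegral_prod_right'.comp (hZm _)
    rw [← lintegral_add_left hm1, ← lintegral_add_left' (hUm j k),
      ← lintegral_const_mul' _ _ ENNReal.coe_ne_top]
    refine lintegral_mono_ae ?_
    filter_upwards [hdrift (gridPoint t j k)] with ω hω
    rw [← mul_add]
    have h4 : a j k ω * φ (Z (gridPoint t j k) ω) ≤ U j k ω + b j ω := by
      refine tsub_le_iff_left.1 ?_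
      exact le_iSup₂ (f := fun k (_ : k ∈ Finset.range (2 ^ j)) =>
        a j k ω * φ (Z (gridPoint t j k) ω) - U j k ω) k (Finset.mem_range.2 hk)
    refine le_trans ?_ (mul_le_mul_right h4 _)
    rw [ha]
    by_cases h : ω ∈ {ω | ∀ i ≤ k, Z (gridPoint t j i) ω ∈ D}
    · simp only [indicator_of_mem h, Pi.one_apply, one_mul]
      exact hω (h k le_rfl)
    · simp only [indicator_of_notMem h, zero_mul, zero_le]
  have hU0 : ∀ j, ∫⁻ ω, U j 0 ω ∂P = φ z₀ := by
    intro j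
    have : ∀ᵐ ω ∂P, U j 0 ω = φ z₀ := by
      filter_upwards [hz₀] with ω hω
      simp [hU, hω]
    rw [lintegral_congr_ae this]
    simp
  have hgron : ∀ j k, k ≤ 2 ^ j → ∫⁻ ω, U j k ω ∂P + ∫⁻ ω, b j ω ∂P ≤
      (φ z₀ + ∫⁻ ω, b j ω ∂P) * (1 + t * (2 ^ j)⁻¹ * c) ^ k := by
    intro j k
    induction k with
    | zero => intro _; rw [hU0]; simp
    | succ k ih =>
      intro hk
      calc ∫⁻ ω, U j (k + 1) ω ∂P + ∫⁻ ω, b j ω ∂P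
          ≤ ∫⁻ ω, U j k ω ∂P + t * (2 ^ j)⁻¹ * c * (∫⁻ ω, U j k ω ∂P + ∫⁻ ω, b j ω ∂P) +
              ∫⁻ ω, b j ω ∂P := add_le_add (hrec j k hk) le_rfl
        _ = (∫⁻ ω, U j k ω ∂P + ∫⁻ ω, b j ω ∂P) * (1 + t * (2 ^ j)⁻¹ * c) := by ring
        _ ≤ _ := by
            rw [pow_succ, ← mul_assoc]
            exact mul_le_mul_left (ih (Nat.le_of_succ_le hk)) _
  have hfinal : ∀ j, ∫⁻ ω, U j (2 ^ j) ω ∂P ≤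
      (φ z₀ + ∫⁻ ω, b j ω ∂P) * ENNReal.ofReal (Real.exp (c * t)) := by
    intro j
    refine (le_self_add.trans (hgron j (2 ^ j) le_rfl)).trans (mul_le_mul_right ?_ _)
    have := one_add_div_pow_le_exp c t (2 ^ j) (by positivity)
    push_cast at this
    exact this
  calc ∫⁻ ω, stoppedSup φ D (fun s => Z s ω) t ∂P
      ≤ ∫⁻ ω, liminf (fun j => U j (2 ^ j) ω) atTop ∂P := by
        refine lintegral_mono_ae ?_
        filter_upwards [hstep] with ω ⟨j₀, hj₀⟩
        refine le_liminf_of_le (by isBoundedDefault) (eventually_atTop.2 ⟨j₀, fun j hj => ?_⟩)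
        rw [stoppedSup_eq_gridSup (hj₀ j hj)]
        refine iSup_le fun k => ?_
        split_ifs with hk
        · exact (hpath ω j (hj₀ j hj) k hk.1 hk.2).trans (hUmono j ω hk.1)
        · exact zero_le
    _ ≤ liminf (fun j => ∫⁻ ω, U j (2 ^ j) ω ∂P) atTop := lintegral_liminf_le' fun j => hUm j _
    _ ≤ liminf (fun j => (φ z₀ + ∫⁻ ω, b j ω ∂P) * ENNReal.ofReal (Real.exp (c * t))) atTop :=
        liminf_le_liminf (Eventually.of_forall hfinal)
    _ = φ z₀ * ENNReal.ofReal (Real.exp (c * t)) := by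
        have := ENNReal.Tendsto.mul_const (hb0.const_add (φ z₀))
          (Or.inr (ENNReal.ofReal_ne_top (r := Real.exp (c * t))))
        rw [add_zero] at this
        exact this.liminf_eq

end Moment

/-! ### The pair of solutions as a step process -/

/-- The action of a coalescence event on a pair of states. -/
noncomputable def coagPairStep (K : ℝ≥0 → ℝ≥0 → ℝ≥0) (e : CoagMark)
    (z : (ℕ → ℝ≥0) × (ℕ → ℝ≥0)) : (ℕ → ℝ≥0) × (ℕ → ℝ≥0) :=
  (coagStep K e z.1, coagStep K e z.2)

/-- The action of a fragmentation event on a pair of states. -/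
noncomputable def fragPairStep (F : ℝ≥0 → ℝ≥0) (e : FragMark)
    (z : (ℕ → ℝ≥0) × (ℕ → ℝ≥0)) : (ℕ → ℝ≥0) × (ℕ → ℝ≥0) :=
  (fragStep F e z.1, fragStep F e z.2)

lemma measurable_coagPairStep {K : ℝ≥0 → ℝ≥0 → ℝ≥0}
    (hK : Measurable fun q : ℝ≥0 × ℝ≥0 => K q.1 q.2) :
    Measurable fun q : CoagMark × ((ℕ → ℝ≥0) × (ℕ → ℝ≥0)) => coagPairStep K q.1 q.2 :=
  ((measurable_coagStep hK).comp
    (measurable_fst.prodMk (measurable_fst.comp measurable_snd))).prodMk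
    ((measurable_coagStep hK).comp (measurable_fst.prodMk (measurable_snd.comp measurable_snd)))

lemma measurable_fragPairStep {F : ℝ≥0 → ℝ≥0} (hF : Measurable F) :
    Measurable fun q : FragMark × ((ℕ → ℝ≥0) × (ℕ → ℝ≥0)) => fragPairStep F q.1 q.2 :=
  ((measurable_fragStep hF).comp
    (measurable_fst.prodMk (measurable_fst.comp measurable_snd))).prodMk
    ((measurable_fragStep hF).comp (measurable_fst.prodMk (measurable_snd.comp measurable_snd)))

/-- Over a cell with at most one event, two solutions driven by the same measures perform the same
step. -/
lemma IsSolutionPath.isCellStep {p : ℝ} (hp : 0 < p) {K : ℝ≥0 → ℝ≥0 → ℝ≥0} {F : ℝ≥0 → ℝ≥0}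
    {m m' : ℕ → ℝ≥0} {x x' : ℝ≥0 → ℕ → ℝ≥0} {N : Measure CoagSpace} {M : Measure FragSpace}
    {D : Set ℝ≥0} {l : ℕ} {r r' T : ℝ≥0} (h : IsSolutionPath p K F m N M D l T x)
    (h' : IsSolutionPath p K F m' N M D l T x') (hD : Dense D) (hr : r ∈ D) (hr' : r' ∈ D)
    (hT : r' ≤ T) (hrr : r < r')
    (hN : ∃ (s : Set ℕ) (y : s → CoagSpace), N = Measure.sum fun n => Measure.dirac (y n))
    (hM : ∃ (s : Set ℕ) (y : s → FragSpace), M = Measure.sum fun n => Measure.dirac (y n))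
    (hone : AtMostOneEvent (E₁ := CoagMark) (E₂ := FragMark) N M (coagRegion l) (fragRegion l)
      r r') :
    IsCellStep (E₁ := CoagMark) (E₂ := FragMark) N M (coagPairStep K) (fragPairStep F)
      (fun s => (x s, x' s)) r r' := by
  obtain ⟨hN2, hM2, h1⟩ := hone
  have hBN : MeasurableSet (Ioc r r' ×ˢ coagRegion l) :=
    measurableSet_Ioc.prod (measurableSet_coagRegion l)
  have hBM : MeasurableSet (Ioc r r' ×ˢ fragRegion l) :=
    measurableSet_Ioc.prod (measurableSet_fragRegion l)
  have hNr := restrict_eq_zero_or_dirac hN hBN hN2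
  have hMr := restrict_eq_zero_or_dirac hM hBM hM2
  have hlt : ∀ {E : Type} [MeasurableSpace E] {μ : Measure E} {C : Set E} {e : E},
      μ.restrict C = Measure.dirac e → ¬ μ C < 1 := by
    intro E _ μ C e he hlt
    have := congrArg (fun μ : Measure E => μ univ) he
    simp only [Measure.restrict_apply_univ, Measure.dirac_apply_of_mem (mem_univ e)] at this
    exact absurd this hlt.ne
  rcases hNr with hN0 | ⟨⟨s, e⟩, he, hNd⟩
  · rcases hMr with hM0 | ⟨⟨s, e⟩, he, hMd⟩
    · have e1 := h.eq_of_no_event hp hD hr hr' hT hrr hN0 hM0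
      have e2 := h'.eq_of_no_event hp hD hr hr' hT hrr hN0 hM0
      have e3 : ∀ u ∈ Icc r r', (x u, x' u) = (x r, x' r) := fun u hu => by rw [e1 u hu, e2 u hu]
      refine ⟨r', ⟨hrr, le_rfl⟩, fun u hu => e3 u ⟨hu.1, hu.2.le⟩, fun u hu => ?_,
        Or.inl (e3 r' ⟨hrr.le, le_rfl⟩)⟩
      rw [le_antisymm hu.2 hu.1]
    · obtain ⟨a1, a2⟩ := h.eq_of_frag_event hp hD hr hr' hT he.1 hN0 hMd
      obtain ⟨b1, b2⟩ := h'.eq_of_frag_event hp hD hr hr' hT he.1 hN0 hMd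
      have e3 : ∀ u ∈ Icc s r', (x u, x' u) = fragPairStep F e (x r, x' r) := fun u hu => by
        rw [a2 u hu, b2 u hu]; rfl
      refine ⟨s, he.1, fun u hu => ?_, fun u hu => ?_, Or.inr (Or.inr ⟨s, e, ?_, ?_⟩)⟩
      · simp only [a1 u hu, b1 u hu]
      · exact (e3 u hu).trans (e3 r' ⟨he.1.2, le_rfl⟩).symm
      · rw [← hMd]
        exact Measure.restrict_mono (prod_mono le_rfl (subset_univ _)) le_rfl
      · exact e3 r' ⟨he.1.2, le_rfl⟩
  · have hM0 : M.restrict (Ioc r r' ×ˢ fragRegion l) = 0 := by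
      refine hMr.resolve_right ?_
      rintro ⟨e', -, hMd⟩
      exact h1.elim (hlt hNd) (hlt hMd)
    obtain ⟨a1, a2⟩ := h.eq_of_coag_event hp hD hr hr' hT he.1 hNd hM0
    obtain ⟨b1, b2⟩ := h'.eq_of_coag_event hp hD hr hr' hT he.1 hNd hM0
    have e3 : ∀ u ∈ Icc s r', (x u, x' u) = coagPairStep K e (x r, x' r) := fun u hu => by
      rw [a2 u hu, b2 u hu]; rfl
    refine ⟨s, he.1, fun u hu => ?_, fun u hu => ?_, Or.inr (Or.inl ⟨s, e, ?_, ?_⟩)⟩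
    · simp only [a1 u hu, b1 u hu]
    · exact (e3 u hu).trans (e3 r' ⟨he.1.2, le_rfl⟩).symm
    · rw [← hNd]
      exact Measure.restrict_mono (prod_mono le_rfl (subset_univ _)) le_rfl
    · exact e3 r' ⟨he.1.2, le_rfl⟩

/-- A functional which does not increase over the cells of a grid is non-increasing along a path
with at most one jump per cell. -/
lemma IsCellStep.antitoneOn {S E₁ E₂ : Type*} [MeasurableSpace E₁] [MeasurableSpace E₂]
    {N₁ : Measure (ℝ≥0 × E₁)} {N₂ : Measure (ℝ≥0 × E₂)} {T₁ : E₁ → S → S} {T₂ : E₂ → S → S}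
    {z : ℝ≥0 → S} {t : ℝ≥0} {j : ℕ} {ψ : S → ℝ≥0∞}
    (h : ∀ k < 2 ^ j, IsCellStep N₁ N₂ T₁ T₂ z (gridPoint t j k) (gridPoint t j (k + 1)))
    (hψ : ∀ k < 2 ^ j, ψ (z (gridPoint t j (k + 1))) ≤ ψ (z (gridPoint t j k))) :
    AntitoneOn (fun s => ψ (z s)) (Iic t) := by
  have key : ∀ n ≤ 2 ^ j, ∀ u v, u ≤ v → v ≤ gridPoint t j n → ψ (z v) ≤ ψ (z u) := by
    intro n
    induction n with
    | zero =>
      intro _ u v huv hv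
      rw [gridPoint_zero] at hv
      have hv0 : v = 0 := nonpos_iff_eq_zero.1 hv
      have hu0 : u = 0 := nonpos_iff_eq_zero.1 (huv.trans hv)
      rw [hv0, hu0]
    | succ n ih =>
      intro hn u v huv hv
      rcases le_or_gt v (gridPoint t j n) with hvn | hvn
      · exact ih (Nat.le_of_succ_le hn) u v huv hvn
      obtain ⟨s, hs, h1, h2, -⟩ := h n hn
      have hcell : ∀ u, gridPoint t j n ≤ u → u ≤ v → ψ (z v) ≤ ψ (z u) := by
        intro u hu huv
        rcases lt_or_ge v s with hvs | hvs
        · rw [h1 v ⟨hu.trans huv, hvs⟩, h1 u ⟨hu, huv.trans_lt hvs⟩]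
        · rw [h2 v ⟨hvs, hv⟩]
          rcases lt_or_ge u s with hus | hus
          · rw [h1 u ⟨hu, hus⟩]
            exact hψ n hn
          · rw [h2 u ⟨hus, huv.trans hv⟩]
      rcases le_or_gt (gridPoint t j n) u with hu | hu
      · exact hcell u hu huv
      · exact (hcell _ le_rfl hvn.le).trans (ih (Nat.le_of_succ_le hn) u _ hu.le le_rfl)
  intro u _ v hv huv
  exact key (2 ^ j) le_rfl u v huv ((show v ≤ t from hv).trans_eq (gridPoint_last t j).symm)

lemma measurable_restrict_measure {E : Type*} [MeasurableSpace E] {D : Set E}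
    (hD : MeasurableSet D) : Measurable fun μ : Measure E => μ.restrict D := by
  refine Measure.measurable_of_measurable_coe _ fun A hA => ?_
  simp_rw [Measure.restrict_apply hA]
  exact Measure.measurable_coe (hA.inter hD)

lemma canonicalFiltration_mono {Ω E : Type*} [MeasurableSpace E] (N : Ω → Measure (ℝ≥0 × E)) :
    Monotone (canonicalFiltration N) := by
  intro r s hrs
  refine Measurable.comap_le ?_
  have h : (fun ω => (N ω).restrict (Iic r ×ˢ univ)) =
      (fun μ : Measure (ℝ≥0 × E) => μ.restrict (Iic r ×ˢ univ)) ∘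
        fun ω => (N ω).restrict (Iic s ×ˢ univ) := by
    funext ω
    rw [Function.comp_apply, Measure.restrict_restrict (measurableSet_Iic.prod .univ),
      inter_eq_left.2 (prod_mono (Iic_subset_Iic.2 hrs) le_rfl)]
  rw [h]
  exact (measurable_restrict_measure (measurableSet_Iic.prod .univ)).comp (comap_measurable _)

lemma canonicalFiltration_le_comap {Ω E : Type*} [MeasurableSpace E]
    (N : Ω → Measure (ℝ≥0 × E)) (r : ℝ≥0) :
    canonicalFiltration N r ≤ MeasurableSpace.comap N inferInstance := by
  refine Measurable.comap_le ?_
  exact (measurable_restrict_measure (measurableSet_Iic.prod .univ)).comp (comap_measurable _)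

section Driving

variable {Ω : Type*} [mΩ : MeasurableSpace Ω] {P : Measure Ω}
  {β : Measure Ratios} {N : Ω → Measure CoagSpace} {M : Ω → Measure FragSpace}

/-- The information available at time `r` is independent of the later events of one of two
independent Poisson measures. -/
lemma indep_filtration_comap [IsProbabilityMeasure P] {E E' : Type*} [MeasurableSpace E]
    [MeasurableSpace E']
    {N : Ω → Measure (ℝ≥0 × E)} {N' : Ω → Measure (ℝ≥0 × E')} {ν : Measure (ℝ≥0 × E)}
    (hN : IsPoissonMeasure P N ν) (hN' : Measurable N') (hind : IndepFun N N' P) (r : ℝ≥0)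
    {C : Set (ℝ≥0 × E)} (hC : MeasurableSet C) (hCr : C ⊆ Ioi r ×ˢ univ) :
    Indep (canonicalFiltration N r ⊔ canonicalFiltration N' r)
      (MeasurableSpace.comap (fun ω => N ω C) inferInstance) P := by
  have hNle : MeasurableSpace.comap N inferInstance ≤ mΩ := hN.measurable.comap_le
  have hN'le : MeasurableSpace.comap N' inferInstance ≤ mΩ := hN'.comap_le
  have hCle : MeasurableSpace.comap (fun ω => N ω C) inferInstance ≤
      MeasurableSpace.comap N inferInstance :=
    ((Measure.measurable_coe hC).comp (comap_measurable N)).comap_le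
  have hle := canonicalFiltration_le_comap N r
  have hle' := canonicalFiltration_le_comap N' r
  refine indep_sup_left_of_indep_sup (hle.trans hNle) (hCle.trans hNle) (hle'.trans hN'le)
    (hN.indep_comap_restrict (measurableSet_Iic.prod .univ) hC ?_) ?_
  · refine disjoint_left.2 fun e he he' => ?_
    have h1 : e.1 ≤ r := he.1
    have h2 : r < e.1 := (hCr he').1
    exact absurd h1 (not_le.2 h2)
  · exact indep_of_indep_of_le_left (indep_of_indep_of_le_right hind hle') (sup_le hle hCle)

variable {p : ℝ} {q : ℝ} {K : ℝ≥0 → ℝ≥0 → ℝ≥0} {F : ℝ≥0 → ℝ≥0} {m m' : ℕ → ℝ≥0}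
  {X X' : ℝ≥0 → Ω → ℕ → ℝ≥0}

/-- The set of times at which the equation is used: the points of the dyadic grids of `[0, t]`
and a countable dense set. -/
def equationTimes (t : ℝ≥0) : Set ℝ≥0 :=
  range (TopologicalSpace.denseSeq ℝ≥0) ∪ range fun a : ℕ × ℕ => gridPoint t a.1 a.2

lemma countable_equationTimes (t : ℝ≥0) : (equationTimes t).Countable :=
  (countable_range _).union (countable_range _)

lemma dense_equationTimes (t : ℝ≥0) : Dense (equationTimes t) := by
  refine (TopologicalSpace.denseRange_denseSeq ℝ≥0).mono ?_
  rintro _ ⟨n, rfl⟩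
  exact Or.inl ⟨n, rfl⟩

lemma gridPoint_mem_equationTimes (t : ℝ≥0) (j k : ℕ) : gridPoint t j k ∈ equationTimes t :=
  Or.inr ⟨(j, k), rfl⟩

lemma IsFiniteSolution.ae_exists_isSolutionPath (hp : 0 < p) (hq : 0 ≤ q)
    (hK : IsCoagulationKernel p K) (hF : IsFragmentationKernel q F)
    (hX : IsFiniteSolution P p K F m N M X) (t : ℝ≥0) :
    ∀ᵐ ω ∂P, ∃ l₀, ∀ l ≥ l₀,
      IsSolutionPath p K F m (N ω) (M ω) (equationTimes t) l t fun s => X s ω := by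
  have heq : ∀ᵐ ω ∂P, ∀ u ∈ equationTimes t, PathEquation K F m (fun s => X s ω) (N ω) (M ω) u :=
    (ae_ball_iff (countable_equationTimes t)).2 fun u _ => hX.equation u
  filter_upwards [hX.cadlag, hX.finite, heq] with ω h1 h2 h3
  obtain ⟨n, hn⟩ := h2 t
  obtain ⟨l₀, hl₀⟩ := exists_region hp hq hK hF h1 hn
  exact ⟨l₀, fun l hl => ⟨h1, h3, fun s hs => (hl₀ l hl s hs).1, fun s hs => (hl₀ l hl s hs).2⟩⟩

lemma IsDrivingPair.ae_eventually_isCellStep [IsProbabilityMeasure P]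
    (h : IsDrivingPair P β N M) [IsFiniteMeasure β]
    (hp : 0 < p) (hq : 0 ≤ q) (hK : IsCoagulationKernel p K) (hF : IsFragmentationKernel q F)
    (hX : IsFiniteSolution P p K F m N M X) (hX' : IsFiniteSolution P p K F m' N M X') {t : ℝ≥0}
    (ht : 0 < t) :
    ∀ᵐ ω ∂P, ∃ j₀, ∀ j ≥ j₀, ∀ k < 2 ^ j, IsCellStep (E₁ := CoagMark) (E₂ := FragMark) (N ω) (M ω)
      (coagPairStep K) (fragPairStep F) (fun s => (X s ω, X' s ω)) (gridPoint t j k)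
      (gridPoint t j (k + 1)) := by
  have hone : ∀ᵐ ω ∂P, ∀ l : ℕ, ∃ j₀, ∀ j ≥ j₀, ∀ k < 2 ^ j,
      AtMostOneEvent (E₁ := CoagMark) (E₂ := FragMark) (N ω) (M ω) (coagRegion l) (fragRegion l)
        (gridPoint t j k) (gridPoint t j (k + 1)) :=
    ae_all_iff.2 fun l => ae_eventually_atMostOneEvent (μ₁ := coagMarkIntensity)
      (μ₂ := fragMarkIntensity β) h.coag h.frag h.indep (measurableSet_coagRegion l)
      (measurableSet_fragRegion l) (coagMarkIntensity_coagRegion_lt_top l)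
      (fragMarkIntensity_fragRegion_lt_top β l) t
  filter_upwards [hone, hX.ae_exists_isSolutionPath hp hq hK hF t,
    hX'.ae_exists_isSolutionPath hp hq hK hF t, h.coag.point_measure, h.frag.point_measure]
    with ω h1 ⟨l₁, hl₁⟩ ⟨l₂, hl₂⟩ hNω hMω
  obtain ⟨j₀, hj₀⟩ := h1 (max l₁ l₂)
  refine ⟨j₀, fun j hj k hk => ?_⟩
  exact (hl₁ _ (le_max_left _ _)).isCellStep hp (hl₂ _ (le_max_right _ _)) (dense_equationTimes t)
    (gridPoint_mem_equationTimes t j k) (gridPoint_mem_equationTimes t j (k + 1))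
    ((gridPoint_mono t j hk).trans_eq (gridPoint_last t j)) (gridPoint_lt_succ ht j k) hNω hMω
    (hj₀ j hj k hk)

lemma IsSolution.ae_zero_eq (hX : IsSolution P p K F m N M X) : ∀ᵐ ω ∂P, X 0 ω = m := by
  filter_upwards [hX.equation 0] with ω h
  funext k
  have h1 : coagIntegrand K (fun s => X s ω) 0 k = fun _ => 0 := by
    funext ⟨s, e, z⟩
    simp [coagIntegrand]
  have h2 : fragIntegrand F (fun s => X s ω) 0 k = fun _ => 0 := by
    funext ⟨s, i, θ, z⟩
    simp [fragIntegrand]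
  have h3 := (h k).2.2
  rw [h1, h2] at h3
  simp only [integral_zero, add_zero] at h3
  exact_mod_cast h3

/-- Almost surely, no fragmentation event creates mass. -/
lemma IsDrivingPair.ae_no_gain [SFinite β] (h : IsDrivingPair P β N M)
    (hβ : IsDislocationMeasure p β) :
    ∀ᵐ ω ∂P, M ω {e | 1 < ∑' k, (e.2.2.1.1 k : ℝ≥0∞)} = 0 := by
  set bad : Set Ratios := {θ | 1 < ∑' k, (θ.1 k : ℝ≥0∞)} with hbad
  have hm : MeasurableSet bad := by
    refine measurableSet_lt measurable_const (Measurable.tsum fun k => ?_)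
    exact measurable_coe_nnreal_ennreal.comp ((measurable_pi_apply k).comp measurable_subtype_coe)
  have hset : {e : FragSpace | 1 < ∑' k, (e.2.2.1.1 k : ℝ≥0∞)} =
      univ ×ˢ univ ×ˢ bad ×ˢ univ := by ext e; simp [hbad]
  rw [hset]
  have hM : MeasurableSet (univ ×ˢ univ ×ˢ bad ×ˢ univ : Set FragSpace) :=
    MeasurableSet.univ.prod (MeasurableSet.univ.prod (hm.prod .univ))
  have h0 : fragIntensity β (univ ×ˢ univ ×ˢ bad ×ˢ univ) = 0 := by
    have hb : β bad = 0 := hβ.no_gain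
    rw [fragIntensity, Measure.prod_prod, Measure.prod_prod, Measure.prod_prod, hb]
    simp
  have h1 := h.frag.lintegral_apply hM (by rw [h0]; exact ENNReal.zero_lt_top)
  rw [h0, lintegral_eq_zero_iff (h.frag.measurable_apply hM)] at h1
  exact h1

lemma IsDrivingPair.ae_antitone_massNorm_one [IsProbabilityMeasure P]
    (h : IsDrivingPair P β N M) [IsFiniteMeasure β]
    (hβ : IsDislocationMeasure p β) (hp : 0 < p) (hq : 0 ≤ q) (hK : IsCoagulationKernel p K)
    (hF : IsFragmentationKernel q F) (hX : IsFiniteSolution P p K F m N M X) :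
    ∀ᵐ ω ∂P, Antitone fun t : ℝ≥0 => massNorm 1 (X t ω) := by
  have hstep := ae_all_iff.2 fun n : ℕ => h.ae_eventually_isCellStep hp hq hK hF hX hX
    (t := (n + 1 : ℝ≥0)) (by positivity)
  filter_upwards [hstep, h.ae_no_gain hβ, hX.cadlag] with ω h1 h2 h3 u v huv
  obtain ⟨n, hn⟩ := exists_nat_ge v
  obtain ⟨j, hj⟩ := h1 n
  have hcells := hj j le_rfl
  have hψ : ∀ k < 2 ^ j, massNorm 1 (X (gridPoint (n + 1) j (k + 1)) ω) ≤
      massNorm 1 (X (gridPoint (n + 1) j k) ω) := by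
    intro k hk
    have hanti := h3.antitone (gridPoint (n + 1) j k)
    obtain ⟨-, -, -, -, hc | ⟨s, e, -, hc⟩ | ⟨s, e, hle, hc⟩⟩ := hcells k hk
    · exact (congrArg (massNorm 1) (congrArg Prod.fst hc)).le
    · rw [show X (gridPoint (n + 1) j (k + 1)) ω = _ from congrArg Prod.fst hc]
      simp only [coagPairStep, coagStep]
      split_ifs
      · exact massNorm_coalesce_le one_pos le_rfl hanti e.1.2.ne
      · exact le_rfl
    · rw [show X (gridPoint (n + 1) j (k + 1)) ω = _ from congrArg Prod.fst hc]
      simp only [fragPairStep, fragStep]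
      split_ifs
      · refine massNorm_one_fragment_le hanti _ _ (not_lt.1 fun hbad => ?_)
        have hd : Measure.dirac ((s, e) : ℝ≥0 × FragMark)
            {e | 1 < ∑' k, (e.2.2.1.1 k : ℝ≥0∞)} ≤ M ω {e | 1 < ∑' k, (e.2.2.1.1 k : ℝ≥0∞)} :=
          (hle.trans Measure.restrict_le_self) _
        rw [h2, Measure.dirac_apply_of_mem (show ((s, e) : ℝ≥0 × FragMark) ∈ _ from hbad)] at hd
        exact absurd hd (by simp)
      · exact le_rfl
  have hvn : v ≤ (n + 1 : ℝ≥0) := hn.trans (by simp)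
  exact IsCellStep.antitoneOn hcells (ψ := fun z => massNorm 1 z.1) hψ
    (show u ∈ Iic (n + 1 : ℝ≥0) from huv.trans hvn) hvn huv

lemma massNorm_lt_top_of_mem_ellZeroPlus {p : ℝ} (hp : 0 < p) {m : ℕ → ℝ≥0} (hm : m ∈ ellZeroPlus) :
    massNorm p m < ∞ := by
  obtain ⟨hanti, k, hk⟩ := hm
  have h0 : ∀ l ∉ Finset.range k, (m l : ℝ≥0∞) ^ p = 0 := by
    intro l hl
    have : m l = 0 := nonpos_iff_eq_zero.1 ((hanti (by simpa using hl)).trans hk.le)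
    simp [this, hp]
  rw [massNorm, tsum_eq_sum h0]
  exact ENNReal.sum_lt_top.2 fun l _ => ENNReal.rpow_lt_top_of_nonneg hp.le ENNReal.coe_ne_top

lemma coe_le_massNorm_one (x : ℕ → ℝ≥0) (k : ℕ) : (x k : ℝ≥0∞) ≤ massNorm 1 x := by
  have := ENNReal.le_tsum (f := fun k => (x k : ℝ≥0∞) ^ (1 : ℝ)) k
  simpa [massNorm] using this

/-- Almost surely, the masses remain bounded by the initial total mass. -/
lemma IsDrivingPair.ae_coe_le_massNorm_one [IsProbabilityMeasure P]
    (h : IsDrivingPair P β N M) [IsFiniteMeasure β]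
    (hβ : IsDislocationMeasure p β) (hp : 0 < p) (hq : 0 ≤ q) (hK : IsCoagulationKernel p K)
    (hF : IsFragmentationKernel q F) (hX : IsFiniteSolution P p K F m N M X) :
    ∀ᵐ ω ∂P, ∀ t k, (X t ω k : ℝ≥0∞) ≤ massNorm 1 m := by
  filter_upwards [h.ae_antitone_massNorm_one hβ hp hq hK hF hX, hX.ae_zero_eq] with ω h1 h2 t k
  refine (coe_le_massNorm_one _ k).trans ((h1 (zero_le (a := t))).trans ?_)
  simp only [h2, le_refl]

end Driving

/-! ### Moment bounds for the solutions -/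

section Bounds

variable {Ω : Type*} [mΩ : MeasurableSpace Ω] {P : Measure Ω} [IsProbabilityMeasure P]
  {β : Measure Ratios} [IsFiniteMeasure β] {N : Ω → Measure CoagSpace} {M : Ω → Measure FragSpace}
  {p q : ℝ} {K : ℝ≥0 → ℝ≥0 → ℝ≥0} {F : ℝ≥0 → ℝ≥0} {m m' : ℕ → ℝ≥0} {X X' : ℝ≥0 → Ω → ℕ → ℝ≥0}

/-- The bound on the supremum of a stopped functional, for the pair of two solutions driven by the
same Poisson measures. -/
lemma IsDrivingPair.lintegral_stoppedSup_le (h : IsDrivingPair P β N M)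
    (hp : 0 < p) (hq : 0 ≤ q) (hK : IsCoagulationKernel p K) (hF : IsFragmentationKernel q F)
    (hX : IsFiniteSolution P p K F m N M X) (hX' : IsFiniteSolution P p K F m' N M X')
    {φ : (ℕ → ℝ≥0) × (ℕ → ℝ≥0) → ℝ≥0∞} (hφ : Measurable φ) {D : Set ((ℕ → ℝ≥0) × (ℕ → ℝ≥0))}
    (hD : MeasurableSet D) {c : ℝ≥0}
    (hdrift : ∀ r, ∀ᵐ ω ∂P, (X r ω, X' r ω) ∈ D →
      ∫⁻ e, (φ (coagPairStep K e (X r ω, X' r ω)) - φ (X r ω, X' r ω)) ∂coagMarkIntensity +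
        ∫⁻ e, (φ (fragPairStep F e (X r ω, X' r ω)) - φ (X r ω, X' r ω)) ∂fragMarkIntensity β ≤
          c * φ (X r ω, X' r ω))
    {R : ℝ≥0} (hR : ∀ z ∈ D, φ z ≤ R) (t : ℝ≥0) :
    AEMeasurable (fun ω => stoppedSup φ D (fun s => (X s ω, X' s ω)) t) P ∧
      ∫⁻ ω, stoppedSup φ D (fun s => (X s ω, X' s ω)) t ∂P ≤
        φ (m, m') * ENNReal.ofReal (Real.exp (c * t)) := by
  have hz₀ : ∀ᵐ ω ∂P, (X 0 ω, X' 0 ω) = (m, m') := by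
    filter_upwards [hX.ae_zero_eq, hX'.ae_zero_eq] with ω h1 h2
    rw [h1, h2]
  rcases eq_or_ne t 0 with rfl | ht
  · have hae : (fun ω => stoppedSup φ D (fun s => (X s ω, X' s ω)) 0) =ᵐ[P]
        fun _ => φ (m, m') := by
      filter_upwards [hz₀] with ω hω
      rw [← hω]
      refine le_antisymm (iSup₂_le fun s hs => ?_) ?_
      · rw [nonpos_iff_eq_zero.1 hs.1]
      · exact le_iSup₂_of_le (f := fun s (_ : s ≤ 0 ∧ ∀ r < s, (X r ω, X' r ω) ∈ D) =>
          φ (X s ω, X' s ω)) 0 ⟨le_rfl, fun r hr => absurd hr not_lt_zero⟩ le_rfl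
    refine ⟨aemeasurable_const.congr hae.symm, ?_⟩
    rw [lintegral_congr_ae hae]
    simp
  have hNle : ∀ r, canonicalFiltration N r ≤ mΩ := fun r =>
    (canonicalFiltration_le_comap N r).trans h.coag.measurable.comap_le
  have hMle : ∀ r, canonicalFiltration M r ≤ mΩ := fun r =>
    (canonicalFiltration_le_comap M r).trans h.frag.measurable.comap_le
  exact CoalFrag.lintegral_stoppedSup_le (E₁ := CoagMark) (E₂ := FragMark)
    (μ₁ := coagMarkIntensity) (μ₂ := fragMarkIntensity β) h.coag h.frag
    (𝓕 := fun r => canonicalFiltration N r ⊔ canonicalFiltration M r)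
    (fun r => sup_le (hNle r) (hMle r))
    (fun r s hrs => sup_le_sup (canonicalFiltration_mono N hrs) (canonicalFiltration_mono M hrs))
    (fun r C hC hCr => indep_filtration_comap h.coag h.frag.measurable h.indep r hC hCr)
    (fun r C hC hCr => by
      rw [sup_comm]
      exact indep_filtration_comap h.frag h.coag.measurable h.indep.symm r hC hCr)
    (Z := fun s ω => (X s ω, X' s ω)) (fun r => (hX.adapted r).prodMk (hX'.adapted r))
    (measurable_coagPairStep (hK.measurable hp)) (measurable_fragPairStep hF.measurable)
    hφ hD (h.ae_eventually_isCellStep hp hq hK hF hX hX' (pos_iff_ne_zero.2 ht)) hdrift hR hz₀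

/-- On a bounded time interval a path takes only finitely many values, of finite norm. -/
lemma IsDrivingPair.ae_exists_massNorm_le (h : IsDrivingPair P β N M)
    (hp : 0 < p) (hq : 0 ≤ q) (hK : IsCoagulationKernel p K) (hF : IsFragmentationKernel q F)
    (hX : IsFiniteSolution P p K F m N M X) (t : ℝ≥0) :
    ∀ᵐ ω ∂P, ∃ B < ∞, ∀ s ≤ t, massNorm p (X s ω) ≤ B := by
  have ht : 0 < t + 1 := by positivity
  filter_upwards [h.ae_eventually_isCellStep hp hq hK hF hX hX ht, hX.cadlag] with ω ⟨j, hj⟩ hc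
  refine ⟨∑ k ∈ Finset.range (2 ^ j + 1), massNorm p (X (gridPoint (t + 1) j k) ω),
    ENNReal.sum_lt_top.2 fun k _ => (hc.mem_ell _).2, fun s hs => ?_⟩
  have h1 := stoppedSup_eq_gridSup (φ := fun z => massNorm p z.1) (D := univ) (hj j le_rfl)
  have h2 : massNorm p (X s ω) ≤
      stoppedSup (fun z => massNorm p z.1) univ (fun s => (X s ω, X s ω)) (t + 1) :=
    le_iSup₂_of_le (f := fun s (_ : s ≤ t + 1 ∧ ∀ r < s, (X r ω, X r ω) ∈ univ) =>
      massNorm p (X s ω)) s ⟨hs.trans (by simp), fun _ _ => mem_univ _⟩ le_rfl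
  rw [h1] at h2
  refine h2.trans (iSup_le fun k => ?_)
  split_ifs with hk
  · exact Finset.single_le_sum (f := fun k => massNorm p (X (gridPoint (t + 1) j k) ω))
      (fun _ _ => zero_le) (Finset.mem_range.2 (Nat.lt_succ_of_le hk.1))
  · exact zero_le

lemma IsFragmentationKernel.supRate_lt_top (hq : 0 ≤ q) (hF : IsFragmentationKernel q F)
    (hm : massNorm 1 m < ∞) : supRate F m < ∞ := by
  obtain ⟨b, hb⟩ := hF.exists_bound hq (massNorm 1 m).toNNReal
  refine lt_of_le_of_lt (iSup₂_le fun x hx => ?_) (ENNReal.coe_lt_top (r := b))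
  refine ENNReal.coe_le_coe.2 (hb x ?_)
  rwa [← ENNReal.coe_le_coe, ENNReal.coe_toNNReal hm.ne]

/-- The mean growth of `‖·‖_p`: coalescences decrease it, and a fragmentation of a particle of mass
`y` increases it by at most `y ^ p` times the integrand of `C_β^p`. -/
lemma lintegral_massNorm_step_sub_le (hp : 0 < p) (hp1 : p ≤ 1) (hF : IsFragmentationKernel q F)
    {x : ℕ → ℝ≥0} (hx : Antitone x) (hxm : ∀ k, (x k : ℝ≥0∞) ≤ massNorm 1 m) :
    ∫⁻ e, (massNorm p (coagStep K e x) - massNorm p x) ∂coagMarkIntensity +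
      ∫⁻ e, (massNorm p (fragStep F e x) - massNorm p x) ∂fragMarkIntensity β ≤
        supRate F m * betaConst p β * massNorm p x := by
  have h1 : ∀ e, massNorm p (coagStep K e x) - massNorm p x = 0 := by
    intro e
    refine tsub_eq_zero_of_le ?_
    unfold coagStep
    split_ifs
    · exact massNorm_coalesce_le hp hp1 hx e.1.2.ne
    · exact le_rfl
  simp only [h1, lintegral_zero, zero_add]
  have h0 : ∀ e, fragStep F e (0 : ℕ → ℝ≥0) = 0 := by
    intro e
    unfold fragStep
    split_ifs
    · exact fragment_of_eq_zero (antitone_const (c := (0 : ℝ≥0))) _ rfl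
    · rfl
  have h2 := lintegral_delta_fragStep_sub_le hp hp1 (F := F) β hx (x' := 0)
    (antitone_const (c := (0 : ℝ≥0)) : Antitone (0 : ℕ → ℝ≥0)) (B := supRate F m) (L := 0)
    (fun k => le_iSup₂_of_le (f := fun (y : ℝ≥0) (_ : (y : ℝ≥0∞) ≤ massNorm 1 m) => (F y : ℝ≥0∞))
      (x k) (hxm k) le_rfl)
    (fun k => by simp [hF.zero]) (fun k _ hk => absurd hk (by simp))
  simpa only [h0, ← massNorm_eq_delta_zero hp, add_zero] using h2

/-- The bound holds for the path stopped when its norm reaches a level `R`, and `R` tends to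
infinity by monotone convergence. -/
theorem IsDrivingPair.lintegral_supNorm_le (h : IsDrivingPair P β N M) (hp : 0 < p) (hp1 : p ≤ 1)
    (hq : 0 ≤ q) (hK : IsCoagulationKernel p K) (hF : IsFragmentationKernel q F)
    (hβ : IsDislocationMeasure p β) (hm : m ∈ ellZeroPlus)
    (hX : IsFiniteSolution P p K F m N M X) (t : ℝ≥0) :
    AEMeasurable (supNorm p X t) P ∧
      ∫⁻ ω, supNorm p X t ω ∂P ≤ massNorm p m * ENNReal.ofReal (Real.exp
        ((supRate F m).toReal * (betaConst p β).toReal * t)) := by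
  set φ : (ℕ → ℝ≥0) × (ℕ → ℝ≥0) → ℝ≥0∞ := fun z => massNorm p z.1 with hφdef
  have hφ : Measurable φ := (measurable_massNorm p).comp measurable_fst
  set c : ℝ≥0 := (supRate F m).toNNReal * (betaConst p β).toNNReal with hc
  have hce : (c : ℝ≥0∞) = supRate F m * betaConst p β := by
    rw [hc, ENNReal.coe_mul, ENNReal.coe_toNNReal
      (hF.supRate_lt_top hq (massNorm_lt_top_of_mem_ellZeroPlus one_pos hm)).ne,
      ENNReal.coe_toNNReal hβ.const_lt_top.ne]
  have hdrift : ∀ r, ∀ᵐ ω ∂P,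
      ∫⁻ e, (φ (coagPairStep K e (X r ω, X r ω)) - φ (X r ω, X r ω)) ∂coagMarkIntensity +
        ∫⁻ e, (φ (fragPairStep F e (X r ω, X r ω)) - φ (X r ω, X r ω)) ∂fragMarkIntensity β ≤
          c * φ (X r ω, X r ω) := by
    intro r
    filter_upwards [hX.cadlag, h.ae_coe_le_massNorm_one hβ hp hq hK hF hX] with ω h1 h2
    rw [hce]
    exact lintegral_massNorm_step_sub_le hp hp1 hF (h1.antitone r) (h2 r)
  have key : ∀ R : ℕ, _ := fun R => h.lintegral_stoppedSup_le hp hq hK hF hX hX hφ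
    (D := {z | φ z < (R : ℝ≥0)}) (measurableSet_lt hφ measurable_const)
    (fun r => (hdrift r).mono fun ω hω _ => hω) (fun z hz => le_of_lt hz) t
  have hmono : ∀ ω, Monotone fun R : ℕ =>
      stoppedSup φ {z | φ z < (R : ℝ≥0)} (fun s => (X s ω, X s ω)) t := by
    intro ω R R' hRR
    refine iSup₂_le fun s hs => ?_
    refine le_iSup₂_of_le (f := fun s (_ : s ≤ t ∧ ∀ r < s, (X r ω, X r ω) ∈
      {z | φ z < (R' : ℝ≥0)}) => φ (X s ω, X s ω)) s ⟨hs.1, fun r hr => ?_⟩ le_rfl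
    have hRR' : ((R : ℝ≥0) : ℝ≥0∞) ≤ (R' : ℝ≥0) := by exact_mod_cast hRR
    exact lt_of_lt_of_le (show φ (X r ω, X r ω) < (R : ℝ≥0) from hs.2 r hr) hRR'
  have hsup : supNorm p X t =ᵐ[P] fun ω => ⨆ R : ℕ,
      stoppedSup φ {z | φ z < (R : ℝ≥0)} (fun s => (X s ω, X s ω)) t := by
    filter_upwards [h.ae_exists_massNorm_le hp hq hK hF hX t] with ω ⟨B, hB, hBs⟩
    obtain ⟨R, hR⟩ := ENNReal.exists_nat_gt hB.ne
    refine le_antisymm (iSup₂_le fun s hs => ?_) (iSup_le fun R => iSup₂_le fun s hs => ?_)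
    · refine le_iSup_of_le R (le_iSup₂_of_le (f := fun s (_ : s ≤ t ∧ ∀ r < s, (X r ω, X r ω) ∈
        {z | φ z < (R : ℝ≥0)}) => φ (X s ω, X s ω)) s ⟨hs, fun r hr => ?_⟩ le_rfl)
      exact (hBs r (hr.le.trans hs)).trans_lt (by exact_mod_cast hR)
    · exact le_iSup₂_of_le (f := fun s (_ : s ≤ t) => massNorm p (X s ω)) s hs.1 le_rfl
  refine ⟨(AEMeasurable.iSup fun R => (key R).1).congr hsup.symm, ?_⟩
  rw [lintegral_congr_ae hsup, lintegral_iSup' (fun R => (key R).1) (Eventually.of_forall hmono)]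
  exact iSup_le fun R => (key R).2

lemma supDelta_eq_stoppedSup {Ω : Type*} (X X' : ℝ≥0 → Ω → ℕ → ℝ≥0) (p x : ℝ) (t : ℝ≥0) (ω : Ω) :
    supDelta p X X' x t ω = stoppedSup (fun z => delta p z.1 z.2)
      {z | massNorm p z.1 < ENNReal.ofReal x ∧ massNorm p z.2 < ENNReal.ofReal x}
      (fun s => (X s ω, X' s ω)) t := by
  unfold supDelta stoppedSup
  have hτ : ∀ (Y : ℝ≥0 → Ω → ℕ → ℝ≥0) (s : ℝ≥0), (s : ℝ≥0∞) ≤ hittingLevel p Y x ω ↔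
      ∀ r < s, massNorm p (Y r ω) < ENNReal.ofReal x := by
    intro Y s
    simp only [hittingLevel, le_iInf_iff, ENNReal.coe_le_coe]
    refine forall_congr' fun r => ?_
    rw [← not_lt, ← not_lt]
    exact not_imp_not
  refine iSup_congr fun s => iSup_congr_Prop ?_ fun _ => rfl
  rw [le_min_iff, le_min_iff, ENNReal.coe_le_coe, hτ, hτ]
  exact and_congr_right fun _ =>
    ⟨fun h r hr => ⟨h.1 r hr, h.2 r hr⟩, fun h => ⟨fun r hr => (h r hr).1, fun r hr => (h r hr).2⟩⟩

/-- The mean growth of the distance of two coupled states with masses at most `a`. -/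
lemma lintegral_delta_step_sub_le (hp : 0 < p) (hp1 : p ≤ 1) (hq : 0 ≤ q) {a b : ℝ≥0} {κ μ : ℝ}
    (hκ0 : 0 ≤ κ) (hμ0 : 0 ≤ μ)
    (hκ : ∀ x ∈ Ioc 0 a, ∀ y ∈ Ioc 0 a, ∀ x' ∈ Ioc 0 a, ∀ y' ∈ Ioc 0 a,
      |(K x y : ℝ) - K x' y'| ≤
        κ * (|(x : ℝ) ^ p - (x' : ℝ) ^ p| + |(y : ℝ) ^ p - (y' : ℝ) ^ p|))
    (hμ : ∀ x ∈ Ioc 0 a, ∀ x' ∈ Ioc 0 a, |(F x : ℝ) - F x'| ≤ μ * |(x : ℝ) ^ q - (x' : ℝ) ^ q|)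
    (hb : ∀ x ≤ a, F x ≤ b) {x x' : ℕ → ℝ≥0} (hx : Antitone x) (hx' : Antitone x')
    (hxa : ∀ k, x k ≤ a) (hxa' : ∀ k, x' k ≤ a) :
    ∫⁻ e, (delta p (coagStep K e x) (coagStep K e x') - delta p x x') ∂coagMarkIntensity +
      ∫⁻ e, (delta p (fragStep F e x) (fragStep F e x') - delta p x x') ∂fragMarkIntensity β ≤
        (ENNReal.ofReal (4 * κ) * (massNorm p x + massNorm p x') +
          (b + ENNReal.ofReal (μ * (max (q / p) 1 * (a : ℝ) ^ q))) * betaConst p β) *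
            delta p x x' := by
  rw [add_mul]
  refine add_le_add (lintegral_delta_coagStep_sub_le hp hp1 hx hx' hxa hxa' hκ0 hκ)
    (lintegral_delta_fragStep_sub_le hp hp1 β hx hx' (fun k => ENNReal.coe_le_coe.2 (hb _ (hxa k)))
      (fun k => ENNReal.coe_le_coe.2 (hb _ (hxa' k))) fun k hk hk' => ?_)
  have h1 : (max (x k) (x' k) : ℝ≥0∞) ^ p = ENNReal.ofReal (max (x k : ℝ) (x' k) ^ p) := by
    rw [← ENNReal.ofReal_rpow_of_nonneg (le_max_of_le_left (NNReal.coe_nonneg _)) hp.le,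
      ENNReal.ofReal_max, ENNReal.ofReal_coe_nnreal, ENNReal.ofReal_coe_nnreal]
  rw [h1, ← ENNReal.ofReal_mul (abs_nonneg _), ← ENNReal.ofReal_mul (by positivity)]
  refine ENNReal.ofReal_le_ofReal ?_
  have h2 := abs_rpow_sub_mul_max_rpow_le hp hq (u := x k) (v := x' k) (a := a)
    (by exact_mod_cast hk) (by exact_mod_cast hk') (by exact_mod_cast hxa k)
    (by exact_mod_cast hxa' k)
  calc |(F (x k) : ℝ) - F (x' k)| * max (x k : ℝ) (x' k) ^ p
      ≤ μ * |(x k : ℝ) ^ q - (x' k : ℝ) ^ q| * max (x k : ℝ) (x' k) ^ p :=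
        mul_le_mul_of_nonneg_right (hμ _ ⟨hk, hxa k⟩ _ ⟨hk', hxa' k⟩) (by positivity)
    _ = μ * (|(x k : ℝ) ^ q - (x' k : ℝ) ^ q| * max (x k : ℝ) (x' k) ^ p) := by ring
    _ ≤ μ * (max (q / p) 1 * (a : ℝ) ^ q * |(x k : ℝ) ^ p - (x' k : ℝ) ^ p|) :=
        mul_le_mul_of_nonneg_left h2 hμ0
    _ = _ := by ring

/-- As long as both norms are below `x`, the distance grows in the mean at a rate of at most
`8 κ x` from the coalescences, plus a rate independent of `x` from the fragmentations. -/
theorem IsDrivingPair.lintegral_supDelta_le (h : IsDrivingPair P β N M) (hp : 0 < p) (hp1 : p ≤ 1)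
    (hq : 0 ≤ q) (hK : IsCoagulationKernel p K) (hF : IsFragmentationKernel q F)
    (hβ : IsDislocationMeasure p β) {a b : ℝ≥0} {κ μ : ℝ} (hκ0 : 0 ≤ κ) (hμ0 : 0 ≤ μ)
    (hκ : ∀ x ∈ Ioc 0 a, ∀ y ∈ Ioc 0 a, ∀ x' ∈ Ioc 0 a, ∀ y' ∈ Ioc 0 a,
      |(K x y : ℝ) - K x' y'| ≤
        κ * (|(x : ℝ) ^ p - (x' : ℝ) ^ p| + |(y : ℝ) ^ p - (y' : ℝ) ^ p|))
    (hμ : ∀ x ∈ Ioc 0 a, ∀ x' ∈ Ioc 0 a, |(F x : ℝ) - F x'| ≤ μ * |(x : ℝ) ^ q - (x' : ℝ) ^ q|)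
    (hb : ∀ x ≤ a, F x ≤ b) (hma : massNorm 1 m ≤ a) (hma' : massNorm 1 m' ≤ a)
    (hX : IsFiniteSolution P p K F m N M X) (hX' : IsFiniteSolution P p K F m' N M X')
    (t : ℝ≥0) {x : ℝ} (hx : 0 < x) {C : ℝ}
    (hC : 8 * κ + (b + μ * (max (q / p) 1 * (a : ℝ) ^ q)) * (betaConst p β).toReal ≤ C) :
    AEMeasurable (supDelta p X X' x t) P ∧
      ∫⁻ ω, supDelta p X X' x t ω ∂P ≤
        delta p m m' * ENNReal.ofReal (Real.exp (C * (x + 1) * t)) := by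
  have hC0 : 0 ≤ C := le_trans (by positivity) hC
  have hcR : (((C * (x + 1)).toNNReal : ℝ≥0) : ℝ) = C * (x + 1) :=
    Real.coe_toNNReal _ (by positivity)
  have hφ : Measurable fun z : (ℕ → ℝ≥0) × (ℕ → ℝ≥0) => delta p z.1 z.2 :=
    measurable_delta p measurable_fst measurable_snd
  have hn : Measurable (massNorm p) := measurable_massNorm p
  have key := h.lintegral_stoppedSup_le hp hq hK hF hX hX' hφ
    (D := {z | massNorm p z.1 < ENNReal.ofReal x ∧ massNorm p z.2 < ENNReal.ofReal x})
    ((measurableSet_lt (hn.comp measurable_fst) measurable_const).inter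
      (measurableSet_lt (hn.comp measurable_snd) measurable_const))
    (c := (C * (x + 1)).toNNReal) ?_ (R := 2 * x.toNNReal) ?_ t
  · rw [hcR] at key
    have heq : supDelta p X X' x t = _ := funext fun ω => supDelta_eq_stoppedSup X X' p x t ω
    rw [heq]
    exact key
  · intro r
    filter_upwards [hX.cadlag, hX'.cadlag, h.ae_coe_le_massNorm_one hβ hp hq hK hF hX,
      h.ae_coe_le_massNorm_one hβ hp hq hK hF hX'] with ω h1 h1' h2 h2' hD
    refine (lintegral_delta_step_sub_le hp hp1 hq hκ0 hμ0 hκ hμ hb (h1.antitone r)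
      (h1'.antitone r) (fun k => by exact_mod_cast (h2 r k).trans hma)
      (fun k => by exact_mod_cast (h2' r k).trans hma')).trans (mul_le_mul_left ?_ _)
    calc ENNReal.ofReal (4 * κ) * (massNorm p (X r ω) + massNorm p (X' r ω)) +
          (b + ENNReal.ofReal (μ * (max (q / p) 1 * (a : ℝ) ^ q))) * betaConst p β
        ≤ ENNReal.ofReal (4 * κ) * (ENNReal.ofReal x + ENNReal.ofReal x) +
          (ENNReal.ofReal b + ENNReal.ofReal (μ * (max (q / p) 1 * (a : ℝ) ^ q))) *
            ENNReal.ofReal (betaConst p β).toReal := by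
          rw [ENNReal.ofReal_toReal hβ.const_lt_top.ne, ENNReal.ofReal_coe_nnreal]
          exact add_le_add (mul_le_mul_right (add_le_add hD.1.le hD.2.le) _) le_rfl
      _ = ENNReal.ofReal (8 * κ * x +
          (b + μ * (max (q / p) 1 * (a : ℝ) ^ q)) * (betaConst p β).toReal) := by
          rw [← ENNReal.ofReal_add hx.le hx.le, ← ENNReal.ofReal_mul (by positivity),
            ← ENNReal.ofReal_add (by positivity) (by positivity),
            ← ENNReal.ofReal_mul (by positivity),
            ← ENNReal.ofReal_add (by positivity) (by positivity)]
          congr 1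
          ring
      _ ≤ ENNReal.ofReal (C * (x + 1)) := by
          refine ENNReal.ofReal_le_ofReal ?_
          have h3 : 0 ≤ (b + μ * (max (q / p) 1 * (a : ℝ) ^ q)) * (betaConst p β).toReal := by
            positivity
          nlinarith [mul_le_mul_of_nonneg_right hC (by positivity : 0 ≤ x + 1),
            mul_nonneg h3 hx.le]
  · intro z hz
    refine (delta_le_massNorm_add_massNorm hp _ _).trans ((add_le_add hz.1.le hz.2.le).trans ?_)
    rw [← two_mul, ENNReal.coe_mul]
    exact le_rfl

end Bounds

end CoalFrag

theorem mainTheorem3 (lam alpha : ℝ) (hlam : 0 < lam) (hlam_le : lam ≤ 1) (halpha : 0 ≤ alpha)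
    (K : ℝ≥0 → ℝ≥0 → ℝ≥0) (F : ℝ≥0 → ℝ≥0)
    (hK : CoalFrag.IsCoagulationKernel lam K) (hF : CoalFrag.IsFragmentationKernel alpha F) :
    -- the constant of (ii), as a function of `C_β^lam`, `‖m‖_1` and `‖m'‖_1`
    ∃ C : ℝ≥0∞ → ℝ≥0∞ → ℝ≥0∞ → ℝ, (∀ c a b, 0 < C c a b) ∧
      ∀ (β : Measure CoalFrag.Ratios), CoalFrag.IsDislocationMeasure lam β →
        CoalFrag.IsFiniteDislocation β →
      ∀ (Ω : Type*) [MeasurableSpace Ω] (P : Measure Ω) [IsProbabilityMeasure P]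
        (N : Ω → Measure CoalFrag.CoagSpace) (M : Ω → Measure CoalFrag.FragSpace),
        CoalFrag.IsDrivingPair P β N M →
      ∀ m ∈ CoalFrag.ellZeroPlus, ∀ m' ∈ CoalFrag.ellZeroPlus,
      ∀ X X' : ℝ≥0 → Ω → ℕ → ℝ≥0,
        CoalFrag.IsFiniteSolution P lam K F m N M X →
        CoalFrag.IsFiniteSolution P lam K F m' N M X' →
      -- (i)
      ((∀ᵐ ω ∂P, Antitone fun t : ℝ≥0 => CoalFrag.massNorm 1 (X t ω)) ∧
        ∀ t : ℝ≥0, AEMeasurable (CoalFrag.supNorm lam X t) P ∧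
          ∫⁻ ω, CoalFrag.supNorm lam X t ω ∂P ≤
            CoalFrag.massNorm lam m * ENNReal.ofReal (Real.exp
              ((CoalFrag.supRate F m).toReal * (CoalFrag.betaConst lam β).toReal * t))) ∧
      -- (ii)
      ∀ (t : ℝ≥0) (x : ℝ), 0 < x →
        AEMeasurable (CoalFrag.supDelta lam X X' x t) P ∧
          ∫⁻ ω, CoalFrag.supDelta lam X X' x t ω ∂P ≤
            CoalFrag.delta lam m m' * ENNReal.ofReal (Real.exp
              (C (CoalFrag.betaConst lam β) (CoalFrag.massNorm 1 m) (CoalFrag.massNorm 1 m') *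
                (x + 1) * t)) := by
  have hκ : ∀ a : ℝ≥0, ∃ κ : ℝ, 0 < κ ∧
      ∀ x ∈ Ioc 0 (a + 1), ∀ y ∈ Ioc 0 (a + 1), ∀ x' ∈ Ioc 0 (a + 1), ∀ y' ∈ Ioc 0 (a + 1),
        |(K x y : ℝ) - K x' y'| ≤
          κ * (|(x : ℝ) ^ lam - (x' : ℝ) ^ lam| + |(y : ℝ) ^ lam - (y' : ℝ) ^ lam|) :=
    fun a => hK.holder (a + 1) (by positivity)
  have hμ : ∀ a : ℝ≥0, ∃ μ : ℝ, 0 < μ ∧ ∀ x ∈ Ioc 0 (a + 1), ∀ x' ∈ Ioc 0 (a + 1),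
      |(F x : ℝ) - F x'| ≤ μ * |(x : ℝ) ^ alpha - (x' : ℝ) ^ alpha| :=
    fun a => hF.holder (a + 1) (by positivity)
  choose κ hκ0 hκ using hκ
  choose μ hμ0 hμ using hμ
  choose B hB using fun a : ℝ≥0 => hF.exists_bound halpha (a + 1)
  -- the masses of both systems are bounded by `A + 1`, where `A` is the larger initial total mass
  set C : ℝ≥0∞ → ℝ≥0 → ℝ := fun c A => 8 * κ A +
    (B A + μ A * (max (alpha / lam) 1 * ((A + 1 : ℝ≥0) : ℝ) ^ alpha)) * c.toReal with hC
  refine ⟨fun c a b => C c (max a b).toNNReal, fun c a b => ?_, ?_⟩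
  · have h1 := hκ0 (max a b).toNNReal
    have h2 := hμ0 (max a b).toNNReal
    positivity
  intro β hβ hβ' Ω _ P _ N M h m hm m' hm' X X' hX hX'
  have : IsFiniteMeasure β := ⟨hβ'.finite⟩
  refine ⟨⟨h.ae_antitone_massNorm_one hβ hlam halpha hK hF hX,
    h.lintegral_supNorm_le hlam hlam_le halpha hK hF hβ hm hX⟩, fun t x hx => ?_⟩
  have hle : ∀ y ≤ max (CoalFrag.massNorm 1 m) (CoalFrag.massNorm 1 m'),
      y ≤ (((max (CoalFrag.massNorm 1 m) (CoalFrag.massNorm 1 m')).toNNReal + 1 : ℝ≥0) : ℝ≥0∞) := by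
    intro y hy
    rw [ENNReal.coe_add, ENNReal.coe_toNNReal
      (max_lt (CoalFrag.massNorm_lt_top_of_mem_ellZeroPlus one_pos hm)
      (CoalFrag.massNorm_lt_top_of_mem_ellZeroPlus one_pos hm')).ne]
    exact hy.trans le_self_add
  exact h.lintegral_supDelta_le hlam hlam_le halpha hK hF hβ (hκ0 _).le (hμ0 _).le (hκ _) (hμ _)
    (hB _) (hle _ (le_max_left _ _)) (hle _ (le_max_right _ _)) hX hX' t hx le_rfl
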